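/- Let $b>0$, let $q:[0,b]\to\mathbb{C}$ be continuous, and let $f\in C^2[0,b]$ be a complex-valued solution of $f''=qf$ on $[0,b]$ with $f(0)=1$ and $f(x)\neq0$ for all $x\in[0,b]$. **Notation.** Put $X^{(0)}=\widetilde X^{(0)}=1$ and, for $n\ge1$, $$X^{(n)}(x)=n\int_0^x X^{(n-1)}(s)\,(f^2(s))^{(-1)^n}ds,\qquad \widetilde X^{(n)}(x)=n\int_0^x \widetilde X^{(n-1)}(s)\,(f^2(s))^{(-1)^{n-1}}ds,$$ and let $\varphi_k=fX^{(k)}$ for odd $k$, $\varphi_k=f\widetilde X^{(k)}$ for even $k$. Let $P_n$ be the Legendre polynomials and $p_{j,k}=\int_{-1}^1P_j(y)y^k\,dy$. Define recursively, for $k\ge0$ and $x\in(0,b]$, $$\beta_k(x)=\frac1{p_{k,k}}\Bigl(\frac{\varphi_k(x)}{x^k}-1-\sum_{0\le j<k,\ j\equiv k\,(2)}p_{j,k}\,\beta_j(x)\Bigr)$$ (so $\beta_0=\frac{f-1}2$ and $\beta_1=\frac32(\frac{\varphi_1}{x}-1)$), and $\beta_k(0)=\lim_{x\to0+}\beta_k(x)$.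 Let $J_\nu$ be the Bessel functions of the first kind and $j_k$ the spherical Bessel functions, which are entire. For a function $K$ on $R=\{0\le x\le b,\ |t|\le x\}$ put $Tu(x)=u(x)+\int_{-x}^xK(x,t)u(t)\,dt$, $0\le x\le b$. Call $K$ a transmutation kernel if $K\in C^1(R)$, $T[1]=f$ on $[0,b]$, and for every complex-valued $u\in C^2[-b,b]$ one has $Tu\in C^2[0,b]$ and $\bigl(-\frac{d^2}{dx^2}+q\bigr)T[u]=T[-u'']$ on $[0,b]$. **Theorem.** There is exactly one transmutation kernel $K$ on $R$. With it let $$c(\omega,x)=T[\cos\omega x],\qquad s(\omega,x)=T[\sin\omega x],\qquad K_N(x,t)=\sum_{j=0}^N\frac{\beta_j(x)}{x}P_j\Bigl(\frac tx\Bigr).$$ 1. For every $\omega\in\mathbb{C}$, $c(\omega,\cdot)$ and $s(\omega,\cdot)$ are solutions of $-y''+qy=\omega^2y$ on $[0,b]$. 2. For all $\omega\in\mathbb{C}$ and $x\in[0,b]$, with absolutely convergent series, $$c(\omega,x)=\cos\omega x+2\sum_{n=0}^\infty(-1)^n\beta_{2n}(x)j_{2n}(\omega x),\qquad s(\omega,x)=\sin\omega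 x+2\sum_{n=0}^\infty(-1)^n\beta_{2n+1}(x)j_{2n+1}(\omega x).$$ If $\omega\ne0$ and $x\in(0,b]$, then also, with absolutely convergent series, $$c(\omega,x)=\cos\omega x+\sqrt{\tfrac{2\pi}{\omega x}}\sum_{n=0}^\infty(-1)^n\beta_{2n}(x)J_{2n+1/2}(\omega x),\qquad s(\omega,x)=\sin\omega x+\sqrt{\tfrac{2\pi}{\omega x}}\sum_{n=0}^\infty(-1)^n\beta_{2n+1}(x)J_{2n+3/2}(\omega x),$$ where $\sqrt{2\pi/z}$ means $\sqrt{2\pi}/z^{1/2}$ and the powers of $z$ here and in $J_\nu(z)$ are principal. 3. The two series in spherical Bessel functions converge uniformly in $(\omega,x)\in S\times[0,b]$ for every compact $S\subset\mathbb{C}$. 4. For every $x\in(0,b]$, $K_N(x,t)\to K(x,t)$ as $N\to\infty$, uniformly in $t\in[-x,x]$. 5. For $N\ge0$ let $$c_N(\omega,x)=\cos\omega x+2\sum_{n=0}^{[N/2]}(-1)^n\beta_{2n}(x)j_{2n}(\omega x),\qquad s_N(\omega,x)=\sin\omega x+2\sum_{n=0}^{[(N-1)/2]}(-1)^n\beta_{2n+1}(x)j_{2n+1}(\omega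 x)$$ (the latter sum is empty for $N=0$). Let $\varepsilon_N:[0,b]\to[0,\infty)$ be any function with $|K(x,t)-K_N(x,t)|\le\varepsilon_N(x)$ for all $x\in(0,b]$, $|t|\le x$. Then for all $x\in[0,b]$ $$|c(\omega,x)-c_N(\omega,x)|\le2|x|\,\varepsilon_N(x),\qquad |s(\omega,x)-s_N(\omega,x)|\le2|x|\,\varepsilon_N(x)\qquad\text{for all }\omega\in\mathbb{R},$$ and for every $C>0$ and all $\omega\in\mathbb{C}$ with $|\operatorname{Im}\omega|\le C$ $$|c(\omega,x)-c_N(\omega,x)|\le\frac{2\varepsilon_N(x)\sinh(Cx)}{C},\qquad |s(\omega,x)-s_N(\omega,x)|\le\frac{2\varepsilon_N(x)\sinh(Cx)}{C}.$$ -/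

import Mathlib

open Set Filter Topology

noncomputable section

namespace NeumannBessel

/-! ### Formal powers -/

/-- The recursive integrals `X^{(n)}`: `X^{(0)} = 1` and
`X^{(n)}(x) = n ∫₀ˣ X^{(n-1)}(s) (f(s)²)^{(-1)^n} ds`. -/
def recX (f : ℝ → ℂ) : ℕ → ℝ → ℂ
  | 0 => fun _ => 1
  | n + 1 => fun x =>
      ((n : ℂ) + 1) * ∫ s in (0 : ℝ)..x, recX f n s * ((f s) ^ 2) ^ ((-1 : ℤ) ^ (n + 1))

/-- The recursive integrals `X̃^{(n)}`: `X̃^{(0)} = 1` and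
`X̃^{(n)}(x) = n ∫₀ˣ X̃^{(n-1)}(s) (f(s)²)^{(-1)^(n-1)} ds`. -/
def recXt (f : ℝ → ℂ) : ℕ → ℝ → ℂ
  | 0 => fun _ => 1
  | n + 1 => fun x =>
      ((n : ℂ) + 1) * ∫ s in (0 : ℝ)..x, recXt f n s * ((f s) ^ 2) ^ ((-1 : ℤ) ^ n)

/-- The formal powers `φ_k` associated with `f`. -/
def formalPower (f : ℝ → ℂ) (k : ℕ) (x : ℝ) : ℂ :=
  if Odd k then f x * recX f k x else f x * recXt f k x

/-! ### Legendre polynomials and the coefficients `β_k` -/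

/-- The Legendre polynomial `P_n = (2ⁿ n!)⁻¹ dⁿ/dyⁿ (y² - 1)ⁿ` (Rodrigues' formula). -/
def legendreP (n : ℕ) : Polynomial ℝ :=
  Polynomial.C (1 / ((2 : ℝ) ^ n * (n.factorial : ℝ))) *
    Polynomial.derivative^[n] ((Polynomial.X ^ 2 - 1) ^ n)

/-- `p_{j,k} = ∫_{-1}^{1} P_j(y) y^k dy`. -/
def legendreMoment (j k : ℕ) : ℝ :=
  ∫ y in (-1 : ℝ)..1, (legendreP j).eval y * y ^ k

/-- The coefficients `β_k(x)` for `x ≠ 0`: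
`β_k(x) = p_{kk}⁻¹ (φ_k(x) / x^k - 1 - ∑ p_{jk} β_j(x))`, the sum being over the `j < k` of the same
parity as `k`. Since `p_{00} = 2`, `p_{11} = 2/3` and `φ_0 = f`, this reads
`β_0 = (f - 1) / 2` for `k = 0` and `β_1 = (3/2) (φ_1(x) / x - 1)` for `k = 1`. -/
def betaAux (f : ℝ → ℂ) (x : ℝ) (k : ℕ) : ℂ :=
  (1 / (legendreMoment k k : ℂ)) *
    (formalPower f k x / (x : ℂ) ^ k - 1 -
      ∑ j : Fin k, if (j : ℕ) % 2 = k % 2 then (legendreMoment j k : ℂ) * betaAux f x j else 0)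
termination_by k
decreasing_by exact j.2

/-- The coefficients `β_k` on `[0, b]`; the value at `x = 0` is the limit from the right. -/
def beta (f : ℝ → ℂ) (k : ℕ) (x : ℝ) : ℂ :=
  if x = 0 then limUnder (𝓝[>] (0 : ℝ)) (fun y => betaAux f y k) else betaAux f x k

/-! ### Bessel functions -/

/-- The Bessel function of the first kind `J_ν(z)`, with the principal branch of `(z/2)^ν`. -/
def besselJ (ν z : ℂ) : ℂ :=
  (z / 2) ^ ν * ∑' m : ℕ,
    (-1 : ℂ) ^ m / ((m.factorial : ℂ) * Complex.Gamma (ν + m + 1)) * (z / 2) ^ (2 * m)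

/-- The spherical Bessel function
`j_k(z) = z^k ∑_m (-z²/2)^m / (m! (2k + 2m + 1)!!)`, an entire function of `z`. -/
def sphericalJ (k : ℕ) (z : ℂ) : ℂ :=
  z ^ k * ∑' m : ℕ,
    (-(z ^ 2) / 2) ^ m / ((m.factorial : ℂ) * ((2 * k + 2 * m + 1).doubleFactorial : ℂ))

/-! ### The transmutation operator -/

/-- `T u(x) = u(x) + ∫_{-x}^{x} K(x,t) u(t) dt`. -/
def transmute (K : ℝ → ℝ → ℂ) (u : ℝ → ℂ) (x : ℝ) : ℂ :=
  u x + ∫ t in (-x)..x, K x t * u t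

/-- `K` is the kernel, on the region `0 ≤ x ≤ b`, `|t| ≤ x`, of the transmutation operator `T`
associated with `q` and `f`: it is continuously differentiable there, for all `u ∈ C²[-b,b]` one has
`(-d²/dx² + q) T u = T (-u'')` on `[0,b]`, and `T 1 = f`. -/
structure IsTransmutationKernel (b : ℝ) (q f : ℝ → ℂ) (K : ℝ → ℝ → ℂ) : Prop where
  contDiffOn : ContDiffOn ℝ 1 (fun p : ℝ × ℝ => K p.1 p.2)
    {p : ℝ × ℝ | 0 ≤ p.1 ∧ p.1 ≤ b ∧ |p.2| ≤ p.1}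
  intertwines : ∀ u : ℝ → ℂ, ContDiffOn ℝ 2 u (Icc (-b) b) →
    ContDiffOn ℝ 2 (transmute K u) (Icc 0 b) ∧
    ∀ x ∈ Icc 0 b,
      -(iteratedDerivWithin 2 (transmute K u) (Icc 0 b) x) + q x * transmute K u x =
        transmute K (fun t => -(iteratedDerivWithin 2 u (Icc (-b) b) t)) x
  map_one : ∀ x ∈ Icc 0 b, transmute K (fun _ => 1) x = f x

/-- `y` is a (classical) solution of `-y'' + q y = lam y` on `[0,b]`. -/
def IsSolution (b : ℝ) (q : ℝ → ℂ) (lam : ℂ) (y : ℝ → ℂ) : Prop :=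
  ContDiffOn ℝ 2 y (Icc 0 b) ∧
    ∀ x ∈ Icc 0 b, -(iteratedDerivWithin 2 y (Icc 0 b) x) + q x * y x = lam * y x

/-- `c(ω,x) = T[cos ωx]`. -/
def solC (K : ℝ → ℝ → ℂ) (ω : ℂ) (x : ℝ) : ℂ :=
  transmute K (fun t => Complex.cos (ω * t)) x

/-- `s(ω,x) = T[sin ωx]`. -/
def solS (K : ℝ → ℝ → ℂ) (ω : ℂ) (x : ℝ) : ℂ :=
  transmute K (fun t => Complex.sin (ω * t)) x

/-- `K_N(x,t) = ∑_{j=0}^{N} (β_j(x)/x) P_j(t/x)`. -/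
def kernelPartial (f : ℝ → ℂ) (N : ℕ) (x t : ℝ) : ℂ :=
  ∑ j ∈ Finset.range (N + 1), beta f j x / (x : ℂ) * (((legendreP j).eval (t / x) : ℝ) : ℂ)

/-- The `n`-th term `(-1)ⁿ β_{2n}(x) j_{2n}(ωx)`. -/
def termC (f : ℝ → ℂ) (n : ℕ) (ω : ℂ) (x : ℝ) : ℂ :=
  (-1 : ℂ) ^ n * beta f (2 * n) x * sphericalJ (2 * n) (ω * x)

/-- The `n`-th term `(-1)ⁿ β_{2n+1}(x) j_{2n+1}(ωx)`. -/
def termS (f : ℝ → ℂ) (n : ℕ) (ω : ℂ) (x : ℝ) : ℂ :=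
  (-1 : ℂ) ^ n * beta f (2 * n + 1) x * sphericalJ (2 * n + 1) (ω * x)

/-- `c_N(ω,x) = cos ωx + 2 ∑_{n=0}^{[N/2]} (-1)ⁿ β_{2n}(x) j_{2n}(ωx)`. -/
def approxC (f : ℝ → ℂ) (N : ℕ) (ω : ℂ) (x : ℝ) : ℂ :=
  Complex.cos (ω * x) + 2 * ∑ n ∈ Finset.range (N / 2 + 1), termC f n ω x

/-- `s_N(ω,x) = sin ωx + 2 ∑_{n=0}^{[(N-1)/2]} (-1)ⁿ β_{2n+1}(x) j_{2n+1}(ωx)`; the sum has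
`[(N+1)/2]` terms, none for `N = 0`. -/
def approxS (f : ℝ → ℂ) (N : ℕ) (ω : ℂ) (x : ℝ) : ℂ :=
  Complex.sin (ω * x) + 2 * ∑ n ∈ Finset.range ((N + 1) / 2), termS f n ω x

end NeumannBessel

end

open NeumannBessel

/-!
# Neumann series of Bessel functions for `-y'' + q y = ω² y`

**The kernel.** In characteristic coordinates `u = (x + t)/2`, `v = (x - t)/2` the kernel is
`K(x,t) = H(u,v)`, where `H` solves the Goursat problem `H_{uv} = q(u + v) H`,
`H(u,0) = f'(0)/2 + (1/2) ∫_0^u q`, `H(0,v) = f'(0)/2`; Picard iteration gives a `C¹` solution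
(`exists_goursat`). As `q` is merely continuous, `K` has no second derivatives, and the relation
`(T u)'' = q T u + T u''` cannot be read off from a wave equation for `K`. It is obtained in
`goursat_transmutation` by differentiating `∫_{-x}^{x} K u` twice under the integral sign, choosing
before each differentiation the integration variable for which the derivative of the integrand
exists; only `H_u`, `H_v` and the mixed derivative `H_{uv}` occur.

**Formal powers and uniqueness.** For any transmutation kernel, `T[t^k]` and `φ_k` satisfy the same
recursive initial value problems. Solutions of `y'' = q y` are determined by their data at `0`,
since `f` has no zeros, so `T[t^k] = φ_k` (`IsTransmutationKernel.transmute_pow`). Thus the moments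
of `K(x, ·)` are known, and Weierstrass approximation yields uniqueness
(`IsTransmutationKernel.unique`). Expanding `y^k` in Legendre polynomials turns the moments into
Legendre coefficients: `β_k(x)` is `(2k+1)/2` times `x ∫_{-1}^{1} K(x,xy) P_k(y) dy` (`beta_eq`).

**Convergence.** Hence `K_N(x, ·)` is a partial sum of the Legendre series of a `C¹` function, and
it converges uniformly by `legendreProj_uniform`. That lemma compares the function with the
antiderivative of the projection of its derivative; it uses only best approximation in `L²`,
`P_{n+1}' - P_{n-1}' = (2n+1) P_n` and `|P_n| ≤ 1`.

**The series.** As `∫_{-1}^{1} P_k(y) e^{izy} dy = 2 i^k j_k(z)` (`integral_legendreP_mul_exp`), the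
integrals of `K_N` against `cos ωt` and `sin ωt` are the partial sums of the Neumann series, so the
truncation errors are the integrals of `K - K_N` against `cos ωt` and `sin ωt`
(`transmute_sub_eq`). This gives the limits and the error bounds. Absolute and uniform convergence
follow from `|j_k(z)| ≤ |z|^k / k! · exp(|z|²/2)`, and the form with `J_{k+1/2}` from the values of
the Gamma function at half-integers.
-/

namespace NeumannBessel

/-! ### Legendre polynomials -/

open Polynomial in
lemma legendreP_zero : legendreP 0 = 1 := by simp [legendreP]

open Polynomial in
lemma legendreP_one : legendreP 1 = X := by
  simp [legendreP]
  rw [one_add_one_eq_two, ← C_ofNat, ← mul_assoc, ← C_mul]; norm_num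

open Polynomial in
lemma derivative_sq_sub_one_pow (n : ℕ) :
    derivative (((X : ℝ[X]) ^ 2 - 1) ^ (n + 1)) =
      C (2 * ((n : ℝ) + 1)) * ((X ^ 2 - 1) ^ n * X) := by
  rw [derivative_pow_succ]
  simp only [derivative_sub, derivative_X_pow, derivative_one, map_mul, map_add, map_natCast,
    map_one, map_ofNat]
  push_cast
  ring

open Polynomial in
lemma derivative_legendreP_succ (n : ℕ) :
    derivative (legendreP (n + 1)) =
      X * derivative (legendreP n) + C ((n : ℝ) + 1) * legendreP n := by
  have h2 : derivative (derivative^[n + 1] (((X : ℝ[X]) ^ 2 - 1) ^ (n + 1))) =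
      C (2 * ((n : ℝ) + 1)) * (derivative (derivative^[n] ((X ^ 2 - 1) ^ n)) * X +
        C ((n : ℝ) + 1) * derivative^[n] ((X ^ 2 - 1) ^ n)) := by
    rw [← Function.iterate_succ_apply' derivative (n + 1), Function.iterate_succ_apply,
      derivative_sq_sub_one_pow, iterate_derivative_C_mul, iterate_derivative_mul_X,
      Function.iterate_succ_apply']
    simp
  have h3 : (1 : ℝ) / (2 ^ (n + 1) * (n + 1).factorial) * (2 * ((n : ℝ) + 1)) =
      1 / (2 ^ n * n.factorial) := by
    rw [Nat.factorial_succ]; push_cast; field_simp; ring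
  simp only [legendreP, derivative_C_mul, h2]
  rw [← mul_assoc, ← C_mul, h3]
  ring

open Polynomial in
lemma derivative_legendreP_add_two (n : ℕ) :
    derivative (legendreP (n + 2)) =
      derivative (legendreP n) + C (2 * (n : ℝ) + 3) * legendreP (n + 1) := by
  have h1 : derivative (derivative (((X : ℝ[X]) ^ 2 - 1) ^ (n + 2))) =
      C (2 * ((n : ℝ) + 2)) * (C (2 * (n : ℝ) + 3) * (X ^ 2 - 1) ^ (n + 1) +
        C (2 * ((n : ℝ) + 1)) * (X ^ 2 - 1) ^ n) := by
    rw [derivative_sq_sub_one_pow (n + 1), derivative_C_mul, derivative_mul,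
      derivative_sq_sub_one_pow n, derivative_X]
    simp only [map_add, map_mul, map_natCast, map_one, map_ofNat, Nat.cast_add, Nat.cast_one]
    ring
  have h2 : derivative (derivative^[n + 2] (((X : ℝ[X]) ^ 2 - 1) ^ (n + 2))) =
      C (2 * ((n : ℝ) + 2)) * (C (2 * (n : ℝ) + 3) *
        derivative^[n + 1] ((X ^ 2 - 1) ^ (n + 1)) +
        C (2 * ((n : ℝ) + 1)) * derivative (derivative^[n] ((X ^ 2 - 1) ^ n))) := by
    rw [← Function.iterate_succ_apply' derivative (n + 2), Function.iterate_succ_apply,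
      Function.iterate_succ_apply, h1, iterate_derivative_C_mul, iterate_map_add,
      iterate_derivative_C_mul, iterate_derivative_C_mul,
      ← Function.iterate_succ_apply' derivative n]
  have h3 : (1 : ℝ) / (2 ^ (n + 2) * (n + 2).factorial) * (2 * ((n : ℝ) + 2)) =
      1 / (2 ^ (n + 1) * (n + 1).factorial) := by
    rw [Nat.factorial_succ (n + 1)]; push_cast; field_simp; ring
  have h4 : (1 : ℝ) / (2 ^ (n + 1) * (n + 1).factorial) * (2 * ((n : ℝ) + 1)) =
      1 / (2 ^ n * n.factorial) := by
    rw [Nat.factorial_succ]; push_cast; field_simp; ring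
  simp only [legendreP, derivative_C_mul, h2]
  rw [← mul_assoc, ← C_mul, h3, mul_add, ← mul_assoc _ (C (2 * ((n : ℝ) + 1))), ← C_mul, h4]
  ring

open Polynomial in
lemma one_sub_sq_mul_derivative_legendreP (n : ℕ) :
    (1 - X ^ 2) * derivative (legendreP (n + 1)) =
      C ((n : ℝ) + 1) * (legendreP n - X * legendreP (n + 1)) := by
  have hA := derivative_legendreP_add_two n
  have hB := derivative_legendreP_succ n
  have hB' := derivative_legendreP_succ (n + 1)
  simp only [map_add, map_mul, map_natCast, map_one, map_ofNat, Nat.cast_add, Nat.cast_one] at *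
  linear_combination hB + X * (hB' - hA)

open Polynomial in
/-- Legendre's differential equation. -/
lemma legendreP_ode (n : ℕ) :
    derivative ((1 - X ^ 2) * derivative (legendreP (n + 1))) =
      - C (((n : ℝ) + 1) * ((n : ℝ) + 2)) * legendreP (n + 1) := by
  have hA := derivative_legendreP_add_two n
  have hB' := derivative_legendreP_succ (n + 1)
  rw [one_sub_sq_mul_derivative_legendreP]
  simp only [map_add, map_mul, map_natCast, map_one, map_ofNat, Nat.cast_add, Nat.cast_one,
    derivative_mul, derivative_sub, derivative_X, derivative_natCast,
    derivative_one] at *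
  linear_combination ((n : ℝ[X]) + 1) * (hB' - hA)

open Polynomial in
lemma legendreP_eval_one (n : ℕ) : (legendreP n).eval 1 = 1 := by
  induction n with
  | zero => simp [legendreP_zero]
  | succ n ih =>
    have h := congrArg (eval 1) (one_sub_sq_mul_derivative_legendreP n)
    simp only [eval_mul, eval_sub, eval_one, eval_pow, eval_X, eval_C, ih] at h
    have : ((n : ℝ) + 1) ≠ 0 := by positivity
    have h' : ((n : ℝ) + 1) * (1 - eval 1 (legendreP (n + 1))) = 0 := by linarith
    rcases mul_eq_zero.1 h' with h | h
    · exact absurd h this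
    · linarith

open Polynomial in
lemma legendreP_eval_neg_one (n : ℕ) : (legendreP n).eval (-1) = (-1) ^ n := by
  induction n with
  | zero => simp [legendreP_zero]
  | succ n ih =>
    have h := congrArg (eval (-1)) (one_sub_sq_mul_derivative_legendreP n)
    simp only [eval_mul, eval_sub, eval_one, eval_pow, eval_X, eval_C, ih] at h
    have : ((n : ℝ) + 1) ≠ 0 := by positivity
    have h' : ((n : ℝ) + 1) * ((-1) ^ n + eval (-1) (legendreP (n + 1))) = 0 := by linarith
    rcases mul_eq_zero.1 h' with h | h
    · exact absurd h this
    · rw [pow_succ]; linarith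

open Polynomial in
lemma natDegree_legendreP_le (n : ℕ) : (legendreP n).natDegree ≤ n := by
  refine (natDegree_C_mul_le _ _).trans ((natDegree_iterate_derivative _ _).trans ?_)
  have h : (((X : ℝ[X]) ^ 2 - 1) ^ n).natDegree ≤ n * 2 := by
    refine natDegree_pow_le.trans (Nat.mul_le_mul_left n ?_)
    compute_degree
  omega

open Polynomial in
/-- The classical bound `|P_n| ≤ 1` on `[-1, 1]`: the function
`P_n² + (1 - y²) P_n'² / (n (n + 1))` has derivative `2 y P_n'² / (n (n + 1))` by Legendre's
equation, so that on `[-1, 1]` it is at most its value `1` at both endpoints. -/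
lemma abs_legendreP_eval_le_one (n : ℕ) {y : ℝ} (hy : y ∈ Icc (-1 : ℝ) 1) :
    |(legendreP n).eval y| ≤ 1 := by
  rcases n with _ | n
  · simp [legendreP_zero]
  set P := legendreP (n + 1) with hP
  set c : ℝ := ((n : ℝ) + 1) * ((n : ℝ) + 2) with hc
  have hc0 : 0 < c := by positivity
  set E : ℝ[X] := C c * P ^ 2 + (1 - X ^ 2) * derivative P ^ 2 with hE
  have hder : derivative E = 2 * X * derivative P ^ 2 := by
    have h := legendreP_ode n
    rw [← hP, ← hc] at h
    have h2 : derivative ((1 - X ^ 2) * derivative P) =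
        - (2 * X) * derivative P + (1 - X ^ 2) * derivative (derivative P) := by
      simp only [derivative_mul, derivative_sub, derivative_one, derivative_X_pow]
      simp [C_ofNat]
    rw [h2] at h
    have h3 : derivative E = 2 * C c * P * derivative P - 2 * X * derivative P ^ 2
        + 2 * (1 - X ^ 2) * derivative P * derivative (derivative P) := by
      rw [hE]
      simp only [derivative_add, derivative_mul, derivative_sub, derivative_one, derivative_C,
        derivative_pow_succ]
      simp
      ring
    rw [h3]
    linear_combination 2 * derivative P * h
  have hEd : ∀ x : ℝ, HasDerivAt (fun y => E.eval y) (2 * x * (derivative P).eval x ^ 2) x := by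
    intro x
    have := E.hasDerivAt x
    rw [hder] at this
    simpa using this
  have hval : ∀ x : ℝ, c * P.eval x ^ 2 + (1 - x ^ 2) * (derivative P).eval x ^ 2 = E.eval x := by
    intro x; simp [hE]
  have hEy : E.eval y ≤ c := by
    have h1 : E.eval 1 = c := by
      rw [← hval, legendreP_eval_one]; ring
    have h2 : E.eval (-1) = c := by
      rw [← hval, legendreP_eval_neg_one, ← pow_mul, mul_comm (n + 1) 2, pow_mul]; norm_num
    rcases le_total 0 y with h0 | h0
    · rw [← h1]
      have hm : MonotoneOn (fun y => E.eval y) (Icc 0 1) := by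
        refine monotoneOn_of_hasDerivWithinAt_nonneg (convex_Icc 0 1)
          E.continuous.continuousOn (fun x _ => (hEd x).hasDerivWithinAt) ?_
        intro x hx
        rw [interior_Icc] at hx
        have := hx.1.le
        positivity
      exact hm ⟨h0, hy.2⟩ ⟨zero_le_one, le_rfl⟩ hy.2
    · rw [← h2]
      have hm : AntitoneOn (fun y => E.eval y) (Icc (-1) 0) := by
        refine antitoneOn_of_hasDerivWithinAt_nonpos (convex_Icc (-1) 0)
          E.continuous.continuousOn (fun x _ => (hEd x).hasDerivWithinAt) ?_
        intro x hx
        rw [interior_Icc] at hx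
        exact mul_nonpos_of_nonpos_of_nonneg (by linarith [hx.2]) (sq_nonneg _)
      exact hm ⟨le_rfl, by norm_num⟩ ⟨hy.1, h0⟩ hy.1
  rw [← hval] at hEy
  have h1 : 0 ≤ (1 - y ^ 2) * (derivative P).eval y ^ 2 := by
    have : 0 ≤ 1 - y ^ 2 := by nlinarith [hy.1, hy.2]
    positivity
  have h2 : P.eval y ^ 2 ≤ 1 := by
    by_contra! h
    nlinarith
  exact abs_le_one_iff_mul_self_le_one.2 (by nlinarith)

/-! ### Moments of Legendre polynomials -/

open Polynomial in
lemma intervalIntegrable_eval (p : ℝ[X]) (a b : ℝ) :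
    IntervalIntegrable (fun y => p.eval y) MeasureTheory.volume a b :=
  p.continuous.intervalIntegrable a b

open Polynomial in
lemma integral_derivative_eval (p : ℝ[X]) (a b : ℝ) :
    ∫ y in a..b, (derivative p).eval y = p.eval b - p.eval a :=
  intervalIntegral.integral_eq_sub_of_hasDerivAt (fun x _ => p.hasDerivAt x)
    (intervalIntegrable_eval _ _ _)

open Polynomial in
lemma legendreMoment_eq (j k : ℕ) :
    legendreMoment j k = ∫ y in (-1 : ℝ)..1, (legendreP j * X ^ k).eval y := by
  simp [legendreMoment]

open Polynomial in
/-- Integration of `P_{n+2}' - P_n' = (2n+3) P_{n+1}` against `y^{k+1}`; the boundary terms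
cancel because `P_{n+2}` and `P_n` agree at `±1`. -/
lemma legendreMoment_add_two (n k : ℕ) :
    legendreMoment (n + 2) k =
      legendreMoment n k - (2 * (n : ℝ) + 3) / (k + 1) * legendreMoment (n + 1) (k + 1) := by
  have h := integral_derivative_eval ((legendreP (n + 2) - legendreP n) * X ^ (k + 1)) (-1) 1
  have h1 : derivative ((legendreP (n + 2) - legendreP n) * X ^ (k + 1)) =
      C (2 * (n : ℝ) + 3) * (legendreP (n + 1) * X ^ (k + 1)) +
        C ((k : ℝ) + 1) * (legendreP (n + 2) * X ^ k - legendreP n * X ^ k) := by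
    rw [derivative_mul, derivative_sub, derivative_legendreP_add_two, derivative_X_pow]
    simp only [map_add, map_mul, map_natCast, map_one, map_ofNat, Nat.cast_add, Nat.cast_one,
      Nat.add_one_sub_one]
    ring
  have h2 : ((legendreP (n + 2) - legendreP n) * X ^ (k + 1)).eval 1 -
      ((legendreP (n + 2) - legendreP n) * X ^ (k + 1)).eval (-1) = 0 := by
    simp only [eval_mul, eval_sub, legendreP_eval_one, legendreP_eval_neg_one, pow_add]
    norm_num
  rw [h2, h1] at h
  simp only [eval_add, eval_C_mul] at h
  simp only [eval_sub] at h
  rw [intervalIntegral.integral_add, intervalIntegral.integral_const_mul,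
    intervalIntegral.integral_const_mul, intervalIntegral.integral_sub, ← legendreMoment_eq,
    ← legendreMoment_eq, ← legendreMoment_eq] at h
  · have : ((k : ℝ) + 1) ≠ 0 := by positivity
    field_simp
    linarith
  · exact intervalIntegrable_eval _ _ _
  · exact intervalIntegrable_eval _ _ _
  · exact (intervalIntegrable_eval _ _ _).const_mul _
  · exact ((intervalIntegrable_eval _ _ _).sub (intervalIntegrable_eval _ _ _)).const_mul _

lemma legendreMoment_zero_left (k : ℕ) :
    legendreMoment 0 k = (1 - (-1) ^ (k + 1)) / (k + 1) := by
  simp [legendreMoment, legendreP_zero]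

lemma legendreMoment_one_left (k : ℕ) : legendreMoment 1 k = legendreMoment 0 (k + 1) := by
  simp [legendreMoment, legendreP_zero, legendreP_one, pow_succ, mul_comm]

/-- The moments `∫_{-1}^{1} P_n(y) y^k dy`: a closed form for `k = n + 2m`, and zero if `k < n` or
if `k` and `n` have different parity. -/
lemma legendreMoment_formula (n : ℕ) :
    (∀ m : ℕ, legendreMoment n (n + 2 * m) = 2 * ((n + 2 * m).factorial : ℝ) /
      (2 ^ m * m.factorial * (2 * n + 2 * m + 1).doubleFactorial)) ∧
    (∀ k, k < n → legendreMoment n k = 0) ∧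
    (∀ k, k % 2 ≠ n % 2 → legendreMoment n k = 0) := by
  have key : ∀ m : ℕ, ((2 * m).factorial : ℝ) * (2 * m + 1) =
      2 ^ m * m.factorial * (2 * m + 1).doubleFactorial := by
    intro m
    have h := Nat.factorial_eq_mul_doubleFactorial (2 * m)
    rw [Nat.doubleFactorial_two_mul, Nat.factorial_succ] at h
    have h' : ((2 * m + 1 : ℕ) : ℝ) * ((2 * m).factorial : ℝ) =
      ((2 * m + 1).doubleFactorial : ℝ) * (2 ^ m * m.factorial) := by exact_mod_cast h
    push_cast at h'
    linarith
  induction n using Nat.twoStepInduction with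
  | zero =>
    refine ⟨fun m => ?_, fun k hk => absurd hk (by omega), fun k hk => ?_⟩
    · rw [legendreMoment_zero_left]
      have h : (-1 : ℝ) ^ (0 + 2 * m + 1) = -1 := Odd.neg_one_pow ⟨m, by ring⟩
      have h2 : (0 : ℝ) < (2 * m + 1).doubleFactorial := by
        exact_mod_cast Nat.doubleFactorial_pos _
      rw [h]
      simp only [Nat.zero_add, Nat.mul_zero]
      have := key m
      push_cast
      rw [div_eq_div_iff (by positivity) (by positivity)]
      linarith
    · rw [legendreMoment_zero_left, Even.neg_one_pow (by rw [Nat.even_iff]; omega)]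
      simp
  | one =>
    refine ⟨fun m => ?_, fun k hk => ?_, fun k hk => ?_⟩
    · rw [legendreMoment_one_left, legendreMoment_zero_left]
      have h : (-1 : ℝ) ^ (1 + 2 * m + 1 + 1) = -1 := Odd.neg_one_pow ⟨m + 1, by ring⟩
      have h2 : (0 : ℝ) < (2 * m + 1).doubleFactorial := by
        exact_mod_cast Nat.doubleFactorial_pos _
      rw [h, show 2 * 1 + 2 * m + 1 = (2 * m + 1) + 2 by ring, Nat.doubleFactorial_add_two,
        show 1 + 2 * m = 2 * m + 1 by ring, Nat.factorial_succ]
      have := key m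
      push_cast
      rw [div_eq_div_iff (by positivity) (by positivity)]
      linear_combination (-2 * ((2 : ℝ) * m + 3)) * this
    · interval_cases k
      rw [legendreMoment_one_left, legendreMoment_zero_left]; norm_num
    · rw [legendreMoment_one_left, legendreMoment_zero_left,
        Even.neg_one_pow (by rw [Nat.even_iff]; omega)]
      simp
  | more n ih0 ih1 =>
    refine ⟨fun m => ?_, fun k hk => ?_, fun k hk => ?_⟩
    · have h0 := ih0.1 (m + 1)
      have h1 := ih1.1 (m + 1)
      rw [legendreMoment_add_two, show n + 2 + 2 * m = n + 2 * (m + 1) by ring, h0,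
        show n + 2 * (m + 1) + 1 = n + 1 + 2 * (m + 1) by ring, h1,
        show 2 * (n + 2) + 2 * m + 1 = (2 * n + 2 * (m + 1) + 1) + 2 by ring,
        show 2 * (n + 1) + 2 * (m + 1) + 1 = (2 * n + 2 * (m + 1) + 1) + 2 by ring,
        Nat.doubleFactorial_add_two, show n + 1 + 2 * (m + 1) = (n + 2 * (m + 1)) + 1 by ring,
        Nat.factorial_succ (n + 2 * (m + 1)), Nat.factorial_succ m]
      have h2 : (0 : ℝ) < (2 * n + 2 * (m + 1) + 1).doubleFactorial := by
        exact_mod_cast Nat.doubleFactorial_pos _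
      push_cast
      field_simp
      ring
    · rw [legendreMoment_add_two]
      rcases lt_trichotomy k n with h | h | h
      · rw [ih0.2.1 k h, ih1.2.1 (k + 1) (by omega)]; simp
      · subst h
        have h0 := ih0.1 0
        have h1 := ih1.1 0
        simp only [Nat.mul_zero, Nat.add_zero] at h0 h1
        rw [h0, h1, show 2 * (k + 1) + 1 = 2 * k + 1 + 2 by ring, Nat.doubleFactorial_add_two,
          Nat.factorial_succ]
        have h2 : (0 : ℝ) < (2 * k + 1).doubleFactorial := by
          exact_mod_cast Nat.doubleFactorial_pos _
        push_cast
        field_simp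
        ring
      · rw [ih0.2.2 k (by omega), ih1.2.2 (k + 1) (by omega)]; simp
    · rw [legendreMoment_add_two, ih0.2.2 k (by omega), ih1.2.2 (k + 1) (by omega)]; simp

lemma legendreMoment_eq_zero_of_lt {n k : ℕ} (h : k < n) : legendreMoment n k = 0 :=
  (legendreMoment_formula n).2.1 k h

lemma legendreMoment_eq_zero_of_parity {n k : ℕ} (h : k % 2 ≠ n % 2) : legendreMoment n k = 0 :=
  (legendreMoment_formula n).2.2 k h

lemma legendreMoment_self_ne_zero (n : ℕ) : legendreMoment n n ≠ 0 := by
  have h := (legendreMoment_formula n).1 0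
  simp only [Nat.mul_zero, Nat.add_zero] at h
  have h2 : (0 : ℝ) < (2 * n + 1).doubleFactorial := by exact_mod_cast Nat.doubleFactorial_pos _
  rw [h]
  positivity

/-! ### Legendre series -/

open Polynomial in
lemma integral_eval_mul_legendreP {p : ℝ[X]} {n : ℕ} (hp : p.natDegree ≤ n) :
    ∫ y in (-1 : ℝ)..1, p.eval y * (legendreP n).eval y = p.coeff n * legendreMoment n n := by
  have h : ∀ y : ℝ, p.eval y * (legendreP n).eval y =
      ∑ k ∈ Finset.range (n + 1), p.coeff k * ((legendreP n).eval y * y ^ k) := by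
    intro y
    rw [eval_eq_sum_range' (Nat.lt_succ_of_le hp), Finset.sum_mul]
    exact Finset.sum_congr rfl fun k _ => by ring
  simp only [h]
  rw [intervalIntegral.integral_finsetSum]
  · simp only [intervalIntegral.integral_const_mul]
    rw [Finset.sum_range_succ, Finset.sum_eq_zero]
    · simp [legendreMoment]
    · intro k hk
      have := legendreMoment_eq_zero_of_lt (Finset.mem_range.1 hk)
      rw [legendreMoment] at this
      rw [this, mul_zero]
  · intro k _
    exact (((legendreP n).continuous.mul (continuous_pow k)).const_mul _).intervalIntegrable _ _

open Polynomial in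
lemma integral_eval_mul_legendreP_of_lt {p : ℝ[X]} {n : ℕ} (hp : p.natDegree < n) :
    ∫ y in (-1 : ℝ)..1, p.eval y * (legendreP n).eval y = 0 := by
  rw [integral_eval_mul_legendreP hp.le, coeff_eq_zero_of_natDegree_lt hp, zero_mul]

lemma integral_legendreP_mul_of_ne {i j : ℕ} (h : i ≠ j) :
    ∫ y in (-1 : ℝ)..1, (legendreP i).eval y * (legendreP j).eval y = 0 := by
  rcases lt_or_gt_of_ne h with h | h
  · exact integral_eval_mul_legendreP_of_lt ((natDegree_legendreP_le i).trans_lt h)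
  · simp only [mul_comm ((legendreP i).eval _)]
    exact integral_eval_mul_legendreP_of_lt ((natDegree_legendreP_le j).trans_lt h)

open Polynomial in
/-- The `L²` norm of `P_n`: integrate `(P_{n+1} P_n)'`, using `P_{n+1}' = P_{n-1}' + (2n+1) P_n` and
the orthogonality of `P_n` to polynomials of lower degree. -/
lemma integral_legendreP_mul_self (n : ℕ) :
    (2 * (n : ℝ) + 1) / 2 *
      ∫ y in (-1 : ℝ)..1, (legendreP n).eval y * (legendreP n).eval y = 1 := by
  rcases n with _ | n
  · simp [legendreP_zero]; norm_num
  have hd (m : ℕ) : (derivative (legendreP m)).natDegree < m + 1 :=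
    ((natDegree_derivative_le _).trans (Nat.sub_le _ _)).trans_lt
      (Nat.lt_succ_of_le (natDegree_legendreP_le m))
  have h := integral_derivative_eval (legendreP (n + 2) * legendreP (n + 1)) (-1) 1
  have h1 : ∀ y : ℝ, (derivative (legendreP (n + 2) * legendreP (n + 1))).eval y =
      (derivative (legendreP n)).eval y * (legendreP (n + 1)).eval y +
      (2 * (n : ℝ) + 3) * ((legendreP (n + 1)).eval y * (legendreP (n + 1)).eval y) +
      (derivative (legendreP (n + 1))).eval y * (legendreP (n + 2)).eval y := by
    intro y
    rw [derivative_mul, derivative_legendreP_add_two]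
    simp only [eval_add, eval_mul, eval_C]
    ring
  simp only [h1] at h
  rw [intervalIntegral.integral_add, intervalIntegral.integral_add,
    intervalIntegral.integral_const_mul, integral_eval_mul_legendreP_of_lt (hd n),
    integral_eval_mul_legendreP_of_lt (hd (n + 1))] at h
  · simp only [eval_mul, legendreP_eval_one, legendreP_eval_neg_one, ← pow_add] at h
    rw [Odd.neg_one_pow ⟨n + 1, by ring⟩] at h
    push_cast
    linarith
  all_goals
    apply Continuous.intervalIntegrable
    fun_prop

/-- The unnormalized Legendre coefficient `∫_{-1}^{1} g P_j`. -/
noncomputable def legendreCoeff (g : ℝ → ℝ) (j : ℕ) : ℝ :=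
  ∫ y in (-1 : ℝ)..1, g y * (legendreP j).eval y

/-- The partial sum `∑_{j < N} (2j + 1)/2 (∫ g P_j) P_j` of the Legendre series of `g`, that is, the
orthogonal projection of `g` onto the polynomials of degree less than `N`. -/
noncomputable def legendreProj (g : ℝ → ℝ) (N : ℕ) : Polynomial ℝ :=
  ∑ j ∈ Finset.range N, Polynomial.C ((2 * (j : ℝ) + 1) / 2 * legendreCoeff g j) * legendreP j

lemma legendreProj_eval (g : ℝ → ℝ) (N : ℕ) (y : ℝ) :
    (legendreProj g N).eval y =
      ∑ j ∈ Finset.range N, (2 * (j : ℝ) + 1) / 2 * legendreCoeff g j * (legendreP j).eval y := by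
  simp [legendreProj, Polynomial.eval_finsetSum]

lemma legendreCoeff_sub {g h : ℝ → ℝ} (hg : Continuous g) (hh : Continuous h) (j : ℕ) :
    legendreCoeff (fun y => g y - h y) j = legendreCoeff g j - legendreCoeff h j := by
  simp only [legendreCoeff, sub_mul]
  exact intervalIntegral.integral_sub ((hg.mul (legendreP j).continuous).intervalIntegrable _ _)
    ((hh.mul (legendreP j).continuous).intervalIntegrable _ _)

lemma legendreProj_sub {g h : ℝ → ℝ} (hg : Continuous g) (hh : Continuous h) (N : ℕ) :
    legendreProj (fun y => g y - h y) N = legendreProj g N - legendreProj h N := by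
  simp only [legendreProj, legendreCoeff_sub hg hh, mul_sub, map_sub, sub_mul,
    Finset.sum_sub_distrib]

lemma natDegree_legendreProj_le (g : ℝ → ℝ) (N : ℕ) : (legendreProj g N).natDegree ≤ N - 1 := by
  refine Polynomial.natDegree_sum_le_of_forall_le _ _ fun j hj => ?_
  refine (Polynomial.natDegree_C_mul_le _ _).trans ((natDegree_legendreP_le j).trans ?_)
  have := Finset.mem_range.1 hj
  omega

lemma legendreCoeff_legendreProj (g : ℝ → ℝ) {i N : ℕ} (hi : i < N) :
    legendreCoeff (fun y => (legendreProj g N).eval y) i = legendreCoeff g i := by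
  have h : ∀ y : ℝ, (legendreProj g N).eval y * (legendreP i).eval y =
      ∑ j ∈ Finset.range N, (2 * (j : ℝ) + 1) / 2 * legendreCoeff g j *
        ((legendreP j).eval y * (legendreP i).eval y) := by
    intro y
    rw [legendreProj_eval, Finset.sum_mul]
    exact Finset.sum_congr rfl fun k _ => by ring
  rw [legendreCoeff]
  simp only [h]
  rw [intervalIntegral.integral_finsetSum]
  · simp only [intervalIntegral.integral_const_mul]
    rw [Finset.sum_eq_single i]
    · have := integral_legendreP_mul_self i
      linear_combination legendreCoeff g i * this
    · intro j _ hj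
      rw [integral_legendreP_mul_of_ne hj, mul_zero]
    · intro h; exact absurd (Finset.mem_range.2 hi) h
  · intro k _
    exact (((legendreP k).continuous.mul (legendreP i).continuous).const_mul _).intervalIntegrable
      _ _

open Polynomial in
/-- A polynomial of degree less than `N` is its own projection: the difference is orthogonal to all
`P_j` with `j < N`, hence to the one of its own degree. -/
lemma legendreProj_polynomial {p : ℝ[X]} {N : ℕ} (hp : p.natDegree < N) :
    legendreProj (fun y => p.eval y) N = p := by
  by_contra hne
  set r := p - legendreProj (fun y => p.eval y) N with hr
  have hr0 : r ≠ 0 := fun h => hne (sub_eq_zero.1 h).symm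
  have hd : r.natDegree < N := by
    refine (natDegree_sub_le _ _).trans_lt (max_lt hp ?_)
    exact (natDegree_legendreProj_le _ _).trans_lt (by omega)
  have h1 := integral_eval_mul_legendreP (le_refl r.natDegree)
  have h2 : legendreCoeff (fun y => r.eval y) r.natDegree = 0 := by
    simp only [hr, eval_sub]
    rw [legendreCoeff_sub p.continuous (legendreProj _ N).continuous,
      ← hr, legendreCoeff_legendreProj _ hd, sub_self]
  rw [legendreCoeff, h1] at h2
  rcases mul_eq_zero.1 h2 with h | h
  · exact hr0 (leadingCoeff_eq_zero.1 h)
  · exact legendreMoment_self_ne_zero _ h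

lemma legendreCoeff_sub_legendreProj {g : ℝ → ℝ} (hg : Continuous g) {i N : ℕ} (hi : i < N) :
    legendreCoeff (fun y => g y - (legendreProj g N).eval y) i = 0 := by
  rw [legendreCoeff_sub hg (legendreProj g N).continuous, legendreCoeff_legendreProj g hi, sub_self]

open Polynomial in
lemma integral_sub_legendreProj_mul {g : ℝ → ℝ} (hg : Continuous g) {N : ℕ} {p : ℝ[X]}
    (hp : p.natDegree < N) :
    ∫ y in (-1 : ℝ)..1, (g y - (legendreProj g N).eval y) * p.eval y = 0 := by
  have hr : Continuous fun y => g y - (legendreProj g N).eval y :=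
    hg.sub (legendreProj g N).continuous
  have h : ∀ y : ℝ, (g y - (legendreProj g N).eval y) * p.eval y =
      ∑ j ∈ Finset.range N, (2 * (j : ℝ) + 1) / 2 * legendreCoeff (fun y => p.eval y) j *
        ((g y - (legendreProj g N).eval y) * (legendreP j).eval y) := by
    intro y
    conv_lhs => rw [← legendreProj_polynomial hp, legendreProj_eval (fun y => p.eval y),
      Finset.mul_sum]
    exact Finset.sum_congr rfl fun k _ => by ring
  simp only [h]
  rw [intervalIntegral.integral_finsetSum]
  · simp only [intervalIntegral.integral_const_mul]
    refine Finset.sum_eq_zero fun j hj => ?_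
    have := legendreCoeff_sub_legendreProj hg (Finset.mem_range.1 hj)
    rw [legendreCoeff] at this
    rw [this, mul_zero]
  · intro k _
    exact ((hr.mul (legendreP k).continuous).const_mul _).intervalIntegrable _ _

open Polynomial in
lemma integral_sub_legendreProj_sq_le {g : ℝ → ℝ} (hg : Continuous g) {N : ℕ} {p : ℝ[X]}
    (hp : p.natDegree < N) :
    ∫ y in (-1 : ℝ)..1, (g y - (legendreProj g N).eval y) ^ 2 ≤
      ∫ y in (-1 : ℝ)..1, (g y - p.eval y) ^ 2 := by
  set s := legendreProj g N
  have hsd : (s - p).natDegree < N :=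
    (natDegree_sub_le _ _).trans_lt
      (max_lt ((natDegree_legendreProj_le _ _).trans_lt (by omega)) hp)
  have h0 := integral_sub_legendreProj_mul hg hsd
  have hsc := s.continuous
  have hpc := p.continuous
  have h1 : ∀ y : ℝ, (g y - p.eval y) ^ 2 =
      (g y - s.eval y) ^ 2 + 2 * ((g y - s.eval y) * (s - p).eval y) + ((s - p).eval y) ^ 2 := by
    intro y; rw [eval_sub]; ring
  simp only [h1]
  rw [intervalIntegral.integral_add, intervalIntegral.integral_add,
    intervalIntegral.integral_const_mul, h0]
  · have : 0 ≤ ∫ y in (-1 : ℝ)..1, ((s - p).eval y) ^ 2 :=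
      intervalIntegral.integral_nonneg (by norm_num) fun y _ => sq_nonneg _
    linarith
  all_goals
    apply Continuous.intervalIntegrable
    fun_prop

open Polynomial in
/-- If `h` is within `δ` of a polynomial of degree less than `N`, then the projection error of `h`
is at most `2δ` in `L¹`; this passes through the best approximation property in `L²`. -/
lemma integral_abs_sub_legendreProj_le {h : ℝ → ℝ} (hh : Continuous h) {N : ℕ} {p : ℝ[X]}
    (hp : p.natDegree < N) {δ : ℝ} (hδ : 0 < δ)
    (hpδ : ∀ y ∈ Icc (-1 : ℝ) 1, |p.eval y - h y| < δ) :
    ∫ y in (-1 : ℝ)..1, |h y - (legendreProj h N).eval y| ≤ 2 * δ := by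
  have hsc := (legendreProj h N).continuous
  have hpc := p.continuous
  have h1 := integral_sub_legendreProj_sq_le hh hp
  have h2 : ∫ y in (-1 : ℝ)..1, (h y - p.eval y) ^ 2 ≤ ∫ _ in (-1 : ℝ)..1, δ ^ 2 := by
    refine intervalIntegral.integral_mono_on (by norm_num) ?_ ?_ fun y hy => ?_
    · apply Continuous.intervalIntegrable; fun_prop
    · apply Continuous.intervalIntegrable; fun_prop
    · have := hpδ y hy
      rw [abs_sub_comm] at this
      exact (sq_abs (h y - p.eval y)) ▸ pow_le_pow_left₀ (abs_nonneg _) this.le 2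
  -- `|r| ≤ (r²/δ + δ)/2` replaces the Cauchy–Schwarz inequality
  have h3 : ∫ y in (-1 : ℝ)..1, |h y - (legendreProj h N).eval y| ≤
      ∫ y in (-1 : ℝ)..1, ((2 * δ)⁻¹ * (h y - (legendreProj h N).eval y) ^ 2 + δ / 2) := by
    refine intervalIntegral.integral_mono_on (by norm_num) ?_ ?_ fun y _ => ?_
    · apply Continuous.intervalIntegrable; fun_prop
    · apply Continuous.intervalIntegrable; fun_prop
    · set r := h y - (legendreProj h N).eval y
      have : (2 * δ)⁻¹ * r ^ 2 + δ / 2 - |r| = (2 * δ)⁻¹ * (|r| - δ) ^ 2 := by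
        rw [← sq_abs r]; field_simp; ring
      have h4 : 0 ≤ (2 * δ)⁻¹ * (|r| - δ) ^ 2 := by positivity
      linarith
  rw [intervalIntegral.integral_add, intervalIntegral.integral_const_mul] at h3
  · simp only [intervalIntegral.integral_const, smul_eq_mul] at h2 h3
    have h4 : (2 * δ)⁻¹ * ∫ y in (-1 : ℝ)..1, (h y - (legendreProj h N).eval y) ^ 2 ≤
        (2 * δ)⁻¹ * ((1 - -1) * δ ^ 2) :=
      mul_le_mul_of_nonneg_left (h1.trans h2) (by positivity)
    have h5 : (2 * δ)⁻¹ * ((1 - -1) * δ ^ 2) = δ := by field_simp; ring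
    linarith
  all_goals
    apply Continuous.intervalIntegrable
    fun_prop

open Polynomial in
lemma abs_legendreCoeff_le {h : ℝ → ℝ} (hh : Continuous h) {n : ℕ} {p : ℝ[X]}
    (hp : p.natDegree < n) {δ : ℝ} (hpδ : ∀ y ∈ Icc (-1 : ℝ) 1, |p.eval y - h y| < δ) :
    |legendreCoeff h n| ≤ 2 * δ := by
  have h1 : legendreCoeff h n = legendreCoeff (fun y => h y - p.eval y) n := by
    rw [legendreCoeff_sub hh p.continuous]
    simp only [legendreCoeff]
    rw [integral_eval_mul_legendreP_of_lt hp, sub_zero]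
  rw [h1, legendreCoeff, ← Real.norm_eq_abs]
  have := intervalIntegral.norm_integral_le_of_norm_le_const (a := (-1 : ℝ)) (b := 1) (C := δ)
    (f := fun y => (h y - p.eval y) * (legendreP n).eval y) ?_
  · norm_num at this ⊢; linarith
  · intro y hy
    rw [uIoc_of_le (by norm_num)] at hy
    have hy' : y ∈ Icc (-1 : ℝ) 1 := Ioc_subset_Icc_self hy
    have h2 := hpδ y hy'
    rw [abs_sub_comm] at h2
    rw [norm_mul, Real.norm_eq_abs, Real.norm_eq_abs]
    have := mul_le_mul h2.le (abs_legendreP_eval_le_one n hy') (abs_nonneg _)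
      ((abs_nonneg _).trans h2.le)
    linarith

open Polynomial in
lemma exists_antiderivative_legendreP (n : ℕ) :
    ∃ Q : ℝ[X], derivative Q = legendreP n ∧ Q.natDegree ≤ n + 1 := by
  rcases n with _ | n
  · exact ⟨X, by simp [legendreP_zero], by simp⟩
  · refine ⟨C (2 * (n : ℝ) + 3)⁻¹ * (legendreP (n + 2) - legendreP n), ?_, ?_⟩
    · rw [derivative_C_mul, derivative_sub, derivative_legendreP_add_two, add_sub_cancel_left,
        ← mul_assoc, ← C_mul, inv_mul_cancel₀ (by positivity), C_1, one_mul]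
    · refine (natDegree_C_mul_le _ _).trans ((natDegree_sub_le _ _).trans (max_le ?_ ?_))
      · exact natDegree_legendreP_le _
      · exact (natDegree_legendreP_le _).trans (by omega)

open Polynomial in
lemma exists_antiderivative_legendreProj (h : ℝ → ℝ) (N : ℕ) (c : ℝ) :
    ∃ G : ℝ[X], derivative G = legendreProj h N ∧ G.natDegree < N + 1 ∧ G.eval (-1) = c := by
  choose Q hQ hQd using exists_antiderivative_legendreP
  set G₀ : ℝ[X] := ∑ j ∈ Finset.range N, C ((2 * (j : ℝ) + 1) / 2 * legendreCoeff h j) * Q j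
    with hG₀
  refine ⟨G₀ + C (c - G₀.eval (-1)), ?_, ?_, by simp⟩
  · simp [hG₀, legendreProj, hQ]
  · rw [natDegree_add_C, Nat.lt_succ_iff]
    refine natDegree_sum_le_of_forall_le _ _ fun j hj => ?_
    have := Finset.mem_range.1 hj
    exact (natDegree_C_mul_le _ _).trans ((hQd j).trans (by omega))

open Polynomial in
/-- Integration by parts for Legendre coefficients of a function vanishing at `±1`. -/
lemma legendreCoeff_succ_eq {ρ r : ℝ → ℝ} (hr : Continuous r) (hρ : ∀ y, HasDerivAt ρ (r y) y)
    (h1 : ρ 1 = 0) (h2 : ρ (-1) = 0) (j : ℕ) :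
    (2 * ((j + 1 : ℕ) : ℝ) + 1) * legendreCoeff ρ (j + 1) =
      legendreCoeff r j - legendreCoeff r (j + 2) := by
  have hρc : Continuous ρ := continuous_iff_continuousAt.2 fun y => (hρ y).continuousAt
  have hparts := intervalIntegral.integral_mul_deriv_eq_deriv_mul (a := (-1 : ℝ)) (b := 1)
    (u := ρ) (u' := r) (v := fun y => (legendreP (j + 2) - legendreP j).eval y)
    (v' := fun y => (derivative (legendreP (j + 2) - legendreP j)).eval y)
    (fun y _ => hρ y) (fun y _ => (legendreP (j + 2) - legendreP j).hasDerivAt y)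
    (hr.intervalIntegrable _ _) (intervalIntegrable_eval _ _ _)
  rw [h1, h2, zero_mul, zero_mul, sub_zero, zero_sub, derivative_sub,
    derivative_legendreP_add_two, add_sub_cancel_left] at hparts
  have e1 : ∀ y, ρ y * (C (2 * (j : ℝ) + 3) * legendreP (j + 1)).eval y =
      (2 * (j : ℝ) + 3) * (ρ y * (legendreP (j + 1)).eval y) := by
    intro y; rw [eval_C_mul]; ring
  have e2 : ∀ y, r y * (legendreP (j + 2) - legendreP j).eval y =
      r y * (legendreP (j + 2)).eval y - r y * (legendreP j).eval y := by
    intro y; rw [eval_sub]; ring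
  simp only [e1, e2] at hparts
  rw [intervalIntegral.integral_const_mul, intervalIntegral.integral_sub] at hparts
  · simp only [legendreCoeff]
    push_cast
    linarith
  all_goals
    apply Continuous.intervalIntegrable
    have := (legendreP (j + 2)).continuous
    fun_prop

open Polynomial in
lemma legendreCoeff_zero_eq {ρ r : ℝ → ℝ} (hr : Continuous r) (hρ : ∀ y, HasDerivAt ρ (r y) y)
    (h1 : ρ 1 = 0) (h2 : ρ (-1) = 0) : legendreCoeff ρ 0 = - legendreCoeff r 1 := by
  have hparts := intervalIntegral.integral_mul_deriv_eq_deriv_mul (a := (-1 : ℝ)) (b := 1)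
    (u := ρ) (u' := r) (v := fun y => y) (v' := fun _ => 1)
    (fun y _ => hρ y) (fun y _ => hasDerivAt_id y)
    (hr.intervalIntegrable _ _) (by simp)
  simpa [legendreCoeff, legendreP_zero, legendreP_one, h1, h2] using hparts

open Polynomial in
/-- Uniform convergence of the Legendre series of a `C¹` function. Compare `g` with the polynomial
`G` whose derivative is the projection of `g'`: the error `ρ = g - G` is small because `ρ'` is small
in `L¹`, and of the coefficients of `ρ` up to the degree of `G` only the last two can be nonzero. -/
lemma legendreProj_uniform {g h : ℝ → ℝ} (hh : Continuous h) (hg : ∀ y, HasDerivAt g (h y) y)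
    {ε : ℝ} (hε : 0 < ε) :
    ∃ N₀, ∀ N ≥ N₀, ∀ y ∈ Icc (-1 : ℝ) 1, |g y - (legendreProj g N).eval y| < ε := by
  have hgc : Continuous g := continuous_iff_continuousAt.2 fun y => (hg y).continuousAt
  -- the bounds below add up to `4δ`
  set δ := ε / 5 with hδ_def
  have hδ : 0 < δ := by positivity
  obtain ⟨p, hp⟩ := exists_polynomial_near_of_continuousOn (-1) 1 h hh.continuousOn δ hδ
  refine ⟨p.natDegree + 3, fun N' hN' y hy => ?_⟩
  obtain ⟨M, rfl⟩ : ∃ M, N' = M + 3 := ⟨N' - 3, by omega⟩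
  have hpM : p.natDegree < M + 1 := by omega
  set N := M + 2 with hN_def
  have hpN : p.natDegree < N := by omega
  obtain ⟨G, hG, hGd, hG1⟩ := exists_antiderivative_legendreProj h N (g (-1))
  set r : ℝ → ℝ := fun y => h y - (legendreProj h N).eval y with hr
  set ρ : ℝ → ℝ := fun y => g y - G.eval y with hρ
  have hrc : Continuous r := hh.sub (legendreProj h N).continuous
  have hρd : ∀ y, HasDerivAt ρ (r y) y := fun y => by
    have := (hg y).sub (G.hasDerivAt y)
    rwa [hG] at this
  have hρi : ∀ y, ∫ t in (-1 : ℝ)..y, r t = ρ y := fun y => by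
    rw [intervalIntegral.integral_eq_sub_of_hasDerivAt (fun t _ => hρd t)
      (hrc.intervalIntegrable _ _)]
    simp [hρ, hG1]
  have hr0 : ∀ j < N, legendreCoeff r j = 0 := fun j hj => legendreCoeff_sub_legendreProj hh hj
  have hrN : ∀ j, N ≤ j → legendreCoeff r j = legendreCoeff h j := fun j hj => by
    rw [hr, legendreCoeff_sub hh (legendreProj h N).continuous]
    have : (legendreProj h N).natDegree < j :=
      (natDegree_legendreProj_le _ _).trans_lt (by omega)
    simp only [legendreCoeff]
    rw [integral_eval_mul_legendreP_of_lt this, sub_zero]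
  have hρ1 : ρ 1 = 0 := by
    rw [← hρi]
    have := hr0 0 (by omega)
    simpa [legendreCoeff, legendreP_zero] using this
  have hρ2 : ρ (-1) = 0 := by rw [← hρi]; simp
  have hρy : |ρ y| ≤ 2 * δ := by
    rw [← hρi]
    refine (intervalIntegral.abs_integral_le_integral_abs hy.1).trans ?_
    refine le_trans ?_ (integral_abs_sub_legendreProj_le hh hpN hδ hp)
    exact intervalIntegral.integral_mono_interval le_rfl hy.1 hy.2
      (Eventually.of_forall fun t => abs_nonneg _) (hrc.abs.intervalIntegrable _ _)
  have hcoef : ∀ j, |(2 * ((j : ℕ) : ℝ) + 1) / 2 * legendreCoeff ρ j| =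
      |if j = 0 then legendreCoeff r 1 else
        legendreCoeff r (j - 1) - legendreCoeff r (j + 1)| / 2 := by
    intro j
    rcases j with _ | j
    · rw [legendreCoeff_zero_eq hrc hρd hρ1 hρ2]; simp [abs_mul]; ring
    · have := legendreCoeff_succ_eq hrc hρd hρ1 hρ2 j
      rw [div_mul_eq_mul_div, this, abs_div]; simp
  have hlast : ∀ j, M < j → j ≤ N → |(2 * (j : ℝ) + 1) / 2 * legendreCoeff ρ j *
      (legendreP j).eval y| ≤ δ := by
    intro j hj hj'
    rw [abs_mul, hcoef, if_neg (by omega), hr0 (j - 1) (by omega), hrN (j + 1) (by omega), zero_sub,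
      abs_neg]
    have h1 := abs_legendreCoeff_le hh (n := j + 1) (p := p) (by omega) hp
    have h2 := abs_legendreP_eval_le_one j hy
    have := mul_le_mul (a := |legendreCoeff h (j + 1)| / 2) (b := δ) (by linarith) h2
      (abs_nonneg _) hδ.le
    linarith
  have hproj : |(legendreProj ρ (M + 3)).eval y| ≤ 2 * δ := by
    rw [legendreProj_eval, Finset.sum_range_succ, Finset.sum_range_succ, Finset.sum_eq_zero,
      zero_add]
    · refine (abs_add_le _ _).trans ?_
      have h1 := hlast (M + 1) (by omega) (by omega)
      have h2 := hlast (M + 2) (by omega) (by omega)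
      linarith
    · intro j hj
      have hj := Finset.mem_range.1 hj
      have : (2 * (j : ℝ) + 1) / 2 * legendreCoeff ρ j = 0 := by
        rw [← abs_eq_zero, hcoef]
        split_ifs with h
        · rw [hr0 1 (by omega)]; simp
        · rw [hr0 _ (by omega), hr0 _ (by omega)]; simp
      rw [this, zero_mul]
  have hGp : legendreProj ρ (M + 3) = legendreProj g (M + 3) - G := by
    rw [hρ, legendreProj_sub hgc G.continuous, legendreProj_polynomial hGd]
  rw [hGp, eval_sub] at hproj
  have hfin : g y - (legendreProj g (M + 3)).eval y =
      ρ y - ((legendreProj g (M + 3)).eval y - G.eval y) := by simp only [hρ]; ring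
  rw [hfin]
  refine (abs_sub _ _).trans_lt ?_
  linarith

/-- Uniform convergence of the Legendre series for complex-valued functions. -/
lemma legendreSeries_tendstoUniformlyOn {g h : ℝ → ℂ} (hh : Continuous h)
    (hg : ∀ y, HasDerivAt g (h y) y) :
    TendstoUniformlyOn (fun (N : ℕ) (y : ℝ) => ∑ j ∈ Finset.range (N + 1),
      (2 * (j : ℂ) + 1) / 2 * (∫ t in (-1 : ℝ)..1, g t * ((legendreP j).eval t : ℝ)) *
        (((legendreP j).eval y : ℝ) : ℂ)) g atTop (Icc (-1) 1) := by
  have hgc : Continuous g := continuous_iff_continuousAt.2 fun y => (hg y).continuousAt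
  have hint : ∀ j, IntervalIntegrable (fun t : ℝ => g t * ((legendreP j).eval t : ℝ))
      MeasureTheory.volume (-1) 1 := fun j => by
    apply Continuous.intervalIntegrable
    have := (legendreP j).continuous
    fun_prop
  have hre : ∀ y, HasDerivAt (fun y => (g y).re) ((h y).re) y := fun y =>
    (Complex.reCLM.hasFDerivAt.comp_hasDerivAt y (hg y))
  have him : ∀ y, HasDerivAt (fun y => (g y).im) ((h y).im) y := fun y =>
    (Complex.imCLM.hasFDerivAt.comp_hasDerivAt y (hg y))
  rw [Metric.tendstoUniformlyOn_iff]
  intro ε hε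
  obtain ⟨N₁, h1⟩ := legendreProj_uniform (Complex.continuous_re.comp hh) hre (half_pos hε)
  obtain ⟨N₂, h2⟩ := legendreProj_uniform (Complex.continuous_im.comp hh) him (half_pos hε)
  filter_upwards [eventually_ge_atTop (max N₁ N₂)] with N hN y hy
  have h1 := h1 (N + 1) (by have := le_max_left N₁ N₂; omega) y hy
  have h2 := h2 (N + 1) (by have := le_max_right N₁ N₂; omega) y hy
  rw [legendreProj_eval] at h1 h2
  rw [dist_eq_norm]
  have hI : ∀ j, (∫ t in (-1 : ℝ)..1, g t * ((legendreP j).eval t : ℝ)) =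
      ((legendreCoeff (fun y => (g y).re) j : ℝ) : ℂ) +
      ((legendreCoeff (fun y => (g y).im) j : ℝ) : ℂ) * Complex.I := by
    intro j
    apply Complex.ext
    · have := Complex.reCLM.intervalIntegral_comp_comm (hint j)
      simpa [legendreCoeff] using this.symm
    · have := Complex.imCLM.intervalIntegral_comp_comm (hint j)
      simpa [legendreCoeff] using this.symm
  have hsum : ∑ j ∈ Finset.range (N + 1),
      (2 * (j : ℂ) + 1) / 2 * (∫ t in (-1 : ℝ)..1, g t * ((legendreP j).eval t : ℝ)) *
        (((legendreP j).eval y : ℝ) : ℂ) =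
      ((∑ j ∈ Finset.range (N + 1), (2 * (j : ℝ) + 1) / 2 *
        legendreCoeff (fun y => (g y).re) j * (legendreP j).eval y : ℝ) : ℂ) +
      ((∑ j ∈ Finset.range (N + 1), (2 * (j : ℝ) + 1) / 2 *
        legendreCoeff (fun y => (g y).im) j * (legendreP j).eval y : ℝ) : ℂ) * Complex.I := by
    push_cast
    rw [Finset.sum_mul, ← Finset.sum_add_distrib]
    exact Finset.sum_congr rfl fun j _ => by rw [hI]; ring
  rw [hsum]
  refine (Complex.norm_le_abs_re_add_abs_im _).trans_lt ?_
  simp only [Complex.sub_re, Complex.sub_im, Complex.add_re, Complex.add_im, Complex.ofReal_re,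
    Complex.ofReal_im, Complex.re_ofReal_mul, Complex.im_ofReal_mul, Complex.I_re, Complex.I_im,
    mul_zero, mul_one, add_zero, zero_add]
  linarith

/-! ### Calculus of two variables -/

lemma hasDerivAt_intervalIntegral_param {F F' : ℝ → ℝ → ℂ} (hF : Continuous (Function.uncurry F))
    (hF' : Continuous (Function.uncurry F')) (hd : ∀ x t, HasDerivAt (fun x => F x t) (F' x t) x)
    (a b x : ℝ) : HasDerivAt (fun x => ∫ t in a..b, F x t) (∫ t in a..b, F' x t) x := by
  have hcomp := (isCompact_closedBall x 1).prod (isCompact_uIcc (a := a) (b := b))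
  obtain ⟨C, hC⟩ := hcomp.exists_bound_of_continuousOn hF'.continuousOn
  refine (intervalIntegral.hasDerivAt_integral_of_dominated_loc_of_deriv_le (bound := fun _ => C)
    (Metric.closedBall_mem_nhds x one_pos) (Eventually.of_forall fun x => ?_) ?_ ?_ ?_ ?_ ?_).2
  · exact (by fun_prop : Continuous (F x)).aestronglyMeasurable
  · exact (by fun_prop : Continuous (F x)).intervalIntegrable _ _
  · exact (by fun_prop : Continuous (F' x)).aestronglyMeasurable
  · exact Eventually.of_forall fun t ht y hy => hC (y, t) ⟨hy, uIoc_subset_uIcc ht⟩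
  · simp
  · exact Eventually.of_forall fun t _ y _ => hd y t

lemma hasFDerivAt_of_partial {f f₁ f₂ : ℝ → ℝ → ℂ} (h1 : Continuous (Function.uncurry f₁))
    (h2 : Continuous (Function.uncurry f₂)) (hd1 : ∀ x y, HasDerivAt (fun x => f x y) (f₁ x y) x)
    (hd2 : ∀ x y, HasDerivAt (fun y => f x y) (f₂ x y) y) (p : ℝ × ℝ) :
    HasFDerivAt (Function.uncurry f)
      ((ContinuousLinearMap.toSpanSingleton ℝ (f₁ p.1 p.2)).coprod
        (ContinuousLinearMap.toSpanSingleton ℝ (f₂ p.1 p.2))) p := by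
  have hc : Continuous fun z : ℂ => ContinuousLinearMap.toSpanSingleton ℝ z :=
    (ContinuousLinearMap.toSpanSingletonCLE (𝕜 := ℝ) (E := ℂ)).continuous
  exact (hasStrictFDerivAt_uncurry_coprod (𝕜 := ℝ) (u := p) (f := f)
    (f₁ := fun x y => ContinuousLinearMap.toSpanSingleton ℝ (f₁ x y))
    (f₂ := fun x y => ContinuousLinearMap.toSpanSingleton ℝ (f₂ x y))
    (Eventually.of_forall fun v => (hd1 v.1 v.2).hasFDerivAt)
    (Eventually.of_forall fun v => (hd2 v.1 v.2).hasFDerivAt)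
    (hc.comp h1).continuousAt (hc.comp h2).continuousAt).hasFDerivAt

lemma contDiff_one_of_partial {f f₁ f₂ : ℝ → ℝ → ℂ} (h1 : Continuous (Function.uncurry f₁))
    (h2 : Continuous (Function.uncurry f₂)) (hd1 : ∀ x y, HasDerivAt (fun x => f x y) (f₁ x y) x)
    (hd2 : ∀ x y, HasDerivAt (fun y => f x y) (f₂ x y) y) :
    ContDiff ℝ 1 (Function.uncurry f) := by
  rw [contDiff_one_iff_hasFDerivAt]
  refine ⟨_, ?_, hasFDerivAt_of_partial h1 h2 hd1 hd2⟩
  have hc : Continuous fun z : ℂ => ContinuousLinearMap.toSpanSingleton ℝ z :=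
    (ContinuousLinearMap.toSpanSingletonCLE (𝕜 := ℝ) (E := ℂ)).continuous
  have e1 : Continuous fun p : ℝ × ℝ => ContinuousLinearMap.toSpanSingleton ℝ (f₁ p.1 p.2) :=
    hc.comp h1
  have e2 : Continuous fun p : ℝ × ℝ => ContinuousLinearMap.toSpanSingleton ℝ (f₂ p.1 p.2) :=
    hc.comp h2
  have := (e1.clm_comp (continuous_const (y := ContinuousLinearMap.fst ℝ ℝ ℝ))).add
    (e2.clm_comp (continuous_const (y := ContinuousLinearMap.snd ℝ ℝ ℝ)))
  refine this.congr fun p => ?_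
  ext <;> simp

/-- The Leibniz rule for `∫_0^x F(x,t) dt`. -/
lemma hasDerivAt_integral_zero_self {F F' : ℝ → ℝ → ℂ} (hF : Continuous (Function.uncurry F))
    (hF' : Continuous (Function.uncurry F')) (hd : ∀ x t, HasDerivAt (fun x => F x t) (F' x t) x)
    (x : ℝ) :
    HasDerivAt (fun x => ∫ t in (0 : ℝ)..x, F x t) (F x x + ∫ t in (0 : ℝ)..x, F' x t) x := by
  have h := hasFDerivAt_of_partial (f := fun x y => ∫ t in (0 : ℝ)..y, F x t)
    (f₁ := fun x y => ∫ t in (0 : ℝ)..y, F' x t) (f₂ := F) ?_ hF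
    (fun x y => hasDerivAt_intervalIntegral_param hF hF' hd 0 y x)
    (fun x y => intervalIntegral.integral_hasDerivAt_right
      ((by fun_prop : Continuous (F x)).intervalIntegrable _ _)
      (by fun_prop : Continuous (F x)).stronglyMeasurable.stronglyMeasurableAtFilter
      (by fun_prop : Continuous (F x)).continuousAt) (x, x)
  · have h2 : HasDerivAt (fun x : ℝ => (x, x)) ((1 : ℝ), (1 : ℝ)) x :=
      (hasDerivAt_id x).prodMk (hasDerivAt_id x)
    have := h.comp_hasDerivAt_of_eq x h2 rfl
    simpa [Function.comp_def, Function.uncurry, add_comm] using this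
  · exact intervalIntegral.continuous_parametric_intervalIntegral_of_continuous
      (f := fun (p : ℝ × ℝ) t => F' p.1 t) (by fun_prop) continuous_snd

/-! ### The Goursat problem -/

/-- Picard iterates for the Goursat problem `H_{uv} = q(u + v) H`,
`H(u, 0) = h / 2 + (1/2) ∫_0^u q`, `H(0, v) = h / 2`. -/
noncomputable def goursatIter (q : ℝ → ℂ) (h : ℂ) : ℕ → ℝ → ℝ → ℂ
  | 0 => fun u _ => h / 2 + (1 / 2) * ∫ s in (0 : ℝ)..u, q s
  | n + 1 => fun u v => ∫ α in (0 : ℝ)..u, ∫ β in (0 : ℝ)..v, q (α + β) * goursatIter q h n α β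

lemma continuous_goursat_integral {q : ℝ → ℂ} (hq : Continuous q) {H : ℝ → ℝ → ℂ}
    (hH : Continuous (Function.uncurry H)) :
    Continuous (Function.uncurry fun u v => ∫ α in (0 : ℝ)..u, ∫ β in (0 : ℝ)..v,
      q (α + β) * H α β) := by
  refine intervalIntegral.continuous_parametric_intervalIntegral_of_continuous
    (f := fun (p : ℝ × ℝ) α => ∫ β in (0 : ℝ)..p.2, q (α + β) * H α β) ?_ continuous_fst
  exact intervalIntegral.continuous_parametric_intervalIntegral_of_continuous
    (f := fun (p : (ℝ × ℝ) × ℝ) β => q (p.2 + β) * H p.2 β) (by fun_prop)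
    (continuous_snd.comp continuous_fst)

lemma continuous_goursatIter {q : ℝ → ℂ} (hq : Continuous q) (h : ℂ) (n : ℕ) :
    Continuous (Function.uncurry (goursatIter q h n)) := by
  induction n with
  | zero =>
    have : Continuous fun u => ∫ s in (0 : ℝ)..u, q s :=
      intervalIntegral.continuous_primitive (fun a b => hq.intervalIntegrable a b) 0
    exact continuous_const.add (continuous_const.mul (this.comp continuous_fst))
  | succ n ih => exact continuous_goursat_integral hq ih

lemma abs_le_abs_of_mem_uIoc_zero {α u : ℝ} (h : α ∈ uIoc 0 u) : |α| ≤ |u| := by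
  rcases mem_uIoc.1 h with h | h
  · rw [abs_of_pos h.1, abs_of_pos (h.1.trans_le h.2)]; exact h.2
  · rw [abs_of_nonpos h.2, abs_of_neg (h.1.trans_le h.2)]; linarith [h.1]

lemma norm_integral_le_pow {g : ℝ → ℂ} {C u : ℝ} {n : ℕ}
    (hg : ∀ α ∈ uIoc 0 u, ‖g α‖ ≤ C * |α| ^ n) :
    ‖∫ α in (0 : ℝ)..u, g α‖ ≤ C * (|u| ^ (n + 1) / (n + 1)) := by
  have h := integral_pow_abs_sub_uIoc (a := 0) (b := u) (n := n)
  simp only [sub_zero] at h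
  rw [← h, ← MeasureTheory.integral_const_mul]
  refine intervalIntegral.norm_integral_le_integral_norm_uIoc.trans ?_
  refine MeasureTheory.integral_mono_of_nonneg (Eventually.of_forall fun _ => norm_nonneg _) ?_ ?_
  · refine Continuous.integrableOn_uIoc ?_
    fun_prop
  · exact (MeasureTheory.ae_restrict_iff' measurableSet_uIoc).2 (Eventually.of_forall hg)

lemma norm_goursatIter_le {q : ℝ → ℂ} {M : ℝ} (hM : ∀ x, ‖q x‖ ≤ M) (h : ℂ) {B : ℝ} (hB : 0 ≤ B)
    (n : ℕ) {u v : ℝ} (hu : |u| ≤ B) (hv : |v| ≤ B) :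
    ‖goursatIter q h n u v‖ ≤ (‖h‖ + M * B) * (M * B) ^ n * (|u| ^ n / n.factorial) := by
  have hM0 : 0 ≤ M := (norm_nonneg _).trans (hM 0)
  induction n generalizing u v with
  | zero =>
    have h1 : ‖∫ s in (0 : ℝ)..u, q s‖ ≤ M * |u - 0| :=
      intervalIntegral.norm_integral_le_of_norm_le_const fun x _ => hM x
    rw [sub_zero] at h1
    have h2 : M * |u| ≤ M * B := mul_le_mul_of_nonneg_left hu hM0
    simp only [goursatIter, pow_zero, Nat.factorial_zero, Nat.cast_one, div_one, mul_one]
    refine (norm_add_le _ _).trans ?_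
    rw [norm_mul, norm_div]
    norm_num
    have := norm_nonneg h
    have h3 := norm_nonneg (∫ s in (0 : ℝ)..u, q s)
    linarith
  | succ n ih =>
    have key : ∀ α ∈ uIoc 0 u, ‖∫ β in (0 : ℝ)..v, q (α + β) * goursatIter q h n α β‖ ≤
        ((‖h‖ + M * B) * (M * B) ^ (n + 1) / n.factorial) * |α| ^ n := by
      intro α hα
      have hα' := abs_le_abs_of_mem_uIoc_zero hα
      have h1 : ‖∫ β in (0 : ℝ)..v, q (α + β) * goursatIter q h n α β‖ ≤
          (M * ((‖h‖ + M * B) * (M * B) ^ n * (|α| ^ n / n.factorial))) * |v - 0| := by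
        refine intervalIntegral.norm_integral_le_of_norm_le_const fun β hβ => ?_
        rw [norm_mul]
        have hβ' := abs_le_abs_of_mem_uIoc_zero hβ
        exact mul_le_mul (hM _) (ih (hα'.trans hu) (hβ'.trans hv)) (norm_nonneg _) hM0
      refine h1.trans ?_
      rw [sub_zero]
      refine (mul_le_mul_of_nonneg_left hv (by positivity)).trans (le_of_eq ?_)
      rw [pow_succ]; ring
    refine (norm_integral_le_pow key).trans (le_of_eq ?_)
    rw [Nat.factorial_succ]
    push_cast
    field_simp

/-- Solution of the Goursat problem in integrated form, as the sum of the Picard iterates. -/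
lemma exists_goursat_solution {q : ℝ → ℂ} (hq : Continuous q) {M : ℝ} (hM : ∀ x, ‖q x‖ ≤ M)
    (h : ℂ) :
    ∃ H : ℝ → ℝ → ℂ, Continuous (Function.uncurry H) ∧ ∀ u v, H u v =
      h / 2 + (1 / 2) * (∫ s in (0 : ℝ)..u, q s) +
        ∫ α in (0 : ℝ)..u, ∫ β in (0 : ℝ)..v, q (α + β) * H α β := by
  have hM0 : 0 ≤ M := (norm_nonneg _).trans (hM 0)
  set c : ℝ → ℕ → ℝ := fun B n => (‖h‖ + M * B) * (M * B * B) ^ n / n.factorial with hc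
  have hcs : ∀ B, Summable (c B) := fun B => by
    simp only [hc, mul_div_assoc]
    exact (Real.summable_pow_div_factorial _).mul_left _
  have hb : ∀ B, 0 ≤ B → ∀ n u v, |u| ≤ B → |v| ≤ B → ‖goursatIter q h n u v‖ ≤ c B n := by
    intro B hB n u v hu hv
    refine (norm_goursatIter_le hM h hB n hu hv).trans ?_
    have : |u| ^ n ≤ B ^ n := pow_le_pow_left₀ (abs_nonneg _) hu n
    have h1 : c B n = (‖h‖ + M * B) * (M * B) ^ n * (B ^ n / n.factorial) := by
      simp only [hc]; ring
    rw [h1]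
    gcongr
  have hsum : ∀ u v, Summable fun n => goursatIter q h n u v := fun u v =>
    Summable.of_norm_bounded (hcs (max |u| |v|)) fun n =>
      hb _ (le_max_of_le_left (abs_nonneg _)) n u v (le_max_left _ _) (le_max_right _ _)
  refine ⟨fun u v => ∑' n, goursatIter q h n u v, ?_, fun u v => ?_⟩
  · refine continuous_iff_continuousAt.2 fun p => ?_
    set B := ‖p‖ + 1 with hB
    have hB0 : 0 ≤ B := by positivity
    have hco : ContinuousOn (fun p : ℝ × ℝ => ∑' n, goursatIter q h n p.1 p.2)
        (Metric.closedBall 0 B) := by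
      refine continuousOn_tsum (fun n => (continuous_goursatIter hq h n).continuousOn) (hcs B) ?_
      intro n p hp
      rw [mem_closedBall_zero_iff] at hp
      exact hb B hB0 n p.1 p.2 ((norm_fst_le p).trans hp) ((norm_snd_le p).trans hp)
    refine hco.continuousAt (Filter.mem_of_superset (Metric.ball_mem_nhds p one_pos) ?_)
    intro z hz
    rw [mem_closedBall_zero_iff]
    rw [mem_ball_iff_norm] at hz
    have := norm_le_norm_add_norm_sub' z p
    linarith
  · set B := max |u| |v| with hB
    have hB0 : 0 ≤ B := le_max_of_le_left (abs_nonneg _)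
    have habs : ∀ {α w : ℝ}, α ∈ uIoc 0 w → |w| ≤ B → |α| ≤ B := fun hα hw =>
      (abs_le_abs_of_mem_uIoc_zero hα).trans hw
    have hu : |u| ≤ B := le_max_left _ _
    have hv : |v| ≤ B := le_max_right _ _
    have hcont := continuous_goursatIter hq h
    have hin : ∀ n, ∀ α ∈ uIoc 0 u, ∀ β ∈ uIoc 0 v,
        ‖q (α + β) * goursatIter q h n α β‖ ≤ M * c B n := by
      intro n α hα β hβ
      rw [norm_mul]
      exact mul_le_mul (hM _) (hb B hB0 n α β (habs hα hu) (habs hβ hv)) (norm_nonneg _) hM0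
    have h1 : ∀ α ∈ uIoc 0 u, HasSum
        (fun n => ∫ β in (0 : ℝ)..v, q (α + β) * goursatIter q h n α β)
        (∫ β in (0 : ℝ)..v, q (α + β) * ∑' n, goursatIter q h n α β) := by
      intro α hα
      refine intervalIntegral.hasSum_integral_of_dominated_convergence (fun n _ => M * c B n)
        (fun n => ?_) (fun n => Eventually.of_forall (hin n α hα))
        (Eventually.of_forall fun _ _ => (hcs B).mul_left M) (by simp)
        (Eventually.of_forall fun β _ => (hsum α β).hasSum.mul_left _)
      have := hcont n
      refine Continuous.aestronglyMeasurable ?_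
      fun_prop
    have h2 : HasSum (fun n => goursatIter q h (n + 1) u v)
        (∫ α in (0 : ℝ)..u, ∫ β in (0 : ℝ)..v, q (α + β) * ∑' n, goursatIter q h n α β) := by
      refine intervalIntegral.hasSum_integral_of_dominated_convergence
        (fun n _ => M * c B n * |v - 0|) (fun n => ?_)
        (fun n => Eventually.of_forall fun α hα => ?_)
        (Eventually.of_forall fun _ _ => ((hcs B).mul_left M).mul_right _) (by simp)
        (Eventually.of_forall h1)
      · have := hcont n
        refine Continuous.aestronglyMeasurable ?_
        exact intervalIntegral.continuous_parametric_intervalIntegral_of_continuous'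
          (f := fun α β => q (α + β) * goursatIter q h n α β) (by fun_prop) 0 v
      · exact intervalIntegral.norm_integral_le_of_norm_le_const (hin n α hα)
    refine (hsum u v).tsum_eq_zero_add.trans ?_
    rw [h2.tsum_eq]
    rfl

/-- The solution `H` of the Goursat problem with its first-order partial derivatives and the mixed
second-order one. -/
lemma exists_goursat {q : ℝ → ℂ} (hq : Continuous q) {M : ℝ} (hM : ∀ x, ‖q x‖ ≤ M) (h : ℂ) :
    ∃ H H₁ H₂ : ℝ → ℝ → ℂ, Continuous (Function.uncurry H) ∧ Continuous (Function.uncurry H₁) ∧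
      Continuous (Function.uncurry H₂) ∧ (∀ u v, HasDerivAt (fun u => H u v) (H₁ u v) u) ∧
      (∀ u v, HasDerivAt (fun v => H u v) (H₂ u v) v) ∧
      (∀ u v, HasDerivAt (fun v => H₁ u v) (q (u + v) * H u v) v) ∧
      (∀ v, H 0 v = h / 2) ∧ (∀ u, H₁ u 0 = q u / 2) := by
  obtain ⟨H, hH, heq⟩ := exists_goursat_solution hq hM h
  have hprim : ∀ {g : ℝ → ℂ}, Continuous g → ∀ x, HasDerivAt (fun x => ∫ t in (0 : ℝ)..x, g t)
      (g x) x := fun {g} hg x => intervalIntegral.integral_hasDerivAt_right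
      (hg.intervalIntegrable _ _) hg.stronglyMeasurable.stronglyMeasurableAtFilter hg.continuousAt
  have hin : Continuous (Function.uncurry fun α v => ∫ β in (0 : ℝ)..v, q (α + β) * H α β) :=
    intervalIntegral.continuous_parametric_intervalIntegral_of_continuous
      (f := fun (p : ℝ × ℝ) β => q (p.1 + β) * H p.1 β) (by fun_prop) continuous_snd
  refine ⟨H, fun u v => 1 / 2 * q u + ∫ β in (0 : ℝ)..v, q (u + β) * H u β,
    fun u v => ∫ α in (0 : ℝ)..u, q (α + v) * H α v, hH, ?_, ?_, ?_, ?_, ?_, ?_, ?_⟩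
  · exact (by fun_prop : Continuous fun p : ℝ × ℝ => 1 / 2 * q p.1).add hin
  · exact intervalIntegral.continuous_parametric_intervalIntegral_of_continuous
      (f := fun (p : ℝ × ℝ) α => q (α + p.2) * H α p.2) (by fun_prop) continuous_fst
  · intro u v
    rw [show (fun u => H u v) = _ from funext fun u => heq u v]
    refine HasDerivAt.add (((hprim hq u).const_mul _).const_add _) ?_
    exact hprim (g := fun α => ∫ β in (0 : ℝ)..v, q (α + β) * H α β) (by fun_prop) u
  · intro u v
    rw [show (fun v => H u v) = _ from funext fun v => heq u v]
    refine HasDerivAt.const_add _ ?_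
    refine hasDerivAt_intervalIntegral_param (F := fun v α => ∫ β in (0 : ℝ)..v, q (α + β) * H α β)
      (F' := fun v α => q (α + v) * H α v) (hin.comp continuous_swap) (by fun_prop) ?_ 0 u v
    intro v α
    exact hprim (g := fun β => q (α + β) * H α β) (by fun_prop) v
  · intro u v
    exact (hprim (g := fun β => q (u + β) * H u β) (by fun_prop) v).const_add _
  · intro v; rw [heq]; simp
  · intro u; simp; ring

/-! ### The transmutation identity -/

/-- Second-order identity for `w(x) = ∫_{-x}^{x} K(x,t) u(t) dt`, `K(x,t) = H((x+t)/2, (x-t)/2)`: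
`w'' = q u + q w + ∫ K u''`. Since `q` is only continuous, `K` has no second derivatives. In `w'`,
the integral with `H_u` is rewritten in the variable `a = (x + t)/2`, where the next derivative in
`x` produces the mixed derivative `H_{uv} = q H`. -/
lemma goursat_transmutation {q : ℝ → ℂ} {h : ℂ} {H H₁ : ℝ → ℝ → ℂ}
    (hH : Continuous (Function.uncurry H)) (hH1 : Continuous (Function.uncurry H₁))
    (hq : Continuous q)
    (hd1 : ∀ u v, HasDerivAt (fun u => H u v) (H₁ u v) u)
    (hd12 : ∀ u v, HasDerivAt (fun v => H₁ u v) (q (u + v) * H u v) v)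
    (h0 : ∀ v, H 0 v = h / 2) (h10 : ∀ u, H₁ u 0 = q u / 2)
    {u u₁ u₂ : ℝ → ℂ} (hu2 : Continuous u₂) (hu : ∀ x, HasDerivAt u (u₁ x) x)
    (hu1 : ∀ x, HasDerivAt u₁ (u₂ x) x) :
    ∃ w₁ : ℝ → ℂ, w₁ 0 = h * u 0 ∧
      (∀ x, HasDerivAt (fun x => ∫ t in (-x)..x, H ((x + t) / 2) ((x - t) / 2) * u t) (w₁ x) x) ∧
      (∀ x, HasDerivAt w₁ (q x * u x +
        q x * (∫ t in (-x)..x, H ((x + t) / 2) ((x - t) / 2) * u t) +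
        ∫ t in (-x)..x, H ((x + t) / 2) ((x - t) / 2) * u₂ t) x) := by
  have huc : Continuous u := continuous_iff_continuousAt.2 fun y => (hu y).continuousAt
  have hu1c : Continuous u₁ := continuous_iff_continuousAt.2 fun y => (hu1 y).continuousAt
  -- the substitutions `t = 2a - x` and `t = x - 2c`
  have hsub : ∀ (G : ℝ → ℝ → ℂ) (g : ℝ → ℂ) (x : ℝ),
      (∫ t in (-x)..x, G ((x + t) / 2) ((x - t) / 2) * g t) =
        2 * ∫ a in (0 : ℝ)..x, G a (x - a) * g (2 * a - x) := by
    intro G g x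
    have := intervalIntegral.integral_comp_mul_sub (a := 0) (b := x) (c := 2)
      (fun t => G ((x + t) / 2) ((x - t) / 2) * g t) two_ne_zero x
    rw [show 2 * 0 - x = -x by ring, show 2 * x - x = x by ring] at this
    have e : ∀ a, G ((x + (2 * a - x)) / 2) ((x - (2 * a - x)) / 2) * g (2 * a - x) =
        G a (x - a) * g (2 * a - x) := by
      intro a
      rw [show (x + (2 * a - x)) / 2 = a by ring, show (x - (2 * a - x)) / 2 = x - a by ring]
    simp only [e] at this
    rw [this, Complex.real_smul, ← mul_assoc]
    simp
  have hsub' : ∀ (G : ℝ → ℝ → ℂ) (g : ℝ → ℂ) (x : ℝ),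
      (∫ a in (0 : ℝ)..x, G a (x - a) * g (2 * a - x)) =
        ∫ c in (0 : ℝ)..x, G (x - c) c * g (x - 2 * c) := by
    intro G g x
    have := intervalIntegral.integral_comp_sub_left (a := 0) (b := x)
      (fun a => G a (x - a) * g (2 * a - x)) x
    rw [sub_self, sub_zero] at this
    rw [← this]
    refine intervalIntegral.integral_congr fun c _ => ?_
    rw [show x - (x - c) = c by ring, show 2 * (x - c) - x = x - 2 * c by ring]
  have dH : ∀ (g g₁ : ℝ → ℂ), Continuous g → Continuous g₁ → (∀ x, HasDerivAt g (g₁ x) x) →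
      ∀ x, HasDerivAt (fun x => ∫ c in (0 : ℝ)..x, H (x - c) c * g (x - 2 * c))
        (h / 2 * g (-x) + ∫ c in (0 : ℝ)..x, (H₁ (x - c) c * g (x - 2 * c) +
          H (x - c) c * g₁ (x - 2 * c))) x := by
    intro g g₁ hg hg1 hd x
    have := hasDerivAt_integral_zero_self (F := fun x c => H (x - c) c * g (x - 2 * c))
      (F' := fun x c => H₁ (x - c) c * g (x - 2 * c) + H (x - c) c * g₁ (x - 2 * c))
      (by fun_prop) (by fun_prop) ?_ x
    · simpa only [sub_self, h0, show x - 2 * x = -x by ring] using this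
    · intro x c
      have e1 : HasDerivAt (fun x => H (x - c) c) (H₁ (x - c) c) x := by
        simpa using (hd1 (x - c) c).comp_sub_const x c
      have e2 : HasDerivAt (fun x => g (x - 2 * c)) (g₁ (x - 2 * c)) x := by
        simpa using (hd (x - 2 * c)).comp_sub_const x (2 * c)
      exact e1.mul e2
  have dH1 : ∀ x, HasDerivAt (fun x => ∫ a in (0 : ℝ)..x, H₁ a (x - a) * u (2 * a - x))
      (q x / 2 * u x + ∫ a in (0 : ℝ)..x, (q x * (H a (x - a) * u (2 * a - x)) -
          H₁ a (x - a) * u₁ (2 * a - x))) x := by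
    intro x
    have := hasDerivAt_integral_zero_self (F := fun x a => H₁ a (x - a) * u (2 * a - x))
      (F' := fun x a => q x * (H a (x - a) * u (2 * a - x)) - H₁ a (x - a) * u₁ (2 * a - x))
      (by fun_prop) (by fun_prop) ?_ x
    · simpa only [sub_self, h10, show 2 * x - x = x by ring] using this
    · intro x a
      have e1 : HasDerivAt (fun x => H₁ a (x - a)) (q x * H a (x - a)) x := by
        have := (hd12 a (x - a)).comp_sub_const x a
        simpa using this
      have e2 : HasDerivAt (fun x => u (2 * a - x)) (-u₁ (2 * a - x)) x := by
        simpa using (hu (2 * a - x)).comp_const_sub (2 * a) x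
      exact (e1.mul e2).congr_deriv (by ring)
  refine ⟨fun x => h * u (-x) + 2 * (∫ a in (0 : ℝ)..x, H₁ a (x - a) * u (2 * a - x)) +
    2 * ∫ c in (0 : ℝ)..x, H (x - c) c * u₁ (x - 2 * c), by simp, fun x => ?_, fun x => ?_⟩
  · simp only [hsub H, hsub' H]
    refine ((dH u u₁ huc hu1c hu x).const_mul 2).congr_deriv ?_
    rw [intervalIntegral.integral_add, hsub' H₁]
    · ring
    all_goals
      apply Continuous.intervalIntegrable
      fun_prop
  · simp only [hsub H]
    have e1 : HasDerivAt (fun x => h * u (-x)) (h * -u₁ (-x)) x := by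
      have := (hu (-x)).scomp x (hasDerivAt_neg x)
      simpa [Function.comp_def] using this.const_mul h
    refine ((e1.add ((dH1 x).const_mul 2)).add
      ((dH u₁ u₂ hu1c hu2 hu1 x).const_mul 2)).congr_deriv ?_
    rw [intervalIntegral.integral_add, intervalIntegral.integral_sub,
      intervalIntegral.integral_const_mul, ← hsub' H₁ u₁, ← hsub' H u₂]
    · ring
    all_goals
      apply Continuous.intervalIntegrable
      fun_prop

/-! ### Second derivatives on an interval -/

/-- `y` is `C²` on `s` (one-sidedly at boundary points), with derivatives `y₁` and `y₂`. -/
structure HasSecondDerivOn (s : Set ℝ) (y y₁ y₂ : ℝ → ℂ) : Prop where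
  hasDeriv : ∀ x ∈ s, HasDerivWithinAt y (y₁ x) s x
  hasDeriv₁ : ∀ x ∈ s, HasDerivWithinAt y₁ (y₂ x) s x
  cont : ContinuousOn y₂ s

lemma HasSecondDerivOn.of_contDiffOn {a c : ℝ} (hac : a < c) {y : ℝ → ℂ}
    (hy : ContDiffOn ℝ 2 y (Icc a c)) :
    HasSecondDerivOn (Icc a c) y (derivWithin y (Icc a c))
      (iteratedDerivWithin 2 y (Icc a c)) := by
  have hs := uniqueDiffOn_Icc hac
  rw [show (2 : WithTop ℕ∞) = 1 + 1 from rfl, contDiffOn_succ_iff_derivWithin hs] at hy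
  obtain ⟨h1, -, h2⟩ := hy
  rw [contDiffOn_one_iff_derivWithin hs] at h2
  rw [show iteratedDerivWithin 2 y (Icc a c) =
    derivWithin (derivWithin y (Icc a c)) (Icc a c) by
      rw [iteratedDerivWithin_succ, iteratedDerivWithin_one]]
  exact ⟨fun x hx => (h1 x hx).hasDerivWithinAt, fun x hx => (h2.1 x hx).hasDerivWithinAt, h2.2⟩

lemma HasSecondDerivOn.iteratedDerivWithin_eq {a c : ℝ} (hac : a < c) {y y₁ y₂ : ℝ → ℂ}
    (h : HasSecondDerivOn (Icc a c) y y₁ y₂) :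
    EqOn (iteratedDerivWithin 2 y (Icc a c)) y₂ (Icc a c) := by
  have hs := uniqueDiffOn_Icc hac
  have e1 : EqOn (derivWithin y (Icc a c)) y₁ (Icc a c) := fun x hx =>
    (h.hasDeriv x hx).derivWithin (hs x hx)
  intro x hx
  rw [iteratedDerivWithin_succ, iteratedDerivWithin_one]
  rw [derivWithin_congr e1 (e1 hx)]
  exact (h.hasDeriv₁ x hx).derivWithin (hs x hx)

lemma HasSecondDerivOn.contDiffOn {a c : ℝ} (hac : a < c) {y y₁ y₂ : ℝ → ℂ}
    (h : HasSecondDerivOn (Icc a c) y y₁ y₂) : ContDiffOn ℝ 2 y (Icc a c) := by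
  have hs := uniqueDiffOn_Icc hac
  have e1 : EqOn (derivWithin y (Icc a c)) y₁ (Icc a c) := fun x hx =>
    (h.hasDeriv x hx).derivWithin (hs x hx)
  rw [show (2 : WithTop ℕ∞) = 1 + 1 from rfl, contDiffOn_succ_iff_derivWithin hs]
  refine ⟨fun x hx => (h.hasDeriv x hx).differentiableWithinAt, by simp, ?_⟩
  rw [contDiffOn_congr e1, contDiffOn_one_iff_derivWithin hs]
  refine ⟨fun x hx => (h.hasDeriv₁ x hx).differentiableWithinAt, ?_⟩
  exact h.cont.congr fun x hx => (h.hasDeriv₁ x hx).derivWithin (hs x hx)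

lemma HasSecondDerivOn.congr {s : Set ℝ} {y y₁ y₂ z z₂ : ℝ → ℂ} (h : HasSecondDerivOn s y y₁ y₂)
    (hz : EqOn z y s) (hz2 : EqOn z₂ y₂ s) : HasSecondDerivOn s z y₁ z₂ :=
  ⟨fun x hx => (h.hasDeriv x hx).congr hz (hz hx),
    fun x hx => by rw [hz2 hx]; exact h.hasDeriv₁ x hx, h.cont.congr hz2⟩

lemma eqOn_of_hasDerivWithinAt_eq {a c x₀ : ℝ} {y z y₁ : ℝ → ℂ} (h0 : x₀ ∈ Icc a c)
    (hy : ∀ x ∈ Icc a c, HasDerivWithinAt y (y₁ x) (Icc a c) x)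
    (hz : ∀ x ∈ Icc a c, HasDerivWithinAt z (y₁ x) (Icc a c) x) (hyz : y x₀ = z x₀) :
    EqOn y z (Icc a c) := by
  intro x hx
  have := Convex.norm_image_sub_le_of_norm_hasDerivWithin_le (C := 0)
    (fun x hx => (hy x hx).sub (hz x hx)) (fun x _ => by simp) (convex_Icc a c) h0 hx
  simp only [Pi.sub_apply, hyz, sub_self, sub_zero, zero_mul, norm_le_zero_iff] at this
  exact sub_eq_zero.1 this

lemma hasDerivAt_primitive {g : ℝ → ℂ} (hg : Continuous g) (a x : ℝ) :
    HasDerivAt (fun x => ∫ t in a..x, g t) (g x) x :=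
  intervalIntegral.integral_hasDerivAt_right (hg.intervalIntegrable _ _)
    hg.stronglyMeasurable.stronglyMeasurableAtFilter hg.continuousAt

lemma hasDerivWithinAt_primitive {c : ℝ} (hc : 0 ≤ c) {g : ℝ → ℂ} (hg : ContinuousOn g (Icc 0 c))
    {x : ℝ} (hx : x ∈ Icc 0 c) :
    HasDerivWithinAt (fun x => ∫ t in (0 : ℝ)..x, g t) (g x) (Icc 0 c) x := by
  set G := IccExtend hc ((Icc 0 c).domRestrict g)
  have hGc : Continuous G := (continuousOn_iff_continuous_domRestrict.1 hg).Icc_extend'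
  have hGg : ∀ y ∈ Icc 0 c, G y = g y := fun y hy => IccExtend_of_mem hc _ hy
  have e : EqOn (fun x => ∫ t in (0 : ℝ)..x, g t) (fun x => ∫ t in (0 : ℝ)..x, G t) (Icc 0 c) := by
    intro y hy
    refine intervalIntegral.integral_congr fun t ht => ?_
    rw [uIcc_of_le hy.1] at ht
    exact (hGg t ⟨ht.1, ht.2.trans hy.2⟩).symm
  rw [← hGg x hx]
  exact (hasDerivAt_primitive hGc 0 x).hasDerivWithinAt.congr e (e hx)

/-- Every `C²` function on `[-b, b]` extends to a `C²` function on the line: extend the second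
derivative by constants and integrate twice. -/
lemma HasSecondDerivOn.exists_extension {b : ℝ} (hb : 0 < b) {u u₁ u₂ : ℝ → ℂ}
    (h : HasSecondDerivOn (Icc (-b) b) u u₁ u₂) :
    ∃ v v₁ v₂ : ℝ → ℂ, Continuous v₂ ∧ (∀ x, HasDerivAt v (v₁ x) x) ∧
      (∀ x, HasDerivAt v₁ (v₂ x) x) ∧ EqOn v u (Icc (-b) b) ∧ EqOn v₂ u₂ (Icc (-b) b) := by
  have hle : -b ≤ b := by linarith
  have h0 : (0 : ℝ) ∈ Icc (-b) b := ⟨by linarith, hb.le⟩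
  set v₂ := IccExtend hle ((Icc (-b) b).domRestrict u₂)
  have hv2c : Continuous v₂ := (continuousOn_iff_continuous_domRestrict.1 h.cont).Icc_extend'
  have e2 : EqOn v₂ u₂ (Icc (-b) b) := fun y hy => IccExtend_of_mem hle _ hy
  set v₁ : ℝ → ℂ := fun x => u₁ 0 + ∫ t in (0 : ℝ)..x, v₂ t with hv1
  have d1 : ∀ x, HasDerivAt v₁ (v₂ x) x := fun x => (hasDerivAt_primitive hv2c 0 x).const_add _
  have hv1c : Continuous v₁ := continuous_iff_continuousAt.2 fun x => (d1 x).continuousAt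
  have e1 : EqOn v₁ u₁ (Icc (-b) b) :=
    eqOn_of_hasDerivWithinAt_eq h0 (fun x _ => (d1 x).hasDerivWithinAt)
      (fun x hx => by rw [e2 hx]; exact h.hasDeriv₁ x hx) (by simp [hv1])
  refine ⟨fun x => u 0 + ∫ t in (0 : ℝ)..x, v₁ t, v₁, v₂, hv2c,
    fun x => (hasDerivAt_primitive hv1c 0 x).const_add _, d1, ?_, e2⟩
  exact eqOn_of_hasDerivWithinAt_eq h0
    (fun x _ => ((hasDerivAt_primitive hv1c 0 x).const_add _).hasDerivWithinAt)
    (fun x hx => by rw [e1 hx]; exact h.hasDeriv x hx) (by simp)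

/-- Uniqueness for `y'' = q y` in the presence of a solution `f` without zeros: the Wronskian of `y`
and `f` vanishes, so that `y / f` is constant. -/
lemma eq_zero_of_ode {b : ℝ} (hb : 0 < b) {q f f₁ y y₁ : ℝ → ℂ}
    (hfne : ∀ x ∈ Icc 0 b, f x ≠ 0)
    (hf : ∀ x ∈ Icc 0 b, HasDerivWithinAt f (f₁ x) (Icc 0 b) x)
    (hf1 : ∀ x ∈ Icc 0 b, HasDerivWithinAt f₁ (q x * f x) (Icc 0 b) x)
    (hy : ∀ x ∈ Icc 0 b, HasDerivWithinAt y (y₁ x) (Icc 0 b) x)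
    (hy1 : ∀ x ∈ Icc 0 b, HasDerivWithinAt y₁ (q x * y x) (Icc 0 b) x)
    (h0 : y 0 = 0) (h1 : y₁ 0 = 0) : ∀ x ∈ Icc 0 b, y x = 0 := by
  have hm : (0 : ℝ) ∈ Icc 0 b := ⟨le_rfl, hb.le⟩
  have hW : EqOn (fun x => y₁ x * f x - y x * f₁ x) (fun _ => 0) (Icc 0 b) := by
    refine eqOn_of_hasDerivWithinAt_eq (y₁ := fun _ => 0) hm (fun x hx => ?_)
      (fun x _ => hasDerivWithinAt_const _ _ _) (by simp [h0, h1])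
    exact (((hy1 x hx).mul (hf x hx)).sub ((hy x hx).mul (hf1 x hx))).congr_deriv (by ring)
  have hQ : EqOn (fun x => y x / f x) (fun _ => 0) (Icc 0 b) := by
    refine eqOn_of_hasDerivWithinAt_eq (y₁ := fun _ => 0) hm (fun x hx => ?_)
      (fun x _ => hasDerivWithinAt_const _ _ _) (by simp [h0])
    refine ((hy x hx).div (hf x hx) (hfne x hx)).congr_deriv ?_
    have : y₁ x * f x - y x * f₁ x = 0 := hW hx
    rw [this, zero_div]
  intro x hx
  have : y x / f x = 0 := hQ hx
  exact (div_eq_zero_iff.1 this).resolve_right (hfne x hx)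

/-! ### Formal powers -/

section FormalPowers

variable {b : ℝ} {f : ℝ → ℂ}

lemma hasDerivWithinAt_recX (hb : 0 ≤ b) (hf : ContinuousOn f (Icc 0 b))
    (hfne : ∀ x ∈ Icc 0 b, f x ≠ 0) (n : ℕ) :
    ∀ x ∈ Icc 0 b, HasDerivWithinAt (recX f (n + 1))
      (((n : ℂ) + 1) * (recX f n x * ((f x) ^ 2) ^ ((-1 : ℤ) ^ (n + 1)))) (Icc 0 b) x := by
  have hc : ∀ n, ContinuousOn (recX f n) (Icc 0 b) → ContinuousOn
      (fun s => recX f n s * ((f s) ^ 2) ^ ((-1 : ℤ) ^ (n + 1))) (Icc 0 b) := fun n h =>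
    h.mul ((hf.pow 2).zpow₀ _ fun x hx => Or.inl (pow_ne_zero 2 (hfne x hx)))
  have key : ∀ n, ContinuousOn (recX f n) (Icc 0 b) → ∀ x ∈ Icc 0 b,
      HasDerivWithinAt (recX f (n + 1))
      (((n : ℂ) + 1) * (recX f n x * ((f x) ^ 2) ^ ((-1 : ℤ) ^ (n + 1)))) (Icc 0 b) x :=
    fun n h x hx => (hasDerivWithinAt_primitive hb (hc n h) hx).const_mul _
  refine key n ?_
  induction n with
  | zero => exact continuousOn_const
  | succ n ih => exact fun x hx => (key n ih x hx).continuousWithinAt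

lemma hasDerivWithinAt_recXt (hb : 0 ≤ b) (hf : ContinuousOn f (Icc 0 b))
    (hfne : ∀ x ∈ Icc 0 b, f x ≠ 0) (n : ℕ) :
    ∀ x ∈ Icc 0 b, HasDerivWithinAt (recXt f (n + 1))
      (((n : ℂ) + 1) * (recXt f n x * ((f x) ^ 2) ^ ((-1 : ℤ) ^ n))) (Icc 0 b) x := by
  have hc : ∀ n, ContinuousOn (recXt f n) (Icc 0 b) → ContinuousOn
      (fun s => recXt f n s * ((f s) ^ 2) ^ ((-1 : ℤ) ^ n)) (Icc 0 b) := fun n h =>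
    h.mul ((hf.pow 2).zpow₀ _ fun x hx => Or.inl (pow_ne_zero 2 (hfne x hx)))
  have key : ∀ n, ContinuousOn (recXt f n) (Icc 0 b) → ∀ x ∈ Icc 0 b,
      HasDerivWithinAt (recXt f (n + 1))
      (((n : ℂ) + 1) * (recXt f n x * ((f x) ^ 2) ^ ((-1 : ℤ) ^ n))) (Icc 0 b) x :=
    fun n h x hx => (hasDerivWithinAt_primitive hb (hc n h) hx).const_mul _
  refine key n ?_
  induction n with
  | zero => exact continuousOn_const
  | succ n ih => exact fun x hx => (key n ih x hx).continuousWithinAt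

lemma formalPower_zero (x : ℝ) : formalPower f 0 x = f x := by
  simp [formalPower, recXt]

/-- The two derivatives of a product `f X` when `X' = k Z / f²` and `Z' = z f²`. -/
lemma hasDerivWithinAt_formal_product {q f₁ X Z z : ℝ → ℂ} {k : ℂ}
    (hfne : ∀ x ∈ Icc 0 b, f x ≠ 0)
    (hf : ∀ x ∈ Icc 0 b, HasDerivWithinAt f (f₁ x) (Icc 0 b) x)
    (hf1 : ∀ x ∈ Icc 0 b, HasDerivWithinAt f₁ (q x * f x) (Icc 0 b) x)
    (hX : ∀ x ∈ Icc 0 b, HasDerivWithinAt X (k * (Z x * (f x ^ 2)⁻¹)) (Icc 0 b) x)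
    (hZ : ∀ x ∈ Icc 0 b, HasDerivWithinAt Z (z x * f x ^ 2) (Icc 0 b) x) :
    (∀ x ∈ Icc 0 b, HasDerivWithinAt (fun x => f x * X x)
      (f₁ x * X x + k * Z x / f x) (Icc 0 b) x) ∧
    (∀ x ∈ Icc 0 b, HasDerivWithinAt (fun x => f₁ x * X x + k * Z x / f x)
      (q x * (f x * X x) + k * (z x * f x)) (Icc 0 b) x) := by
  refine ⟨fun x hx => ?_, fun x hx => ?_⟩
  · refine ((hf x hx).mul (hX x hx)).congr_deriv ?_
    have := hfne x hx
    field_simp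
  · refine (((hf1 x hx).mul (hX x hx)).add
      (((hZ x hx).const_mul k).div (hf x hx) (hfne x hx))).congr_deriv ?_
    have := hfne x hx
    field_simp
    ring

/-- The formal powers solve `φ_k'' = q φ_k + k (k - 1) φ_{k-2}`, with vanishing value at `0`, and
with derivative at `0` equal to `1` for `k = 1` and to `0` for `k ≥ 2`. The statement is for
`k + 1`; at `k = 0` the factor `k` removes the term with the truncated index `k - 1`. -/
lemma formalPower_ode (hb : 0 < b) {q f₁ : ℝ → ℂ} (hf0 : f 0 = 1)
    (hfne : ∀ x ∈ Icc 0 b, f x ≠ 0)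
    (hf : ∀ x ∈ Icc 0 b, HasDerivWithinAt f (f₁ x) (Icc 0 b) x)
    (hf1 : ∀ x ∈ Icc 0 b, HasDerivWithinAt f₁ (q x * f x) (Icc 0 b) x) (k : ℕ) :
    ∃ φ₁ : ℝ → ℂ,
      (∀ x ∈ Icc 0 b, HasDerivWithinAt (formalPower f (k + 1)) (φ₁ x) (Icc 0 b) x) ∧
      (∀ x ∈ Icc 0 b, HasDerivWithinAt φ₁ (q x * formalPower f (k + 1) x +
        ((k : ℂ) + 1) * (k * formalPower f (k - 1) x)) (Icc 0 b) x) ∧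
      formalPower f (k + 1) 0 = 0 ∧ φ₁ 0 = if k = 0 then 1 else 0 := by
  have hfc : ContinuousOn f (Icc 0 b) := fun x hx => (hf x hx).continuousWithinAt
  have dX := hasDerivWithinAt_recX hb.le hfc hfne
  have dXt := hasDerivWithinAt_recXt hb.le hfc hfne
  rcases Nat.even_or_odd k with he | ho
  · have hodd : Odd (k + 1) := he.add_one
    have e1 : formalPower f (k + 1) = fun x => f x * recX f (k + 1) x :=
      funext fun x => if_pos hodd
    have hX : ∀ x ∈ Icc 0 b, HasDerivWithinAt (recX f (k + 1))
        (((k : ℂ) + 1) * (recX f k x * (f x ^ 2)⁻¹)) (Icc 0 b) x := fun x hx => by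
      simpa [hodd.neg_one_pow] using dX k x hx
    have hZ : ∀ x ∈ Icc 0 b, HasDerivWithinAt (recX f k)
        ((k * recX f (k - 1) x) * f x ^ 2) (Icc 0 b) x := fun x hx => by
      rcases k with _ | k
      · exact (hasDerivWithinAt_const x (Icc 0 b) (1 : ℂ)).congr_deriv (by simp)
      · have := dX k x hx
        rw [he.neg_one_pow, zpow_one] at this
        simpa [mul_assoc] using this
    obtain ⟨h1, h2⟩ := hasDerivWithinAt_formal_product hfne hf hf1 hX hZ
    rw [e1]
    refine ⟨_, h1, fun x hx => (h2 x hx).congr_deriv ?_, by simp [recX], ?_⟩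
    · rcases k with _ | k
      · simp
      · have : Odd (k + 1 - 1) := by
          simpa using (Nat.even_add_one.1 he)
        simp only [formalPower, if_pos this]
        ring
    · rcases k with _ | k <;> simp [recX, hf0]
  · have heven : ¬ Odd (k + 1) := by simpa using ho.add_one
    have e1 : formalPower f (k + 1) = fun x => f x * recXt f (k + 1) x :=
      funext fun x => if_neg heven
    have hX : ∀ x ∈ Icc 0 b, HasDerivWithinAt (recXt f (k + 1))
        (((k : ℂ) + 1) * (recXt f k x * (f x ^ 2)⁻¹)) (Icc 0 b) x := fun x hx => by
      simpa [ho.neg_one_pow] using dXt k x hx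
    obtain ⟨m, rfl⟩ : ∃ m, k = m + 1 := ⟨k - 1, by have := ho.pos; omega⟩
    have hm : Even m := by
      have := ho; rw [Nat.odd_add_one] at this; simpa using this
    have hZ : ∀ x ∈ Icc 0 b, HasDerivWithinAt (recXt f (m + 1))
        ((((m + 1 : ℕ) : ℂ) * recXt f m x) * f x ^ 2) (Icc 0 b) x := fun x hx => by
      have := dXt m x hx
      rw [hm.neg_one_pow, zpow_one] at this
      simpa [mul_assoc] using this
    obtain ⟨h1, h2⟩ := hasDerivWithinAt_formal_product hfne hf hf1 hX hZ
    rw [e1]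
    refine ⟨_, h1, fun x hx => (h2 x hx).congr_deriv ?_, by simp [recXt], by simp [recXt]⟩
    have : ¬ Odd (m + 1 - 1) := by simpa using hm
    simp only [formalPower, if_neg this]
    simp only [Nat.add_sub_cancel]
    ring

end FormalPowers

/-! ### Transmutation kernels -/

lemma transmute_congr {K : ℝ → ℝ → ℂ} {u v : ℝ → ℂ} {x : ℝ} (hx : 0 ≤ x)
    (h : EqOn u v (Icc (-x) x)) : transmute K u x = transmute K v x := by
  rw [transmute, transmute, h ⟨by linarith, le_rfl⟩]
  congr 1
  refine intervalIntegral.integral_congr fun t ht => ?_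
  rw [uIcc_of_le (by linarith)] at ht
  rw [h ht]

lemma transmute_zero (K : ℝ → ℝ → ℂ) (u : ℝ → ℂ) : transmute K u 0 = u 0 := by
  simp [transmute]

lemma transmute_const_mul (K : ℝ → ℝ → ℂ) (c : ℂ) (u : ℝ → ℂ) (x : ℝ) :
    transmute K (fun t => c * u t) x = c * transmute K u x := by
  simp only [transmute]
  rw [mul_add, ← intervalIntegral.integral_const_mul]
  congr 2
  ext t
  ring

lemma transmute_neg (K : ℝ → ℝ → ℂ) (u : ℝ → ℂ) (x : ℝ) :
    transmute K (fun t => -u t) x = -transmute K u x := by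
  simpa using transmute_const_mul K (-1) u x

section Kernel

variable {b : ℝ} {q f : ℝ → ℂ} {K : ℝ → ℝ → ℂ}

lemma IsTransmutationKernel.exists_bound (hK : IsTransmutationKernel b q f K) :
    ∃ C, 0 ≤ C ∧ ∀ x ∈ Icc 0 b, ∀ t ∈ Icc (-x) x, ‖K x t‖ ≤ C := by
  have hcomp : IsCompact {p : ℝ × ℝ | 0 ≤ p.1 ∧ p.1 ≤ b ∧ |p.2| ≤ p.1} := by
    refine (isCompact_Icc (a := (0, -b)) (b := (b, b))).of_isClosed_subset ?_ ?_
    · have h1 : IsClosed {p : ℝ × ℝ | 0 ≤ p.1} := isClosed_le continuous_const continuous_fst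
      have h2 : IsClosed {p : ℝ × ℝ | p.1 ≤ b} := isClosed_le continuous_fst continuous_const
      have h3 : IsClosed {p : ℝ × ℝ | |p.2| ≤ p.1} := isClosed_le continuous_snd.abs continuous_fst
      exact h1.inter (h2.inter h3)
    · rintro ⟨x, t⟩ ⟨h1, h2, h3⟩
      simp only at h1 h2 h3
      rw [abs_le] at h3
      exact ⟨⟨h1, by simp only; linarith⟩, ⟨h2, by simp only; linarith⟩⟩
  obtain ⟨C, hC⟩ := hcomp.exists_bound_of_continuousOn hK.contDiffOn.continuousOn
  exact ⟨max C 0, le_max_right _ _, fun x hx t ht =>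
    (hC (x, t) ⟨hx.1, hx.2, abs_le.2 ht⟩).trans (le_max_left _ _)⟩

lemma IsTransmutationKernel.continuousOn (hK : IsTransmutationKernel b q f K) {x : ℝ}
    (hx : x ∈ Icc 0 b) : ContinuousOn (K x) (Icc (-x) x) := by
  refine hK.contDiffOn.continuousOn.comp (f := fun t => (x, t)) (by fun_prop) ?_
  exact fun t ht => ⟨hx.1, hx.2, abs_le.2 ht⟩

lemma hasSecondDerivOn_pow (k : ℕ) (s : Set ℝ) :
    HasSecondDerivOn s (fun t : ℝ => (t : ℂ) ^ k) (fun t => k * (t : ℂ) ^ (k - 1))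
      (fun t => k * (((k - 1 : ℕ) : ℂ) * (t : ℂ) ^ (k - 1 - 1))) := by
  have h : ∀ (k : ℕ) (x : ℝ), HasDerivAt (fun t : ℝ => (t : ℂ) ^ k) (k * (x : ℂ) ^ (k - 1)) x :=
    fun k x => by
      have := (hasDerivAt_pow k (x : ℂ)).comp_ofReal
      simpa using this
  exact ⟨fun x _ => (h k x).hasDerivWithinAt, fun x _ => ((h _ x).const_mul _).hasDerivWithinAt,
    by fun_prop⟩

lemma IsTransmutationKernel.hasSecondDerivOn (hb : 0 < b) (hK : IsTransmutationKernel b q f K)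
    {u u₁ u₂ : ℝ → ℂ} (hu : HasSecondDerivOn (Icc (-b) b) u u₁ u₂) :
    ∃ y₁ y₂, HasSecondDerivOn (Icc 0 b) (transmute K u) y₁ y₂ ∧
      ∀ x ∈ Icc 0 b, y₂ x = q x * transmute K u x + transmute K u₂ x := by
  have hlt : -b < b := by linarith
  obtain ⟨h1, h2⟩ := hK.intertwines u (hu.contDiffOn hlt)
  refine ⟨_, _, HasSecondDerivOn.of_contDiffOn hb h1, fun x hx => ?_⟩
  have h3 := h2 x hx
  have e : transmute K (fun t => -(iteratedDerivWithin 2 u (Icc (-b) b) t)) x =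
      - transmute K u₂ x := by
    rw [transmute_neg]
    refine congrArg _ (transmute_congr hx.1 fun t ht => ?_)
    exact hu.iteratedDerivWithin_eq hlt ⟨by linarith [ht.1, hx.2], ht.2.trans hx.2⟩
  rw [e] at h3
  linear_combination -h3

/-- The transform of `t^(k+1)` has the same derivative at `0` as `t^(k+1)` itself, because
`∫_{-x}^{x} K(x,t) t^(k+1) dt = O(x²)`. -/
lemma IsTransmutationKernel.hasDerivWithinAt_zero (hK : IsTransmutationKernel b q f K) (hb : 0 < b)
    (k : ℕ) : HasDerivWithinAt (transmute K fun t : ℝ => (t : ℂ) ^ (k + 1))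
      (if k = 0 then 1 else 0) (Icc 0 b) 0 := by
  obtain ⟨C, hC0, hC⟩ := hK.exists_bound
  have h1 : HasDerivWithinAt (fun t : ℝ => (t : ℂ) ^ (k + 1)) (if k = 0 then 1 else 0)
      (Icc 0 b) 0 := by
    refine ((hasSecondDerivOn_pow (k + 1) (Icc 0 b)).hasDeriv 0 ⟨le_rfl, hb.le⟩).congr_deriv ?_
    rcases k with _ | k <;> simp
  have h2 : HasDerivWithinAt (fun x => ∫ t in (-x)..x, K x t * (t : ℂ) ^ (k + 1)) 0
      (Icc 0 b) 0 := by
    rw [hasDerivWithinAt_iff_hasFDerivWithinAt]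
    have : (fun x => ∫ t in (-x)..x, K x t * (t : ℂ) ^ (k + 1)) =O[𝓝[Icc 0 b] (0 : ℝ)]
        fun x => ‖x - 0‖ ^ 2 := by
      refine Asymptotics.IsBigO.of_bound (2 * C * b ^ k) ?_
      filter_upwards [self_mem_nhdsWithin] with x hx
      have h := intervalIntegral.norm_integral_le_of_norm_le_const (a := -x) (b := x)
        (C := C * x ^ (k + 1)) (f := fun t => K x t * (t : ℂ) ^ (k + 1)) ?_
      · refine h.trans ?_
        rw [sub_neg_eq_add, abs_of_nonneg (by linarith [hx.1]), sub_zero, norm_pow, norm_norm,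
          Real.norm_eq_abs, sq_abs, pow_succ]
        have : x ^ k ≤ b ^ k := pow_le_pow_left₀ hx.1 hx.2 k
        have := mul_le_mul_of_nonneg_left this (mul_nonneg hC0 (sq_nonneg x))
        linarith
      · intro t ht
        rw [uIoc_of_le (by linarith [hx.1])] at ht
        have ht' : t ∈ Icc (-x) x := Ioc_subset_Icc_self ht
        rw [norm_mul, norm_pow, Complex.norm_real, Real.norm_eq_abs]
        exact mul_le_mul (hC x hx t ht') (pow_le_pow_left₀ (abs_nonneg _) (abs_le.2 ht') _)
          (by positivity) hC0
    simpa using this.hasFDerivWithinAt (𝕜 := ℝ) ⟨le_rfl, hb.le⟩ one_lt_two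
  exact (h1.add h2).congr_deriv (add_zero _)

/-- The transmutation operator maps `t^k` to the formal power `φ_k`. -/
lemma IsTransmutationKernel.transmute_pow (hb : 0 < b) {f₁ : ℝ → ℂ} (hf0 : f 0 = 1)
    (hfne : ∀ x ∈ Icc 0 b, f x ≠ 0)
    (hf : ∀ x ∈ Icc 0 b, HasDerivWithinAt f (f₁ x) (Icc 0 b) x)
    (hf1 : ∀ x ∈ Icc 0 b, HasDerivWithinAt f₁ (q x * f x) (Icc 0 b) x)
    (hK : IsTransmutationKernel b q f K) (k : ℕ) :
    ∀ x ∈ Icc 0 b, transmute K (fun t : ℝ => (t : ℂ) ^ k) x = formalPower f k x := by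
  have hm : (0 : ℝ) ∈ Icc 0 b := ⟨le_rfl, hb.le⟩
  have step : ∀ k : ℕ, (k ≠ 0 → ∀ x ∈ Icc 0 b,
      transmute K (fun t : ℝ => (t : ℂ) ^ (k - 1)) x = formalPower f (k - 1) x) →
      ∀ x ∈ Icc 0 b, transmute K (fun t : ℝ => (t : ℂ) ^ (k + 1)) x = formalPower f (k + 1) x := by
    intro k ih x hx
    obtain ⟨φ₁, p1, p2, p3, p4⟩ := formalPower_ode hb hf0 hfne hf hf1 k
    obtain ⟨y₁, y₂, hy, hy2⟩ := hK.hasSecondDerivOn hb (hasSecondDerivOn_pow (k + 1) _)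
    have hy0 : y₁ 0 = if k = 0 then 1 else 0 := by
      have hs := (uniqueDiffOn_Icc hb) 0 hm
      rw [← (hy.hasDeriv 0 hm).derivWithin hs, (hK.hasDerivWithinAt_zero hb k).derivWithin hs]
    have := eq_zero_of_ode hb hfne hf hf1
      (y := fun x => transmute K (fun t : ℝ => (t : ℂ) ^ (k + 1)) x - formalPower f (k + 1) x)
      (y₁ := fun x => y₁ x - φ₁ x) (fun x hx => (hy.hasDeriv x hx).sub (p1 x hx)) ?_ ?_ ?_ x hx
    · exact sub_eq_zero.1 this
    · intro x hx
      refine ((hy.hasDeriv₁ x hx).sub (p2 x hx)).congr_deriv ?_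
      rw [hy2 x hx, transmute_const_mul, transmute_const_mul]
      rcases eq_or_ne k 0 with h | h
      · subst h; simp; ring
      · simp only [Nat.add_sub_cancel]
        rw [ih h x hx]; push_cast; ring
    · simp [transmute_zero, p3]
    · simp [hy0, p4]
  induction k using Nat.twoStepInduction with
  | zero =>
    intro x hx
    simpa [formalPower_zero] using hK.map_one x hx
  | one => exact step 0 (fun h => absurd rfl h)
  | more k ih _ => exact step (k + 1) (fun _ => ih)

/-- A continuous function on `[a, c]` all of whose moments vanish is zero. -/
lemma eq_zero_of_moments_real {a c : ℝ} (hac : a < c) {d : ℝ → ℝ} (hd : ContinuousOn d (Icc a c))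
    (h : ∀ k : ℕ, ∫ t in a..c, d t * t ^ k = 0) : ∀ t ∈ Icc a c, d t = 0 := by
  have hle := hac.le
  have hI : ∀ {g : ℝ → ℝ}, ContinuousOn g (Icc a c) →
      IntervalIntegrable g MeasureTheory.volume a c := fun {g} hg =>
    ContinuousOn.intervalIntegrable (by rwa [uIcc_of_le hle])
  have hp : ∀ p : Polynomial ℝ, ∫ t in a..c, d t * p.eval t = 0 := by
    intro p
    simp only [Polynomial.eval_eq_sum_range, Finset.mul_sum]
    rw [intervalIntegral.integral_finsetSum]
    · refine Finset.sum_eq_zero fun k _ => ?_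
      have : ∀ t, d t * (p.coeff k * t ^ k) = p.coeff k * (d t * t ^ k) := fun t => by ring
      simp only [this]
      rw [intervalIntegral.integral_const_mul, h, mul_zero]
    · intro k _
      exact hI (hd.mul (by fun_prop))
  have hsq : ∫ t in a..c, d t * d t = 0 := by
    have hnn : 0 ≤ ∫ t in a..c, d t * d t :=
      intervalIntegral.integral_nonneg hle fun t _ => mul_self_nonneg _
    have hAn : 0 ≤ ∫ t in a..c, |d t| :=
      intervalIntegral.integral_nonneg hle fun t _ => abs_nonneg _
    refine le_antisymm (le_of_forall_pos_le_add fun ε hε => ?_) hnn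
    set A := ∫ t in a..c, |d t| with hA
    obtain ⟨p, hpd⟩ := exists_polynomial_near_of_continuousOn a c d hd (ε / (A + 1)) (by positivity)
    have e : ∫ t in a..c, d t * d t = ∫ t in a..c, d t * (d t - p.eval t) := by
      simp only [mul_sub]
      refine Eq.trans ?_ (intervalIntegral.integral_sub (hI (hd.mul hd))
        (hI (hd.mul p.continuous.continuousOn))).symm
      exact (sub_eq_self.2 (hp p)).symm
    have hle2 : ∫ t in a..c, d t * (d t - p.eval t) ≤ ∫ t in a..c, |d t| * (ε / (A + 1)) := by
      refine intervalIntegral.integral_mono_on hle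
        (hI (hd.mul (hd.sub p.continuous.continuousOn))) (hI (hd.abs.mul continuousOn_const)) ?_
      intro t ht
      refine (le_abs_self _).trans ?_
      rw [abs_mul, abs_sub_comm]
      exact mul_le_mul_of_nonneg_left (hpd t ht).le (abs_nonneg _)
    rw [intervalIntegral.integral_mul_const] at hle2
    rw [e, zero_add]
    refine hle2.trans ?_
    rw [← hA, mul_div_assoc', div_le_iff₀ (by positivity)]
    linarith
  by_contra! hne
  obtain ⟨t, ht, hne⟩ := hne
  have := intervalIntegral.integral_pos hac (hd.mul hd) (fun t _ => mul_self_nonneg _)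
    ⟨t, ht, mul_self_pos.2 hne⟩
  exact this.ne' hsq

lemma eq_zero_of_moments {a c : ℝ} (hac : a < c) {d : ℝ → ℂ} (hd : ContinuousOn d (Icc a c))
    (h : ∀ k : ℕ, ∫ t in a..c, d t * (t : ℂ) ^ k = 0) : ∀ t ∈ Icc a c, d t = 0 := by
  have hI : ∀ k : ℕ, IntervalIntegrable (fun t : ℝ => d t * (t : ℂ) ^ k)
      MeasureTheory.volume a c := fun k =>
    ContinuousOn.intervalIntegrable (by
      rw [uIcc_of_le hac.le]
      exact hd.mul (by fun_prop))
  have e : ∀ (t : ℝ) (k : ℕ), (t : ℂ) ^ k = ((t ^ k : ℝ) : ℂ) := fun t k => by push_cast; rfl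
  have hr := eq_zero_of_moments_real hac (Complex.continuous_re.comp_continuousOn hd) fun k => by
    have := Complex.reCLM.intervalIntegral_comp_comm (hI k)
    rw [h] at this
    simpa only [Complex.reCLM_apply, e, Complex.re_mul_ofReal, Function.comp_apply,
      Complex.zero_re] using this
  have hi := eq_zero_of_moments_real hac (Complex.continuous_im.comp_continuousOn hd) fun k => by
    have := Complex.imCLM.intervalIntegral_comp_comm (hI k)
    rw [h] at this
    simpa only [Complex.imCLM_apply, e, Complex.im_mul_ofReal, Function.comp_apply,
      Complex.zero_im] using this
  exact fun t ht => Complex.ext (hr t ht) (hi t ht)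

/-- Uniqueness: for `x > 0` two kernels have the same moments `∫_{-x}^{x} K(x,t) t^k dt`; the point
`x = 0` follows by continuity. -/
lemma IsTransmutationKernel.unique (hb : 0 < b) {f₁ : ℝ → ℂ} {K' : ℝ → ℝ → ℂ} (hf0 : f 0 = 1)
    (hfne : ∀ x ∈ Icc 0 b, f x ≠ 0)
    (hf : ∀ x ∈ Icc 0 b, HasDerivWithinAt f (f₁ x) (Icc 0 b) x)
    (hf1 : ∀ x ∈ Icc 0 b, HasDerivWithinAt f₁ (q x * f x) (Icc 0 b) x)
    (hK : IsTransmutationKernel b q f K) (hK' : IsTransmutationKernel b q f K') :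
    ∀ x ∈ Icc 0 b, ∀ t ∈ Icc (-x) x, K' x t = K x t := by
  have hpos : ∀ x ∈ Ioc 0 b, ∀ t ∈ Icc (-x) x, K' x t = K x t := by
    intro x hx t ht
    have hx' : x ∈ Icc 0 b := Ioc_subset_Icc_self hx
    have hlt : -x < x := by linarith [hx.1]
    have hI : ∀ {G : ℝ → ℝ → ℂ}, ContinuousOn (G x) (Icc (-x) x) → ∀ k : ℕ, IntervalIntegrable
        (fun t : ℝ => G x t * (t : ℂ) ^ k) MeasureTheory.volume (-x) x := fun hG k =>
      ContinuousOn.intervalIntegrable (by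
        rw [uIcc_of_le hlt.le]
        exact hG.mul (by fun_prop))
    refine sub_eq_zero.1 (eq_zero_of_moments hlt (d := fun t => K' x t - K x t)
      ((hK'.continuousOn hx').sub (hK.continuousOn hx')) (fun k => ?_) t ht)
    have h1 := hK.transmute_pow hb hf0 hfne hf hf1 k x hx'
    have h2 := hK'.transmute_pow hb hf0 hfne hf hf1 k x hx'
    simp only [sub_mul]
    rw [intervalIntegral.integral_sub (hI (hK'.continuousOn hx') k) (hI (hK.continuousOn hx') k)]
    simp only [transmute] at h1 h2
    linear_combination h2 - h1
  intro x hx t ht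
  rcases hx.1.eq_or_lt with rfl | h0
  · obtain rfl : t = 0 := le_antisymm ht.2 (by simpa using ht.1)
    have hlim : ∀ {G : ℝ → ℝ → ℂ}, IsTransmutationKernel b q f G →
        Tendsto (fun x => G x 0) (𝓝[>] 0) (𝓝 (G 0 0)) := by
      intro G hG
      have hc : ContinuousWithinAt (fun x => G x 0) (Icc 0 b) 0 := by
        have := hG.contDiffOn.continuousOn.comp (f := fun x : ℝ => (x, (0 : ℝ))) (s := Icc 0 b)
          (by fun_prop) fun x hx => ⟨hx.1, hx.2, by simpa using hx.1⟩
        exact this 0 hx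
      refine hc.tendsto.mono_left ?_
      rw [← nhdsWithin_Ioc_eq_nhdsGT hb]
      exact nhdsWithin_mono _ Ioc_subset_Icc_self
    refine tendsto_nhds_unique (hlim hK') ((hlim hK).congr' ?_)
    filter_upwards [Ioc_mem_nhdsGT hb] with x hx
    exact (hpos x hx 0 ⟨by linarith [hx.1], hx.1.le⟩).symm
  · exact hpos x ⟨h0, hx.2⟩ t ht

/-- Existence of the transmutation kernel, from the solution of the Goursat problem for an extension
of `q` to the line, together with its continuous derivative in `t`. -/
lemma exists_isTransmutationKernel (hb : 0 < b) {f₁ : ℝ → ℂ} (hq : ContinuousOn q (Icc 0 b))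
    (hf0 : f 0 = 1) (hfne : ∀ x ∈ Icc 0 b, f x ≠ 0)
    (hf : ∀ x ∈ Icc 0 b, HasDerivWithinAt f (f₁ x) (Icc 0 b) x)
    (hf1 : ∀ x ∈ Icc 0 b, HasDerivWithinAt f₁ (q x * f x) (Icc 0 b) x) :
    ∃ K Kt : ℝ → ℝ → ℂ, IsTransmutationKernel b q f K ∧ (∀ x, Continuous (Kt x)) ∧
      ∀ x t, HasDerivAt (K x) (Kt x t) t := by
  set Q := IccExtend hb.le ((Icc 0 b).domRestrict q)
  have hQc : Continuous Q := (continuousOn_iff_continuous_domRestrict.1 hq).Icc_extend'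
  have hQq : ∀ y ∈ Icc 0 b, Q y = q y := fun y hy => IccExtend_of_mem hb.le _ hy
  obtain ⟨M, hM⟩ : ∃ M, ∀ x, ‖Q x‖ ≤ M := by
    obtain ⟨M, hM⟩ := isCompact_Icc.exists_bound_of_continuousOn hq
    exact ⟨M, fun x => hM _ (projIcc 0 b hb.le x).2⟩
  obtain ⟨H, H₁, H₂, hHc, hH1c, hH2c, d1, d2, d12, h0, h10⟩ := exists_goursat hQc hM (f₁ 0)
  set K : ℝ → ℝ → ℂ := fun x t => H ((x + t) / 2) ((x - t) / 2) with hKdef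
  have hHd := contDiff_one_of_partial hH1c hH2c d1 d2
  have hKd : ContDiff ℝ 1 (fun p : ℝ × ℝ => K p.1 p.2) :=
    hHd.comp (f := fun p : ℝ × ℝ => ((p.1 + p.2) / 2, (p.1 - p.2) / 2)) (by fun_prop)
  -- the transform of a `C²` function on the line
  have key : ∀ u u₁ u₂ : ℝ → ℂ, Continuous u₂ → (∀ x, HasDerivAt u (u₁ x) x) →
      (∀ x, HasDerivAt u₁ (u₂ x) x) → ∃ y₁, y₁ 0 = u₁ 0 + f₁ 0 * u 0 ∧
        HasSecondDerivOn (Icc 0 b) (transmute K u) y₁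
          (fun x => q x * transmute K u x + transmute K u₂ x) := by
    intro u u₁ u₂ hu2 hu hu1
    obtain ⟨w₁, hw0, hw, hw1⟩ := goursat_transmutation hHc hH1c hQc d1 d12 h0 h10 hu2 hu hu1
    have hd : ∀ x, HasDerivAt (transmute K u) (u₁ x + w₁ x) x := fun x => (hu x).add (hw x)
    refine ⟨fun x => u₁ x + w₁ x, by simp [hw0], fun x _ => (hd x).hasDerivWithinAt,
      fun x hx => ?_, ?_⟩
    · refine ((hu1 x).add (hw1 x)).hasDerivWithinAt.congr_deriv ?_
      rw [hQq x hx]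
      simp only [transmute, hKdef]
      ring
    · have hc2 : Continuous (transmute K u₂) := by
        refine hu2.add ?_
        have hK2 : Continuous (Function.uncurry fun x t => K x t * u₂ t) := by
          have := hKd.continuous
          exact this.mul (hu2.comp continuous_snd)
        have hint : ∀ x a c : ℝ, IntervalIntegrable (fun t => K x t * u₂ t)
            MeasureTheory.volume a c := fun x a c =>
          (by fun_prop : Continuous fun t => K x t * u₂ t).intervalIntegrable _ _
        have e : (fun x => ∫ t in (-x)..x, K x t * u₂ t) = fun x =>
            (∫ t in (0 : ℝ)..x, K x t * u₂ t) - ∫ t in (0 : ℝ)..(-x), K x t * u₂ t :=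
          funext fun x => by
            rw [intervalIntegral.integral_interval_sub_left (hint _ _ _) (hint _ _ _)]
        rw [e]
        exact (intervalIntegral.continuous_parametric_intervalIntegral_of_continuous hK2
          continuous_id).sub (intervalIntegral.continuous_parametric_intervalIntegral_of_continuous
            hK2 continuous_neg)
      have hc1 : Continuous (transmute K u) :=
        continuous_iff_continuousAt.2 fun x => (hd x).continuousAt
      exact (hq.mul hc1.continuousOn).add hc2.continuousOn
  refine ⟨K, fun x t => 1 / 2 * (H₁ ((x + t) / 2) ((x - t) / 2) - H₂ ((x + t) / 2) ((x - t) / 2)),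
    ⟨hKd.contDiffOn, fun u hu => ?_, ?_⟩, fun x => by fun_prop, fun x t => ?_⟩
  · obtain ⟨v, v₁, v₂, hv2, hv, hv1, e, e2⟩ :=
      (HasSecondDerivOn.of_contDiffOn (by linarith : -b < b) hu).exists_extension hb
    obtain ⟨y₁, -, hy⟩ := key v v₁ v₂ hv2 hv hv1
    have hsub : ∀ x ∈ Icc 0 b, Icc (-x) x ⊆ Icc (-b) b := fun x hx =>
      Icc_subset_Icc (by linarith [hx.2]) hx.2
    have e' : EqOn (transmute K u) (transmute K v) (Icc 0 b) := fun x hx =>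
      transmute_congr hx.1 fun t ht => (e (hsub x hx ht)).symm
    have hy' := hy.congr e' fun _ _ => rfl
    refine ⟨hy'.contDiffOn hb, fun x hx => ?_⟩
    rw [hy'.iteratedDerivWithin_eq hb hx, e' hx]
    have : transmute K (fun t => -(iteratedDerivWithin 2 u (Icc (-b) b) t)) x =
        - transmute K v₂ x := by
      rw [transmute_neg]
      exact congrArg _ (transmute_congr hx.1 fun t ht => (e2 (hsub x hx ht)).symm)
    rw [this]
    ring
  · intro x hx
    obtain ⟨y₁, hy0, hy⟩ := key (fun _ => 1) (fun _ => 0) (fun _ => 0) continuous_const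
      (fun x => hasDerivAt_const x _) (fun x => hasDerivAt_const x _)
    have hz : ∀ x, transmute K (fun _ => 0) x = 0 := fun x => by simp [transmute]
    have := eq_zero_of_ode hb hfne hf hf1
      (y := fun x => transmute K (fun _ => 1) x - f x) (y₁ := fun x => y₁ x - f₁ x)
      (fun x hx => (hy.hasDeriv x hx).sub (hf x hx))
      (fun x hx => ((hy.hasDeriv₁ x hx).sub (hf1 x hx)).congr_deriv (by rw [hz]; ring))
      (by simp [transmute_zero, hf0]) (by simp [hy0]) x hx
    exact sub_eq_zero.1 this
  · have hFD := hasFDerivAt_of_partial hH1c hH2c d1 d2 ((x + t) / 2, (x - t) / 2)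
    have hl : HasDerivAt (fun t : ℝ => ((x + t) / 2, (x - t) / 2)) ((1 / 2 : ℝ), (-1 / 2 : ℝ)) t :=
      (((hasDerivAt_id t).const_add x).div_const 2).prodMk
        (((hasDerivAt_id t).const_sub x).div_const 2)
    have := hFD.comp_hasDerivAt_of_eq t hl rfl
    refine this.congr_deriv ?_
    simp
    ring

end Kernel

/-! ### Bessel functions -/

lemma factorial_le_doubleFactorial (k m : ℕ) :
    k.factorial ≤ (2 * k + 2 * m + 1).doubleFactorial := by
  induction k with
  | zero => exact Nat.doubleFactorial_pos _
  | succ k ih =>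
    rw [show 2 * (k + 1) + 2 * m + 1 = (2 * k + 2 * m + 1) + 2 by ring, Nat.doubleFactorial_add_two,
      Nat.factorial_succ]
    exact Nat.mul_le_mul (by omega) ih

lemma norm_sphericalJ_term_le (k : ℕ) (z : ℂ) (m : ℕ) :
    ‖(-(z ^ 2) / 2) ^ m / ((m.factorial : ℂ) * ((2 * k + 2 * m + 1).doubleFactorial : ℂ))‖ ≤
      (k.factorial : ℝ)⁻¹ * ((‖z‖ ^ 2 / 2) ^ m / m.factorial) := by
  have h : (k.factorial : ℝ) ≤ ((2 * k + 2 * m + 1).doubleFactorial : ℝ) := by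
    exact_mod_cast factorial_le_doubleFactorial k m
  have hk : (0 : ℝ) < k.factorial := by positivity
  have hm : (0 : ℝ) < m.factorial := by positivity
  rw [norm_div, norm_pow, norm_div, norm_neg, norm_pow, norm_mul, Complex.norm_natCast,
    Complex.norm_natCast, Complex.norm_ofNat, ← div_eq_inv_mul, div_div]
  gcongr

lemma summable_sphericalJ (k : ℕ) (z : ℂ) : Summable fun m : ℕ =>
    (-(z ^ 2) / 2) ^ m / ((m.factorial : ℂ) * ((2 * k + 2 * m + 1).doubleFactorial : ℂ)) :=
  Summable.of_norm_bounded ((Real.summable_pow_div_factorial _).mul_left _)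
    (norm_sphericalJ_term_le k z)

lemma norm_sphericalJ_le (k : ℕ) (z : ℂ) :
    ‖sphericalJ k z‖ ≤ ‖z‖ ^ k / k.factorial * Real.exp (‖z‖ ^ 2 / 2) := by
  have h : HasSum (fun m : ℕ => (k.factorial : ℝ)⁻¹ * ((‖z‖ ^ 2 / 2) ^ m / m.factorial))
      ((k.factorial : ℝ)⁻¹ * Real.exp (‖z‖ ^ 2 / 2)) := by
    refine HasSum.mul_left _ ?_
    rw [Real.exp_eq_exp_ℝ]
    exact NormedSpace.expSeries_div_hasSum_exp _
  have := tsum_of_norm_bounded h (norm_sphericalJ_term_le k z)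
  rw [sphericalJ, norm_mul, norm_pow]
  refine (mul_le_mul_of_nonneg_left this (by positivity)).trans (le_of_eq ?_)
  ring

lemma sphericalJ_neg (k : ℕ) (z : ℂ) : sphericalJ k (-z) = (-1) ^ k * sphericalJ k z := by
  rw [sphericalJ, neg_pow, neg_sq, mul_assoc, sphericalJ]

/-- `∫_{-1}^{1} P_k(y) e^{izy} dy = 2 i^k j_k(z)`, from the power series of the exponential and the
moments of `P_k`. -/
lemma integral_legendreP_mul_exp (k : ℕ) (z : ℂ) :
    ∫ y in (-1 : ℝ)..1, (((legendreP k).eval y : ℝ) : ℂ) * Complex.exp (z * y * Complex.I) =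
      2 * Complex.I ^ k * sphericalJ k z := by
  have hc : Continuous fun y : ℝ => (((legendreP k).eval y : ℝ) : ℂ) :=
    Complex.continuous_ofReal.comp (legendreP k).continuous
  have h1 : HasSum (fun n : ℕ => ∫ y in (-1 : ℝ)..1, (((legendreP k).eval y : ℝ) : ℂ) *
      ((z * y * Complex.I) ^ n / n.factorial))
      (∫ y in (-1 : ℝ)..1, (((legendreP k).eval y : ℝ) : ℂ) * Complex.exp (z * y * Complex.I)) := by
    refine intervalIntegral.hasSum_integral_of_dominated_convergence
      (fun n _ => ‖z‖ ^ n / n.factorial) (fun n => ?_) (fun n => ?_) ?_ (by simp) ?_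
    · exact (hc.mul (by fun_prop)).aestronglyMeasurable
    · refine Eventually.of_forall fun y hy => ?_
      rw [uIoc_of_le (by norm_num)] at hy
      have hy' : y ∈ Icc (-1 : ℝ) 1 := Ioc_subset_Icc_self hy
      have hP := abs_legendreP_eval_le_one k hy'
      rw [norm_mul, Complex.norm_real, Real.norm_eq_abs, norm_div, norm_pow, norm_mul, norm_mul,
        Complex.norm_real, Complex.norm_I, mul_one, Complex.norm_natCast, Real.norm_eq_abs]
      have h2 : ‖z‖ * |y| ≤ ‖z‖ := mul_le_of_le_one_right (norm_nonneg _) (abs_le.2 hy')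
      calc |(legendreP k).eval y| * ((‖z‖ * |y|) ^ n / n.factorial)
          ≤ 1 * (‖z‖ ^ n / n.factorial) := by gcongr
        _ = _ := one_mul _
    · exact Eventually.of_forall fun _ _ => Real.summable_pow_div_factorial _
    · refine Eventually.of_forall fun y _ => HasSum.mul_left _ ?_
      rw [Complex.exp_eq_exp_ℂ]
      exact NormedSpace.expSeries_div_hasSum_exp _
  have h2 : ∀ n : ℕ, (∫ y in (-1 : ℝ)..1, (((legendreP k).eval y : ℝ) : ℂ) *
      ((z * y * Complex.I) ^ n / n.factorial)) =
      (z * Complex.I) ^ n / n.factorial * (legendreMoment k n : ℂ) := by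
    intro n
    rw [legendreMoment, ← intervalIntegral.integral_ofReal, ← intervalIntegral.integral_const_mul]
    refine intervalIntegral.integral_congr fun y _ => ?_
    push_cast
    rw [mul_right_comm z, mul_pow _ (y : ℂ)]
    ring
  simp only [h2] at h1
  have hinj : Function.Injective fun m : ℕ => k + 2 * m := fun a b h => by
    simp only at h; omega
  have h3 : ∀ n ∉ Set.range (fun m : ℕ => k + 2 * m),
      (z * Complex.I) ^ n / n.factorial * (legendreMoment k n : ℂ) = 0 := by
    intro n hn
    have : legendreMoment k n = 0 := by
      by_cases hp : n % 2 = k % 2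
      · refine legendreMoment_eq_zero_of_lt (lt_of_not_ge fun hkn => hn ⟨(n - k) / 2, ?_⟩)
        simp only
        omega
      · exact legendreMoment_eq_zero_of_parity hp
    rw [this]; simp
  rw [← hinj.hasSum_iff h3] at h1
  have h4 : HasSum ((fun n : ℕ => (z * Complex.I) ^ n / n.factorial * (legendreMoment k n : ℂ)) ∘
      fun m : ℕ => k + 2 * m) (2 * Complex.I ^ k * sphericalJ k z) := by
    have := ((summable_sphericalJ k z).hasSum.mul_left (z ^ k)).mul_left (2 * Complex.I ^ k)
    refine this.congr_fun fun m => ?_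
    simp only [Function.comp_apply]
    rw [(legendreMoment_formula k).1 m]
    have hf : ((k + 2 * m).factorial : ℂ) ≠ 0 := by
      exact_mod_cast (Nat.factorial_pos _).ne'
    have hm : (m.factorial : ℂ) ≠ 0 := by exact_mod_cast (Nat.factorial_pos _).ne'
    have hd : ((2 * k + 2 * m + 1).doubleFactorial : ℂ) ≠ 0 := by
      exact_mod_cast (Nat.doubleFactorial_pos _).ne'
    have hI : Complex.I ^ (k + 2 * m) = Complex.I ^ k * (-1) ^ m := by
      rw [pow_add, pow_mul, Complex.I_sq]
    push_cast
    rw [mul_pow, hI, div_pow, neg_pow (z ^ 2), pow_add, pow_mul]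
    field_simp
  exact h1.unique h4

lemma I_pow_two_mul_add (n : ℕ) :
    Complex.I ^ (2 * n) = (-1) ^ n ∧ Complex.I ^ (2 * n + 1) = (-1) ^ n * Complex.I := by
  rw [pow_succ, pow_mul, Complex.I_sq]
  exact ⟨rfl, rfl⟩

lemma intervalIntegrable_legendreP_mul (k : ℕ) {E : ℝ → ℂ} (hE : Continuous E) (a b : ℝ) :
    IntervalIntegrable (fun y : ℝ => (((legendreP k).eval y : ℝ) : ℂ) * E y)
      MeasureTheory.volume a b :=
  ((Complex.continuous_ofReal.comp (legendreP k).continuous).mul hE).intervalIntegrable _ _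

lemma integral_legendreP_mul_cos (k : ℕ) (z : ℂ) :
    ∫ y in (-1 : ℝ)..1, (((legendreP k).eval y : ℝ) : ℂ) * Complex.cos (z * y) =
      Complex.I ^ k * (1 + (-1) ^ k) * sphericalJ k z := by
  have e : ∀ y : ℝ, (((legendreP k).eval y : ℝ) : ℂ) * Complex.cos (z * y) =
      (1 / 2) * ((((legendreP k).eval y : ℝ) : ℂ) * Complex.exp (z * y * Complex.I)) +
      (1 / 2) * ((((legendreP k).eval y : ℝ) : ℂ) * Complex.exp (-z * y * Complex.I)) := by
    intro y
    rw [Complex.cos, neg_mul z]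
    ring
  simp only [e]
  rw [intervalIntegral.integral_add, intervalIntegral.integral_const_mul,
    intervalIntegral.integral_const_mul, integral_legendreP_mul_exp, integral_legendreP_mul_exp,
    sphericalJ_neg]
  · ring
  all_goals exact (intervalIntegrable_legendreP_mul k (by fun_prop) _ _).const_mul _

lemma integral_legendreP_mul_sin (k : ℕ) (z : ℂ) :
    ∫ y in (-1 : ℝ)..1, (((legendreP k).eval y : ℝ) : ℂ) * Complex.sin (z * y) =
      Complex.I ^ (k + 1) * ((-1) ^ k - 1) * sphericalJ k z := by
  have e : ∀ y : ℝ, (((legendreP k).eval y : ℝ) : ℂ) * Complex.sin (z * y) =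
      (Complex.I / 2) * ((((legendreP k).eval y : ℝ) : ℂ) * Complex.exp (-z * y * Complex.I)) -
      (Complex.I / 2) * ((((legendreP k).eval y : ℝ) : ℂ) * Complex.exp (z * y * Complex.I)) := by
    intro y
    rw [Complex.sin, neg_mul z]
    ring
  simp only [e]
  rw [intervalIntegral.integral_sub, intervalIntegral.integral_const_mul,
    intervalIntegral.integral_const_mul, integral_legendreP_mul_exp, integral_legendreP_mul_exp,
    sphericalJ_neg]
  · ring
  all_goals exact (intervalIntegrable_legendreP_mul k (by fun_prop) _ _).const_mul _

lemma Gamma_nat_add_three_halves (j : ℕ) :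
    Complex.Gamma ((j : ℂ) + 1 / 2 + 1) =
      ((2 * j + 1).doubleFactorial : ℂ) * (Real.sqrt Real.pi : ℂ) / 2 ^ (j + 1) := by
  have h := Real.Gamma_nat_add_one_add_half j
  have e : ((j : ℂ) + 1 / 2 + 1) = (((j : ℝ) + 1 + 1 / 2 : ℝ) : ℂ) := by push_cast; ring
  rw [e, Complex.Gamma_ofReal, h]
  push_cast
  rfl

/-- `√(2π/z) J_{k+1/2}(z) = 2 j_k(z)`, solved for the Bessel function. -/
lemma besselJ_nat_add_half (k : ℕ) {z : ℂ} (hz : z ≠ 0) :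
    besselJ ((k : ℂ) + 1 / 2) z =
      2 * z ^ (1 / 2 : ℂ) / (Real.sqrt (2 * Real.pi) : ℂ) * sphericalJ k z := by
  have hz2 : z / 2 ≠ 0 := div_ne_zero hz two_ne_zero
  have h2 : (z / 2) ^ (1 / 2 : ℂ) = z ^ (1 / 2 : ℂ) / (Real.sqrt 2 : ℂ) := by
    have hlog : Complex.log (z / 2) = Complex.log z - Real.log 2 := by
      have := Complex.log_mul_ofReal (2⁻¹ : ℝ) (by norm_num) z hz
      rw [Real.log_inv] at this
      push_cast at this
      rw [div_eq_mul_inv, this, Complex.ofReal_log (by norm_num)]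
      push_cast
      ring
    have hs : (Real.sqrt 2 : ℂ) = Complex.exp (Real.log 2 * (1 / 2)) := by
      rw [Real.sqrt_eq_rpow, Real.rpow_def_of_pos two_pos]
      push_cast
      rfl
    rw [Complex.cpow_def_of_ne_zero hz2, Complex.cpow_def_of_ne_zero hz, hlog, sub_mul,
      Complex.exp_sub, ← hs]
  have hsqrt : (Real.sqrt (2 * Real.pi) : ℂ) = (Real.sqrt 2 : ℂ) * (Real.sqrt Real.pi : ℂ) := by
    rw [Real.sqrt_mul zero_le_two]; push_cast; rfl
  have hs2 : (Real.sqrt 2 : ℂ) ≠ 0 := by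
    exact_mod_cast (Real.sqrt_pos.2 two_pos).ne'
  have hsp : (Real.sqrt Real.pi : ℂ) ≠ 0 := by
    exact_mod_cast (Real.sqrt_pos.2 Real.pi_pos).ne'
  have hterm : ∀ m : ℕ, (-1 : ℂ) ^ m /
      ((m.factorial : ℂ) * Complex.Gamma ((k : ℂ) + 1 / 2 + m + 1)) * (z / 2) ^ (2 * m) =
      (2 ^ (k + 1) / (Real.sqrt Real.pi : ℂ)) * ((-(z ^ 2) / 2) ^ m /
        ((m.factorial : ℂ) * ((2 * k + 2 * m + 1).doubleFactorial : ℂ))) := by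
    intro m
    have e : (k : ℂ) + 1 / 2 + m + 1 = ((k + m : ℕ) : ℂ) + 1 / 2 + 1 := by push_cast; ring
    have hm : (m.factorial : ℂ) ≠ 0 := by exact_mod_cast (Nat.factorial_pos _).ne'
    have hd : ((2 * k + 2 * m + 1).doubleFactorial : ℂ) ≠ 0 := by
      exact_mod_cast (Nat.doubleFactorial_pos _).ne'
    rw [e, Gamma_nat_add_three_halves, show 2 * (k + m) + 1 = 2 * k + 2 * m + 1 by ring, div_pow z,
      div_pow, neg_pow (z ^ 2), ← pow_mul, show k + m + 1 = k + 1 + m by ring, pow_add _ (k + 1) m,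
      show (2 : ℂ) ^ (2 * m) = 2 ^ m * 2 ^ m by rw [two_mul, pow_add]]
    field_simp
  rw [besselJ, sphericalJ, Complex.cpow_add _ _ hz2, Complex.cpow_natCast, h2, hsqrt]
  simp only [hterm]
  rw [tsum_mul_left, div_pow, pow_succ]
  field_simp

/-! ### The coefficients `β_k` as Legendre coefficients of the kernel -/

lemma pow_eq_sum_legendreP (k : ℕ) (y : ℝ) :
    y ^ k = ∑ j ∈ Finset.range (k + 1),
      (2 * (j : ℝ) + 1) / 2 * legendreMoment j k * (legendreP j).eval y := by
  have h := congrArg (Polynomial.eval y) (legendreProj_polynomial (p := Polynomial.X ^ k)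
    (N := k + 1) (by simp))
  rw [legendreProj_eval] at h
  simp only [Polynomial.eval_pow, Polynomial.eval_X] at h
  rw [← h]
  refine Finset.sum_congr rfl fun j _ => ?_
  simp only [legendreCoeff, legendreMoment, mul_comm]

section Beta

variable {b : ℝ} {q f : ℝ → ℂ} {K : ℝ → ℝ → ℂ}

lemma integral_symm_eq (x : ℝ) (F : ℝ → ℂ) :
    ∫ t in (-x)..x, F t = x * ∫ y in (-1 : ℝ)..1, F (x * y) := by
  have := intervalIntegral.smul_integral_comp_mul_left (a := -1) (b := 1) F x
  rw [mul_neg_one, mul_one] at this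
  rw [← this, Complex.real_smul]

/-- The recursion for `β_k` inverts the expansion of `y^k` in Legendre polynomials, since
`φ_k(x) / x^k - 1` is the moment `x ∫_{-1}^{1} K(x,xy) y^k dy`. -/
lemma betaAux_eq (hKc : ∀ x, Continuous (K x)) {x : ℝ} (hx : 0 < x)
    (hpow : ∀ k : ℕ, transmute K (fun t : ℝ => (t : ℂ) ^ k) x = formalPower f k x) (k : ℕ) :
    betaAux f x k = (2 * (k : ℂ) + 1) / 2 * (x * ∫ y in (-1 : ℝ)..1,
      K x (x * y) * (((legendreP k).eval y : ℝ) : ℂ)) := by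
  have hx0 : (x : ℂ) ≠ 0 := by exact_mod_cast hx.ne'
  have hcont : ∀ {g : ℝ → ℝ}, Continuous g → IntervalIntegrable
      (fun y : ℝ => K x (x * y) * ((g y : ℝ) : ℂ)) MeasureTheory.volume (-1) 1 := fun {g} hg => by
    have := hKc x
    exact (by fun_prop : Continuous fun y : ℝ => K x (x * y) * ((g y : ℝ) : ℂ)).intervalIntegrable
      _ _
  induction k using Nat.strong_induction_on with
  | _ k ih =>
    have h1 : formalPower f k x / (x : ℂ) ^ k - 1 =
        x * ∫ y in (-1 : ℝ)..1, K x (x * y) * ((y ^ k : ℝ) : ℂ) := by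
      rw [← hpow k, transmute, integral_symm_eq]
      have e : ∀ y : ℝ, K x (x * y) * (((x * y : ℝ) : ℂ)) ^ k =
          (x : ℂ) ^ k * (K x (x * y) * ((y ^ k : ℝ) : ℂ)) := fun y => by
        push_cast; ring
      simp only [e]
      rw [intervalIntegral.integral_const_mul]
      field_simp
      ring
    have h2 : (∫ y in (-1 : ℝ)..1, K x (x * y) * ((y ^ k : ℝ) : ℂ)) =
        ∑ j ∈ Finset.range (k + 1), (legendreMoment j k : ℂ) * ((2 * (j : ℂ) + 1) / 2 *
          ∫ y in (-1 : ℝ)..1, K x (x * y) * (((legendreP j).eval y : ℝ) : ℂ)) := by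
      have e : ∀ y : ℝ, K x (x * y) * ((y ^ k : ℝ) : ℂ) =
          ∑ j ∈ Finset.range (k + 1), ((legendreMoment j k : ℂ) * ((2 * (j : ℂ) + 1) / 2)) *
            (K x (x * y) * (((legendreP j).eval y : ℝ) : ℂ)) := fun y => by
        rw [pow_eq_sum_legendreP, Complex.ofReal_sum, Finset.mul_sum]
        refine Finset.sum_congr rfl fun j _ => ?_
        push_cast
        ring
      simp only [e]
      rw [intervalIntegral.integral_finsetSum]
      · simp only [intervalIntegral.integral_const_mul, mul_assoc]
      · exact fun j _ => (hcont (legendreP j).continuous).const_mul _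
    have h3 : (∑ j : Fin k, if (j : ℕ) % 2 = k % 2 then
        (legendreMoment j k : ℂ) * betaAux f x j else 0) =
        ∑ j ∈ Finset.range k, (legendreMoment j k : ℂ) * ((2 * (j : ℂ) + 1) / 2 *
          (x * ∫ y in (-1 : ℝ)..1, K x (x * y) * (((legendreP j).eval y : ℝ) : ℂ))) := by
      rw [← Fin.sum_univ_eq_sum_range (fun j => (legendreMoment j k : ℂ) *
        ((2 * (j : ℂ) + 1) / 2 * (x * ∫ y in (-1 : ℝ)..1,
          K x (x * y) * (((legendreP j).eval y : ℝ) : ℂ)))) k]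
      refine Finset.sum_congr rfl fun j _ => ?_
      split_ifs with hp
      · rw [ih j j.2]
      · rw [legendreMoment_eq_zero_of_parity (Ne.symm hp)]; simp
    have hne : (legendreMoment k k : ℂ) ≠ 0 := by exact_mod_cast legendreMoment_self_ne_zero k
    rw [betaAux, h1, h2, h3, Finset.sum_range_succ, mul_add, Finset.mul_sum]
    have h4 : ∀ j ∈ Finset.range k, (x : ℂ) * ((legendreMoment j k : ℂ) * ((2 * (j : ℂ) + 1) / 2 *
          ∫ y in (-1 : ℝ)..1, K x (x * y) * (((legendreP j).eval y : ℝ) : ℂ))) =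
        (legendreMoment j k : ℂ) * ((2 * (j : ℂ) + 1) / 2 *
          (x * ∫ y in (-1 : ℝ)..1, K x (x * y) * (((legendreP j).eval y : ℝ) : ℂ))) :=
      fun j _ => by ring
    rw [Finset.sum_congr rfl h4, add_sub_cancel_left]
    field_simp

lemma norm_legendre_integral_le {x C : ℝ} (hx : 0 ≤ x)
    (hC : ∀ t ∈ Icc (-x) x, ‖K x t‖ ≤ C) (k : ℕ) :
    ‖∫ y in (-1 : ℝ)..1, K x (x * y) * (((legendreP k).eval y : ℝ) : ℂ)‖ ≤ 2 * C := by
  have h := intervalIntegral.norm_integral_le_of_norm_le_const (a := (-1 : ℝ)) (b := 1) (C := C)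
    (f := fun y : ℝ => K x (x * y) * (((legendreP k).eval y : ℝ) : ℂ)) ?_
  · norm_num at h
    linarith
  · intro y hy
    rw [uIoc_of_le (by norm_num)] at hy
    have hy' : y ∈ Icc (-1 : ℝ) 1 := Ioc_subset_Icc_self hy
    have hm : x * y ∈ Icc (-x) x := ⟨by nlinarith [hy'.1], by nlinarith [hy'.2]⟩
    have h1 := hC _ hm
    rw [norm_mul, Complex.norm_real, Real.norm_eq_abs]
    have := mul_le_mul h1 (abs_legendreP_eval_le_one k hy') (abs_nonneg _)
      ((norm_nonneg _).trans h1)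
    linarith

/-- `β_k(x)` is `x` times the normalized `k`-th Legendre coefficient of `y ↦ K(x, xy)`,
also at `x = 0`, where both sides vanish. -/
lemma beta_eq (hb : 0 < b) (hKc : ∀ x, Continuous (K x)) {C : ℝ}
    (hC : ∀ x ∈ Icc 0 b, ∀ t ∈ Icc (-x) x, ‖K x t‖ ≤ C)
    (hpow : ∀ k : ℕ, ∀ x ∈ Icc 0 b, transmute K (fun t : ℝ => (t : ℂ) ^ k) x = formalPower f k x)
    (k : ℕ) {x : ℝ} (hx : x ∈ Icc 0 b) :
    beta f k x = (2 * (k : ℂ) + 1) / 2 * (x * ∫ y in (-1 : ℝ)..1,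
      K x (x * y) * (((legendreP k).eval y : ℝ) : ℂ)) := by
  rcases hx.1.eq_or_lt with rfl | h0
  · rw [beta, if_pos rfl]
    simp only [Complex.ofReal_zero, zero_mul, mul_zero]
    refine Tendsto.limUnder_eq ?_
    refine squeeze_zero_norm' (a := fun y : ℝ => (2 * (k : ℝ) + 1) / 2 * (y * (2 * C))) ?_ ?_
    · filter_upwards [Ioc_mem_nhdsGT hb] with y hy
      have hy' : y ∈ Icc 0 b := Ioc_subset_Icc_self hy
      rw [betaAux_eq hKc hy.1 (fun k => hpow k y hy'), norm_mul, norm_mul, Complex.norm_real,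
        Real.norm_of_nonneg hy'.1]
      have h1 : ‖(2 * (k : ℂ) + 1) / 2‖ = (2 * (k : ℝ) + 1) / 2 := by
        have : (2 * (k : ℂ) + 1) / 2 = (((2 * (k : ℝ) + 1) / 2 : ℝ) : ℂ) := by push_cast; rfl
        rw [this, Complex.norm_real, Real.norm_of_nonneg (by positivity)]
      rw [h1]
      have := norm_legendre_integral_le (K := K) hy'.1 (hC y hy') k
      have hy0 := hy'.1
      gcongr
    · have : Tendsto (fun y : ℝ => (2 * (k : ℝ) + 1) / 2 * (y * (2 * C))) (𝓝 0)
          (𝓝 ((2 * (k : ℝ) + 1) / 2 * (0 * (2 * C)))) := by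
        refine Continuous.tendsto ?_ 0
        fun_prop
      rw [zero_mul, mul_zero] at this
      exact this.mono_left nhdsWithin_le_nhds
  · rw [beta, if_neg h0.ne', betaAux_eq hKc h0 (fun k => hpow k x hx)]

lemma norm_beta_le (hb : 0 < b) (hKc : ∀ x, Continuous (K x)) {C : ℝ}
    (hC : ∀ x ∈ Icc 0 b, ∀ t ∈ Icc (-x) x, ‖K x t‖ ≤ C)
    (hpow : ∀ k : ℕ, ∀ x ∈ Icc 0 b, transmute K (fun t : ℝ => (t : ℂ) ^ k) x = formalPower f k x)
    (k : ℕ) {x : ℝ} (hx : x ∈ Icc 0 b) : ‖beta f k x‖ ≤ 2 ^ (k + 1) * (b * C) := by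
  rw [beta_eq hb hKc hC hpow k hx, norm_mul, norm_mul, Complex.norm_real,
    Real.norm_of_nonneg hx.1]
  have h1 : ‖(2 * (k : ℂ) + 1) / 2‖ = (2 * (k : ℝ) + 1) / 2 := by
    have : (2 * (k : ℂ) + 1) / 2 = (((2 * (k : ℝ) + 1) / 2 : ℝ) : ℂ) := by push_cast; rfl
    rw [this, Complex.norm_real, Real.norm_of_nonneg (by positivity)]
  have h2 : 2 * (k : ℝ) + 1 ≤ 2 ^ (k + 1) := by
    have : 2 * k + 1 ≤ 2 ^ (k + 1) := by
      have := Nat.lt_two_pow_self (n := k)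
      rw [pow_succ]; omega
    exact_mod_cast this
  rw [h1]
  have h3 := norm_legendre_integral_le (K := K) hx.1 (hC x hx) k
  calc (2 * (k : ℝ) + 1) / 2 * (x * ‖∫ y in (-1 : ℝ)..1,
        K x (x * y) * (((legendreP k).eval y : ℝ) : ℂ)‖)
      ≤ 2 ^ (k + 1) / 2 * (b * (2 * C)) := by
        have := hx.1
        have := hx.2
        gcongr
    _ = _ := by ring

/-! ### Partial sums -/

lemma sum_range_eq_even_add_odd (g : ℕ → ℂ) (M : ℕ) :
    ∑ j ∈ Finset.range M, g j = ∑ n ∈ Finset.range ((M + 1) / 2), g (2 * n) +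
      ∑ n ∈ Finset.range (M / 2), g (2 * n + 1) := by
  induction M with
  | zero => simp
  | succ M ih =>
    rw [Finset.sum_range_succ, ih]
    rcases Nat.even_or_odd' M with ⟨c, rfl | rfl⟩
    · rw [show (2 * c + 1) / 2 = c by omega, show 2 * c / 2 = c by omega,
        show (2 * c + 1 + 1) / 2 = c + 1 by omega, Finset.sum_range_succ]
      ring
    · rw [show (2 * c + 1 + 1) / 2 = c + 1 by omega, show (2 * c + 1) / 2 = c by omega,
        show (2 * c + 1 + 1 + 1) / 2 = c + 1 by omega,
        Finset.sum_range_succ (fun n => g (2 * n + 1))]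
      ring

lemma integral_kernelPartial_mul {E : ℝ → ℂ} (hE : Continuous E) (N : ℕ) (x : ℝ)
    (hx : 0 < x) :
    ∫ t in (-x)..x, kernelPartial f N x t * E t = ∑ j ∈ Finset.range (N + 1),
      beta f j x * ∫ y in (-1 : ℝ)..1, (((legendreP j).eval y : ℝ) : ℂ) * E (x * y) := by
  have hx0 : (x : ℂ) ≠ 0 := by exact_mod_cast hx.ne'
  rw [integral_symm_eq]
  have e : ∀ y : ℝ, kernelPartial f N x (x * y) * E (x * y) =
      ∑ j ∈ Finset.range (N + 1), beta f j x / x *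
        ((((legendreP j).eval y : ℝ) : ℂ) * E (x * y)) := fun y => by
    rw [kernelPartial, mul_div_cancel_left₀ _ hx.ne', Finset.sum_mul]
    exact Finset.sum_congr rfl fun j _ => by ring
  simp only [e]
  rw [intervalIntegral.integral_finsetSum, Finset.mul_sum]
  · refine Finset.sum_congr rfl fun j _ => ?_
    rw [intervalIntegral.integral_const_mul]
    field_simp
  · exact fun j _ => (intervalIntegrable_legendreP_mul j (by fun_prop) _ _).const_mul _

lemma approxC_eq (hβ : ∀ k, beta f k 0 = 0) (N : ℕ) (ω : ℂ) {x : ℝ} (hx : 0 ≤ x) :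
    approxC f N ω x = Complex.cos (ω * x) +
      ∫ t in (-x)..x, kernelPartial f N x t * Complex.cos (ω * t) := by
  rcases hx.eq_or_lt with rfl | h0
  · simp [approxC, termC, hβ]
  · rw [integral_kernelPartial_mul (by fun_prop) N x h0, approxC]
    have e : ∀ j, beta f j x * ∫ y in (-1 : ℝ)..1,
        (((legendreP j).eval y : ℝ) : ℂ) * Complex.cos (ω * ((x * y : ℝ) : ℂ)) =
        beta f j x * (Complex.I ^ j * (1 + (-1) ^ j) * sphericalJ j (ω * x)) := fun j => by
      rw [← integral_legendreP_mul_cos]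
      simp only [Complex.ofReal_mul, mul_assoc]
    simp only [e]
    rw [sum_range_eq_even_add_odd _ (N + 1), Finset.sum_eq_zero (s := Finset.range ((N + 1) / 2)),
      add_zero, Finset.mul_sum, show (N + 1 + 1) / 2 = N / 2 + 1 by omega]
    · refine congrArg _ (Finset.sum_congr rfl fun n _ => ?_)
      rw [(I_pow_two_mul_add n).1, termC, pow_mul (-1 : ℂ)]
      norm_num
      ring
    · intro n _
      rw [pow_succ (-1 : ℂ), pow_mul (-1 : ℂ)]
      norm_num

lemma approxS_eq (hβ : ∀ k, beta f k 0 = 0) (N : ℕ) (ω : ℂ) {x : ℝ} (hx : 0 ≤ x) :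
    approxS f N ω x = Complex.sin (ω * x) +
      ∫ t in (-x)..x, kernelPartial f N x t * Complex.sin (ω * t) := by
  rcases hx.eq_or_lt with rfl | h0
  · simp [approxS, termS, hβ]
  · rw [integral_kernelPartial_mul (by fun_prop) N x h0, approxS]
    have e : ∀ j, beta f j x * ∫ y in (-1 : ℝ)..1,
        (((legendreP j).eval y : ℝ) : ℂ) * Complex.sin (ω * ((x * y : ℝ) : ℂ)) =
        beta f j x * (Complex.I ^ (j + 1) * ((-1) ^ j - 1) * sphericalJ j (ω * x)) := fun j => by
      rw [← integral_legendreP_mul_sin]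
      simp only [Complex.ofReal_mul, mul_assoc]
    simp only [e]
    rw [sum_range_eq_even_add_odd _ (N + 1),
      Finset.sum_eq_zero (s := Finset.range ((N + 1 + 1) / 2)), zero_add, Finset.mul_sum]
    · refine congrArg _ (Finset.sum_congr rfl fun n _ => ?_)
      rw [show 2 * n + 1 + 1 = 2 * (n + 1) by ring, (I_pow_two_mul_add (n + 1)).1, termS,
        pow_succ (-1 : ℂ) (2 * n), pow_mul (-1 : ℂ), pow_succ (-1 : ℂ) n]
      norm_num
      ring
    · intro n _
      rw [pow_mul (-1 : ℂ)]
      norm_num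

lemma continuous_kernelPartial (N : ℕ) (x : ℝ) : Continuous (kernelPartial f N x) := by
  refine continuous_finsetSum _ fun j _ => continuous_const.mul ?_
  exact Complex.continuous_ofReal.comp ((legendreP j).continuous.comp (continuous_id.div_const x))

/-- The error of the `N`-th approximation is the transform of the error of the kernel. -/
lemma transmute_sub_eq (hKc : ∀ x, Continuous (K x)) {E : ℝ → ℂ} (hE : Continuous E) (N : ℕ)
    (x : ℝ) :
    transmute K E x - (E x + ∫ t in (-x)..x, kernelPartial f N x t * E t) =
      ∫ t in (-x)..x, (K x t - kernelPartial f N x t) * E t := by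
  have h1 := hKc x
  have h2 := continuous_kernelPartial (f := f) N x
  simp only [sub_mul]
  rw [intervalIntegral.integral_sub, transmute]
  · ring
  all_goals
    apply Continuous.intervalIntegrable
    fun_prop

lemma norm_cos_sin_le_cosh {z : ℂ} {c : ℝ} (hz : |z.im| ≤ c) :
    ‖Complex.cos z‖ ≤ Real.cosh c ∧ ‖Complex.sin z‖ ≤ Real.cosh c := by
  have h1 : ‖Complex.exp (z * Complex.I)‖ = Real.exp (-z.im) := by
    rw [Complex.norm_exp]; simp
  have h2 : ‖Complex.exp (-z * Complex.I)‖ = Real.exp z.im := by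
    rw [Complex.norm_exp]; simp
  have h3 : Real.cosh z.im ≤ Real.cosh c :=
    Real.cosh_le_cosh.2 (hz.trans (le_abs_self c))
  rw [Real.cosh_eq] at h3
  constructor
  · rw [Complex.cos, norm_div, Complex.norm_ofNat]
    refine le_trans ?_ h3
    have := norm_add_le (Complex.exp (z * Complex.I)) (Complex.exp (-z * Complex.I))
    rw [h1, h2] at this
    linarith
  · rw [Complex.sin, norm_div, norm_mul, Complex.norm_I, mul_one, Complex.norm_ofNat]
    refine le_trans ?_ h3
    have := norm_sub_le (Complex.exp (-z * Complex.I)) (Complex.exp (z * Complex.I))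
    rw [h1, h2] at this
    linarith

lemma norm_integral_mul_le_cosh {D E : ℝ → ℂ} {x ε C : ℝ} (hx : 0 ≤ x) (hC : 0 < C) (hε : 0 ≤ ε)
    (hD : ∀ t ∈ Icc (-x) x, ‖D t‖ ≤ ε) (hE : ∀ t, ‖E t‖ ≤ Real.cosh (C * t)) :
    ‖∫ t in (-x)..x, D t * E t‖ ≤ 2 * ε * Real.sinh (C * x) / C := by
  have hcosh : Continuous fun t : ℝ => ε * Real.cosh (C * t) := by
    have := Real.continuous_cosh
    fun_prop
  refine (intervalIntegral.norm_integral_le_of_norm_le (g := fun t => ε * Real.cosh (C * t))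
    (by linarith) (Eventually.of_forall fun t ht => ?_) (hcosh.intervalIntegrable _ _)).trans ?_
  · rw [norm_mul]
    exact mul_le_mul (hD t (Ioc_subset_Icc_self ht)) (hE t) (norm_nonneg _) hε
  · rw [intervalIntegral.integral_eq_sub_of_hasDerivAt
      (f := fun t => ε * (Real.sinh (C * t) / C)) (fun t _ => ?_) (hcosh.intervalIntegrable _ _)]
    · rw [mul_neg, Real.sinh_neg]
      apply le_of_eq
      ring
    · have h := ((Real.hasDerivAt_sinh (C * t)).comp t ((hasDerivAt_id t).const_mul C))
      refine ((h.div_const C).const_mul ε).congr_deriv ?_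
      field_simp

lemma norm_integral_mul_le_const {D E : ℝ → ℂ} {x ε : ℝ} (hx : 0 ≤ x) (hε : 0 ≤ ε)
    (hD : ∀ t ∈ Icc (-x) x, ‖D t‖ ≤ ε) (hE : ∀ t, ‖E t‖ ≤ 1) :
    ‖∫ t in (-x)..x, D t * E t‖ ≤ 2 * |x| * ε := by
  refine (intervalIntegral.norm_integral_le_of_norm_le_const (C := ε) fun t ht => ?_).trans ?_
  · rw [uIoc_of_le (by linarith)] at ht
    rw [norm_mul]
    simpa using mul_le_mul (hD t (Ioc_subset_Icc_self ht)) (hE t) (norm_nonneg _) hε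
  · rw [sub_neg_eq_add, ← two_mul, abs_mul, abs_two]
    apply le_of_eq
    ring

/-- The functions `K_N(x, ·)` are the partial sums of the Legendre series of `K(x, ·)`. -/
lemma kernelPartial_tendstoUniformlyOn {Kt : ℝ → ℝ → ℂ} (hKt : ∀ x, Continuous (Kt x))
    (hKd : ∀ x t, HasDerivAt (K x) (Kt x t) t) {x : ℝ} (hx : 0 < x)
    (hβ : ∀ k, beta f k x = (2 * (k : ℂ) + 1) / 2 * (x * ∫ y in (-1 : ℝ)..1,
      K x (x * y) * (((legendreP k).eval y : ℝ) : ℂ))) :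
    TendstoUniformlyOn (fun (N : ℕ) (t : ℝ) => kernelPartial f N x t) (K x) atTop
      (Icc (-x) x) := by
  have hx0 : (x : ℂ) ≠ 0 := by exact_mod_cast hx.ne'
  have hgd : ∀ y, HasDerivAt (fun y => K x (x * y)) (x * Kt x (x * y)) y := fun y => by
    have := (hKd x (x * y)).scomp y ((hasDerivAt_id y).const_mul x)
    refine this.congr_deriv ?_
    simp
  have hgc : Continuous fun y => (x : ℂ) * Kt x (x * y) := by
    have := hKt x
    fun_prop
  have h := (legendreSeries_tendstoUniformlyOn hgc hgd).comp (fun t => t / x)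
  have hsub : Icc (-x) x ⊆ (fun t => t / x) ⁻¹' Icc (-1) 1 := fun t ht =>
    ⟨by rw [le_div_iff₀ hx]; linarith [ht.1], by rw [div_le_iff₀ hx]; linarith [ht.2]⟩
  refine ((h.mono hsub).congr (Eventually.of_forall fun N t _ => ?_)).congr_right fun t _ => ?_
  · simp only [Function.comp_apply, kernelPartial]
    refine Finset.sum_congr rfl fun j _ => ?_
    rw [hβ]
    field_simp
  · simp only [Function.comp_apply]
    rw [mul_div_cancel₀ _ hx.ne']

end Beta

/-! ### Convergence of the Neumann series -/

section Series

variable {b : ℝ} {q f : ℝ → ℂ} {K : ℝ → ℝ → ℂ}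

/-- Transforms of solutions of `-u'' = lam u` are solutions of `-y'' + q y = lam y`. -/
lemma IsTransmutationKernel.isSolution (hb : 0 < b) (hK : IsTransmutationKernel b q f K)
    {u u₁ : ℝ → ℂ} {lam : ℂ} (hu : HasSecondDerivOn (Icc (-b) b) u u₁ (fun t => -lam * u t)) :
    IsSolution b q lam (transmute K u) := by
  obtain ⟨y₁, y₂, hy, hy2⟩ := hK.hasSecondDerivOn hb hu
  refine ⟨hy.contDiffOn hb, fun x hx => ?_⟩
  rw [hy.iteratedDerivWithin_eq hb hx, hy2 x hx, transmute_const_mul]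
  ring

lemma hasDerivAt_cos_mul (ω : ℂ) (x : ℝ) :
    HasDerivAt (fun t : ℝ => Complex.cos (ω * t)) (-ω * Complex.sin (ω * x)) x := by
  have h : HasDerivAt (fun z : ℂ => Complex.cos (ω * z)) (-ω * Complex.sin (ω * x)) x :=
    (((hasDerivAt_id (x : ℂ)).const_mul ω).ccos).congr_deriv (by simp; ring)
  exact h.comp_ofReal

lemma hasDerivAt_sin_mul (ω : ℂ) (x : ℝ) :
    HasDerivAt (fun t : ℝ => Complex.sin (ω * t)) (ω * Complex.cos (ω * x)) x := by
  have h : HasDerivAt (fun z : ℂ => Complex.sin (ω * z)) (ω * Complex.cos (ω * x)) x :=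
    (((hasDerivAt_id (x : ℂ)).const_mul ω).csin).congr_deriv (by simp; ring)
  exact h.comp_ofReal

lemma hasSecondDerivOn_cos (ω : ℂ) (s : Set ℝ) :
    HasSecondDerivOn s (fun t : ℝ => Complex.cos (ω * t)) (fun t => -ω * Complex.sin (ω * t))
      (fun t => -ω ^ 2 * Complex.cos (ω * t)) :=
  ⟨fun x _ => (hasDerivAt_cos_mul ω x).hasDerivWithinAt,
    fun x _ => (((hasDerivAt_sin_mul ω x).const_mul (-ω)).congr_deriv (by ring)).hasDerivWithinAt,
    by fun_prop⟩

lemma hasSecondDerivOn_sin (ω : ℂ) (s : Set ℝ) :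
    HasSecondDerivOn s (fun t : ℝ => Complex.sin (ω * t)) (fun t => ω * Complex.cos (ω * t))
      (fun t => -ω ^ 2 * Complex.sin (ω * t)) :=
  ⟨fun x _ => (hasDerivAt_sin_mul ω x).hasDerivWithinAt,
    fun x _ => (((hasDerivAt_cos_mul ω x).const_mul ω).congr_deriv (by ring)).hasDerivWithinAt,
    by fun_prop⟩

/-- The terms of both Neumann series are dominated by those of an exponential series, uniformly for
`|ω| ≤ R` and `x ∈ [0, b]`. -/
lemma norm_beta_mul_sphericalJ_le {B R : ℝ}
    (hβ : ∀ k, ∀ x ∈ Icc 0 b, ‖beta f k x‖ ≤ 2 ^ (k + 1) * B) (hB : 0 ≤ B) (hR : 0 ≤ R)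
    (k : ℕ) {ω : ℂ} (hω : ‖ω‖ ≤ R) {x : ℝ} (hx : x ∈ Icc 0 b) :
    ‖beta f k x * sphericalJ k (ω * x)‖ ≤
      2 * B * Real.exp ((R * b) ^ 2 / 2) * ((2 * (R * b)) ^ k / k.factorial) := by
  have hz : ‖ω * x‖ ≤ R * b := by
    rw [norm_mul, Complex.norm_real, Real.norm_of_nonneg hx.1]
    exact mul_le_mul hω hx.2 hx.1 hR
  have hRb : 0 ≤ R * b := (norm_nonneg _).trans hz
  have h1 := norm_sphericalJ_le k (ω * x)
  have h2 : ‖ω * x‖ ^ k / k.factorial * Real.exp (‖ω * x‖ ^ 2 / 2) ≤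
      (R * b) ^ k / k.factorial * Real.exp ((R * b) ^ 2 / 2) := by
    gcongr
  rw [norm_mul]
  refine (mul_le_mul (hβ k x hx) (h1.trans h2) (norm_nonneg _) (by positivity)).trans (le_of_eq ?_)
  rw [mul_pow 2, pow_succ]
  ring

/-- The transform of the error `K - K_N` tends to zero. -/
lemma tendsto_integral_sub_kernelPartial
    (hlim : ∀ x ∈ Ioc 0 b, TendstoUniformlyOn (fun (N : ℕ) (t : ℝ) => kernelPartial f N x t) (K x)
      atTop (Icc (-x) x)) {E : ℝ → ℂ} {C : ℝ} (hC : 0 < C)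
    (hE : ∀ t, ‖E t‖ ≤ Real.cosh (C * t)) {x : ℝ} (hx : x ∈ Icc 0 b) :
    Tendsto (fun N => ∫ t in (-x)..x, (K x t - kernelPartial f N x t) * E t) atTop (𝓝 0) := by
  rcases hx.1.eq_or_lt with rfl | h0
  · simp
  · have hs : 0 < Real.sinh (C * x) := Real.sinh_pos_iff.2 (by positivity)
    rw [Metric.tendsto_atTop']
    intro ε hε
    set δ := ε * C / (4 * Real.sinh (C * x)) with hδ
    have hδ0 : 0 < δ := by positivity
    obtain ⟨N₀, hN⟩ := eventually_atTop.1
      (Metric.tendstoUniformlyOn_iff.1 (hlim x ⟨h0, hx.2⟩) δ hδ0)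
    refine ⟨N₀, fun N hN' => ?_⟩
    rw [dist_zero_right]
    refine (norm_integral_mul_le_cosh hx.1 hC hδ0.le (fun t ht => ?_) hE).trans_lt ?_
    · rw [← dist_eq_norm]
      exact (hN N hN'.le t ht).le
    · have : 2 * δ * Real.sinh (C * x) / C = ε / 2 := by
        rw [hδ]
        field_simp
        norm_num
      rw [this]
      exact half_lt_self hε

lemma norm_cos_sin_mul_le {ω : ℂ} {C : ℝ} (hω : |ω.im| ≤ C) (t : ℝ) :
    ‖Complex.cos (ω * t)‖ ≤ Real.cosh (C * t) ∧ ‖Complex.sin (ω * t)‖ ≤ Real.cosh (C * t) := by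
  have h : |(ω * t).im| ≤ |C * t| := by
    rw [Complex.im_mul_ofReal, abs_mul, abs_mul]
    exact mul_le_mul_of_nonneg_right (hω.trans (le_abs_self C)) (abs_nonneg _)
  have := norm_cos_sin_le_cosh h
  rwa [Real.cosh_abs] at this

end Series

end NeumannBessel

theorem mainTheorem1 (b : ℝ) (hb : 0 < b) (q f : ℝ → ℂ)
    (hq : ContinuousOn q (Icc 0 b))
    (hf : IsSolution b q 0 f) (hf0 : f 0 = 1) (hfne : ∀ x ∈ Icc 0 b, f x ≠ 0) :
    ∃ K : ℝ → ℝ → ℂ,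
      -- `K` is the transmutation kernel, and it is the only one on its region
      IsTransmutationKernel b q f K ∧
      (∀ K' : ℝ → ℝ → ℂ, IsTransmutationKernel b q f K' →
        ∀ x ∈ Icc 0 b, ∀ t ∈ Icc (-x) x, K' x t = K x t) ∧
      -- `c` and `s` are solutions
      (∀ ω : ℂ, IsSolution b q (ω ^ 2) (solC K ω) ∧ IsSolution b q (ω ^ 2) (solS K ω)) ∧
      -- the representations with spherical Bessel functions
      (∀ ω : ℂ, ∀ x ∈ Icc 0 b,
        (Summable (fun n => termC f n ω x) ∧
          solC K ω x = Complex.cos (ω * x) + 2 * ∑' n, termC f n ω x) ∧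
        (Summable (fun n => termS f n ω x) ∧
          solS K ω x = Complex.sin (ω * x) + 2 * ∑' n, termS f n ω x)) ∧
      -- the representations with Bessel functions of half-integer order
      (∀ ω : ℂ, ω ≠ 0 → ∀ x ∈ Ioc 0 b,
        (Summable (fun n : ℕ =>
            (-1 : ℂ) ^ n * beta f (2 * n) x * besselJ (2 * n + 1 / 2) (ω * x)) ∧
          solC K ω x = Complex.cos (ω * x) +
            (Real.sqrt (2 * Real.pi) : ℂ) / (ω * x) ^ (1 / 2 : ℂ) *
              ∑' n : ℕ, (-1 : ℂ) ^ n * beta f (2 * n) x * besselJ (2 * n + 1 / 2) (ω * x)) ∧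
        (Summable (fun n : ℕ =>
            (-1 : ℂ) ^ n * beta f (2 * n + 1) x * besselJ (2 * n + 3 / 2) (ω * x)) ∧
          solS K ω x = Complex.sin (ω * x) +
            (Real.sqrt (2 * Real.pi) : ℂ) / (ω * x) ^ (1 / 2 : ℂ) *
              ∑' n : ℕ, (-1 : ℂ) ^ n * beta f (2 * n + 1) x * besselJ (2 * n + 3 / 2) (ω * x))) ∧
      -- uniform convergence, jointly in `x ∈ [0,b]` and in `ω` in a compact set
      (∀ S : Set ℂ, IsCompact S →
        TendstoUniformlyOn
          (fun (M : ℕ) (p : ℂ × ℝ) => ∑ n ∈ Finset.range M, termC f n p.1 p.2)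
          (fun p : ℂ × ℝ => ∑' n, termC f n p.1 p.2) atTop (S ×ˢ Icc 0 b) ∧
        TendstoUniformlyOn
          (fun (M : ℕ) (p : ℂ × ℝ) => ∑ n ∈ Finset.range M, termS f n p.1 p.2)
          (fun p : ℂ × ℝ => ∑' n, termS f n p.1 p.2) atTop (S ×ˢ Icc 0 b)) ∧
      -- `K_N(x,·)` converges uniformly to `K(x,·)`, so that small bounds `ε_N(x)` exist
      (∀ x ∈ Ioc 0 b,
        TendstoUniformlyOn (fun (N : ℕ) (t : ℝ) => kernelPartial f N x t) (K x) atTop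
          (Icc (-x) x)) ∧
      -- the error bounds
      (∀ (N : ℕ) (ε : ℝ → ℝ), (∀ x ∈ Icc 0 b, 0 ≤ ε x) →
        (∀ x ∈ Ioc 0 b, ∀ t ∈ Icc (-x) x, ‖K x t - kernelPartial f N x t‖ ≤ ε x) →
        ∀ x ∈ Icc 0 b,
          (∀ ω : ℝ, ‖solC K ω x - approxC f N ω x‖ ≤ 2 * |x| * ε x ∧
            ‖solS K ω x - approxS f N ω x‖ ≤ 2 * |x| * ε x) ∧
          (∀ C : ℝ, 0 < C → ∀ ω : ℂ, |ω.im| ≤ C →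
            ‖solC K ω x - approxC f N ω x‖ ≤ 2 * ε x * Real.sinh (C * x) / C ∧
            ‖solS K ω x - approxS f N ω x‖ ≤ 2 * ε x * Real.sinh (C * x) / C)) := by
  have hm : (0 : ℝ) ∈ Icc 0 b := ⟨le_rfl, hb.le⟩
  have hfd := HasSecondDerivOn.of_contDiffOn hb hf.1
  set f₁ := derivWithin f (Icc 0 b)
  have hd := hfd.hasDeriv
  have hd1 : ∀ x ∈ Icc 0 b, HasDerivWithinAt f₁ (q x * f x) (Icc 0 b) x := fun x hx =>
    (hfd.hasDeriv₁ x hx).congr_deriv (by linear_combination -(hf.2 x hx))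
  obtain ⟨K, Kt, hK, hKt, hKd⟩ := exists_isTransmutationKernel hb hq hf0 hfne hd hd1
  obtain ⟨C, hC0, hC⟩ := hK.exists_bound
  have hKc : ∀ x, Continuous (K x) := fun x =>
    continuous_iff_continuousAt.2 fun t => (hKd x t).continuousAt
  have hpow := hK.transmute_pow hb hf0 hfne hd hd1
  have hbeta : ∀ k, ∀ x ∈ Icc 0 b, beta f k x = _ := fun k x hx => beta_eq hb hKc hC hpow k hx
  have hbeta0 : ∀ k, beta f k 0 = 0 := fun k => by simp [hbeta k 0 hm]
  have hbetaB : ∀ k, ∀ x ∈ Icc 0 b, ‖beta f k x‖ ≤ 2 ^ (k + 1) * (b * C) := fun k x hx =>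
    norm_beta_le hb hKc hC hpow k hx
  have hlim : ∀ x ∈ Ioc 0 b, TendstoUniformlyOn (fun (N : ℕ) (t : ℝ) => kernelPartial f N x t) (K x)
      atTop (Icc (-x) x) := fun x hx =>
    kernelPartial_tendstoUniformlyOn hKt hKd hx.1 fun k => hbeta k x (Ioc_subset_Icc_self hx)
  -- a majorant for the terms with `|ω| ≤ R`
  set v : ℝ → ℕ → ℝ := fun R k =>
    2 * (b * C) * Real.exp ((R * b) ^ 2 / 2) * ((2 * (R * b)) ^ k / k.factorial) with hv
  have hvs : ∀ R, Summable (v R) := fun R => (Real.summable_pow_div_factorial _).mul_left _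
  have hvC : ∀ R, Summable fun n => v R (2 * n) := fun R =>
    (hvs R).comp_injective fun a c h => by simpa using h
  have hvS : ∀ R, Summable fun n => v R (2 * n + 1) := fun R =>
    (hvs R).comp_injective fun a c h => by simpa using h
  have hbC : 0 ≤ b * C := mul_nonneg hb.le hC0
  have htC : ∀ R, 0 ≤ R → ∀ n ω x, ‖ω‖ ≤ R → x ∈ Icc 0 b → ‖termC f n ω x‖ ≤ v R (2 * n) := by
    intro R hR n ω x hω hx
    rw [termC, mul_assoc, norm_mul, norm_pow, norm_neg, norm_one, one_pow, one_mul]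
    exact norm_beta_mul_sphericalJ_le hbetaB hbC hR _ hω hx
  have htS : ∀ R, 0 ≤ R → ∀ n ω x, ‖ω‖ ≤ R → x ∈ Icc 0 b →
      ‖termS f n ω x‖ ≤ v R (2 * n + 1) := by
    intro R hR n ω x hω hx
    rw [termS, mul_assoc, norm_mul, norm_pow, norm_neg, norm_one, one_pow, one_mul]
    exact norm_beta_mul_sphericalJ_le hbetaB hbC hR _ hω hx
  have hsumC : ∀ ω, ∀ x ∈ Icc 0 b, Summable fun n => termC f n ω x := fun ω x hx =>
    Summable.of_norm_bounded (hvC ‖ω‖) fun n => htC _ (norm_nonneg _) n ω x le_rfl hx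
  have hsumS : ∀ ω, ∀ x ∈ Icc 0 b, Summable fun n => termS f n ω x := fun ω x hx =>
    Summable.of_norm_bounded (hvS ‖ω‖) fun n => htS _ (norm_nonneg _) n ω x le_rfl hx
  have hdiffC : ∀ N ω, ∀ x ∈ Icc 0 b, solC K ω x - approxC f N ω x =
      ∫ t in (-x)..x, (K x t - kernelPartial f N x t) * Complex.cos (ω * t) := by
    intro N ω x hx
    rw [approxC_eq hbeta0 N ω hx.1]
    exact transmute_sub_eq hKc (E := fun t : ℝ => Complex.cos (ω * t)) (by fun_prop) N x
  have hdiffS : ∀ N ω, ∀ x ∈ Icc 0 b, solS K ω x - approxS f N ω x =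
      ∫ t in (-x)..x, (K x t - kernelPartial f N x t) * Complex.sin (ω * t) := by
    intro N ω x hx
    rw [approxS_eq hbeta0 N ω hx.1]
    exact transmute_sub_eq hKc (E := fun t : ℝ => Complex.sin (ω * t)) (by fun_prop) N x
  have hserC : ∀ ω, ∀ x ∈ Icc 0 b,
      solC K ω x = Complex.cos (ω * x) + 2 * ∑' n, termC f n ω x := by
    intro ω x hx
    have h1 := tendsto_integral_sub_kernelPartial hlim (C := |ω.im| + 1) (by positivity)
      (fun t => (norm_cos_sin_mul_le (ω := ω) (by linarith) t).1) hx
    simp only [← hdiffC _ ω x hx] at h1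
    have h2 : Tendsto (fun M => approxC f (2 * M) ω x) atTop
        (𝓝 (Complex.cos (ω * x) + 2 * ∑' n, termC f n ω x)) := by
      have h3 := ((hsumC ω x hx).hasSum.tendsto_sum_nat.comp (tendsto_add_atTop_nat 1)).const_mul 2
      refine (h3.const_add (Complex.cos (ω * x))).congr fun M => ?_
      rw [approxC, show 2 * M / 2 = M by omega]
      rfl
    -- along `N = 2M` the truncations are partial sums of the series
    have h4 := h1.comp (tendsto_id.const_mul_atTop' (r := 2) two_pos)
    exact sub_eq_zero.1 (tendsto_nhds_unique (tendsto_const_nhds.sub h2) h4)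
  have hserS : ∀ ω, ∀ x ∈ Icc 0 b,
      solS K ω x = Complex.sin (ω * x) + 2 * ∑' n, termS f n ω x := by
    intro ω x hx
    have h1 := tendsto_integral_sub_kernelPartial hlim (C := |ω.im| + 1) (by positivity)
      (fun t => (norm_cos_sin_mul_le (ω := ω) (by linarith) t).2) hx
    simp only [← hdiffS _ ω x hx] at h1
    have h2 : Tendsto (fun M => approxS f (2 * M) ω x) atTop
        (𝓝 (Complex.sin (ω * x) + 2 * ∑' n, termS f n ω x)) := by
      have h3 := (hsumS ω x hx).hasSum.tendsto_sum_nat.const_mul 2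
      refine (h3.const_add (Complex.sin (ω * x))).congr fun M => ?_
      rw [approxS, show (2 * M + 1) / 2 = M by omega]
    have h4 := h1.comp (tendsto_id.const_mul_atTop' (r := 2) two_pos)
    exact sub_eq_zero.1 (tendsto_nhds_unique (tendsto_const_nhds.sub h2) h4)
  have hsqrt : (Real.sqrt (2 * Real.pi) : ℂ) ≠ 0 := by
    exact_mod_cast (Real.sqrt_pos.2 (by positivity)).ne'
  refine ⟨K, hK, fun K' hK' => hK.unique hb hf0 hfne hd hd1 hK',
    fun ω => ⟨hK.isSolution hb (hasSecondDerivOn_cos ω _),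
      hK.isSolution hb (hasSecondDerivOn_sin ω _)⟩,
    fun ω x hx => ⟨⟨hsumC ω x hx, hserC ω x hx⟩, ⟨hsumS ω x hx, hserS ω x hx⟩⟩, ?_, ?_, hlim, ?_⟩
  · intro ω hω x hx
    have hx' : x ∈ Icc 0 b := Ioc_subset_Icc_self hx
    have hz : ω * x ≠ 0 := mul_ne_zero hω (by exact_mod_cast hx.1.ne')
    have hzp : (ω * x) ^ (1 / 2 : ℂ) ≠ 0 := by
      rw [Complex.cpow_def_of_ne_zero hz]
      exact Complex.exp_ne_zero _
    have eC : ∀ n : ℕ, (-1 : ℂ) ^ n * beta f (2 * n) x * besselJ (2 * n + 1 / 2) (ω * x) =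
        2 * (ω * x) ^ (1 / 2 : ℂ) / (Real.sqrt (2 * Real.pi) : ℂ) * termC f n ω x := fun n => by
      have := besselJ_nat_add_half (2 * n) hz
      push_cast at this
      rw [this, termC]
      ring
    have eS : ∀ n : ℕ, (-1 : ℂ) ^ n * beta f (2 * n + 1) x * besselJ (2 * n + 3 / 2) (ω * x) =
        2 * (ω * x) ^ (1 / 2 : ℂ) / (Real.sqrt (2 * Real.pi) : ℂ) * termS f n ω x := fun n => by
      have := besselJ_nat_add_half (2 * n + 1) hz
      push_cast at this
      rw [show (2 * (n : ℂ) + 3 / 2) = 2 * n + 1 + 1 / 2 by ring, this, termS]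
      ring
    simp only [eC, eS]
    refine ⟨⟨(hsumC ω x hx').mul_left _, ?_⟩, ⟨(hsumS ω x hx').mul_left _, ?_⟩⟩
    · rw [hserC ω x hx', tsum_mul_left]
      field_simp
    · rw [hserS ω x hx', tsum_mul_left]
      field_simp
  · intro S hS
    obtain ⟨R, hR⟩ := hS.isBounded.exists_norm_le
    have hR' : ∀ ω ∈ S, ‖ω‖ ≤ max R 0 := fun ω hω => (hR ω hω).trans (le_max_left _ _)
    exact ⟨tendstoUniformlyOn_tsum_nat (hvC (max R 0)) fun n p hp =>
        htC _ (le_max_right _ _) n p.1 p.2 (hR' _ hp.1) hp.2,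
      tendstoUniformlyOn_tsum_nat (hvS (max R 0)) fun n p hp =>
        htS _ (le_max_right _ _) n p.1 p.2 (hR' _ hp.1) hp.2⟩
  · intro N ε hε hKN x hx
    rcases hx.1.eq_or_lt with rfl | h0
    · refine ⟨fun ω => ?_, fun c hc ω _ => ?_⟩ <;> rw [hdiffC _ _ _ hx, hdiffS _ _ _ hx] <;> simp
    · have hD : ∀ t ∈ Icc (-x) x, ‖K x t - kernelPartial f N x t‖ ≤ ε x := hKN x ⟨h0, hx.2⟩
      refine ⟨fun ω => ?_, fun c hc ω hω => ?_⟩ <;> rw [hdiffC _ _ _ hx, hdiffS _ _ _ hx]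
      · have hE := norm_cos_sin_mul_le (ω := ω) (C := 0) (by simp)
        simp only [zero_mul, Real.cosh_zero] at hE
        exact ⟨norm_integral_mul_le_const hx.1 (hε x hx) hD fun t => (hE t).1,
          norm_integral_mul_le_const hx.1 (hε x hx) hD fun t => (hE t).2⟩
      · have hE := norm_cos_sin_mul_le hω
        exact ⟨norm_integral_mul_le_cosh hx.1 hc (hε x hx) hD fun t => (hE t).1,
          norm_integral_mul_le_cosh hx.1 hc (hε x hx) hD fun t => (hE t).2⟩
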